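/- Let $n\ge 1$, $\nu=(\nu_1,\dots,\nu_n)\in(-1/2,\infty)^n$ and $k,\alpha\in\mathbb N^n$ (with $0\in\mathbb N$), and let $\mathbb R^n_+=(0,\infty)^n$ carry Lebesgue measure. For $\mu\in(-1/2,\infty)^n$ let $\Delta_\mu$ be the non-negative self-adjoint realization in $L^2(\mathbb R^n_+)$ of the Bessel operator $$-\sum_{j=1}^n\Big(\frac{\partial^2}{\partial x_j^2}-\frac{\mu_j^2-1/4}{x_j^2}\Big)$$ that is diagonalized by its generalized eigenfunctions $\varphi_y(x)=\prod_{j=1}^n (x_jy_j)^{1/2}J_{\mu_j}(x_jy_j)$, $\Delta_\mu\varphi_y=|y|^2\varphi_y$ ($y\in\mathbb R^n_+$, $J_a$ the Bessel function of the first kind); that is, the unitary Hankel transform $f\mapsto\int_{\mathbb R^n_+}\varphi_y(x)f(x)\,dx$ turns $\Delta_\mu$ into multiplication by $|y|^2$. For $s\ge 0$ let $\Delta_\mu^{-s}$ be defined by the spectral theorem, with domain the set of $f\in L^2(\mathbb R^n_+)$ such that $\int_0^\infty\lambda^{-2s}\,d\langle E(\lambda)f,f\rangle<\infty$, where $E$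 is the spectral resolution of $\Delta_\mu$. Put $|k|=k_1+\dots+k_n$ and $\delta_\mu^k=\delta_{\mu_n}^{k_n}\cdots\delta_{\mu_1}^{k_1}$, where $\delta_{\mu_j}=\frac{\partial}{\partial x_j}-\frac1{x_j}\big(\mu_j+\frac12\big)$ acts in the sense of distributions on $\mathbb R^n_+$. Then, for every $1<p<\infty$, the operator $$\delta_\nu^k\Delta_\nu^{-|k|/2}-\delta_{\nu+\alpha}^k\Delta_{\nu+\alpha}^{-|k|/2}$$ is bounded on $L^p(\mathbb R^n_+)$: the set of $f\in L^p(\mathbb R^n_+)\cap L^2(\mathbb R^n_+)$ that lie in the domains of both $\Delta_\nu^{-|k|/2}$ and $\Delta_{\nu+\alpha}^{-|k|/2}$ is dense in $L^p(\mathbb R^n_+)$, and on this set the operator coincides with (the restriction of) a bounded linear operator from $L^p(\mathbb R^n_+)$ to itself. -/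

import Mathlib

open MeasureTheory Set TopologicalSpace
open scoped ENNReal Distributions

namespace BesselRiesz

/-- The open orthant `ℝ^n_+ = (0, ∞)^n`. Points are plain coordinate vectors; the Euclidean norm is
always written out as a sum of squares. -/
def orthant (n : ℕ) : Opens (Fin n → ℝ) where
  carrier := {x | ∀ j, 0 < x j}
  is_open' := by
    have h : {x : Fin n → ℝ | ∀ j, 0 < x j} = ⋂ j, {x | 0 < x j} := by
      ext x
      simp
    rw [h]
    exact isOpen_iInter_of_finite fun j => isOpen_lt continuous_const (continuous_apply j)

/-- Lebesgue measure on the orthant. -/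
noncomputable def orthantMeasure (n : ℕ) : Measure (Fin n → ℝ) :=
  volume.restrict (orthant n : Set (Fin n → ℝ))

/-- The Bessel function of the first kind
`J_a(z) = ∑_m (-1)^m / (m! Γ(m + a + 1)) (z / 2)^(2 m + a)`, used for `z > 0` and `a > -1`. -/
noncomputable def besselJ (a z : ℝ) : ℝ :=
  ∑' m : ℕ, (-1) ^ m / ((m.factorial : ℝ) * Real.Gamma (m + a + 1)) *
    (z / 2) ^ (2 * (m : ℝ) + a)

/-- The generalized eigenfunctions `φ_y(x) = ∏_j (x_j y_j)^(1/2) J_{ν_j}(x_j y_j)` of the Bessel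
operator, `Δ_ν φ_y = |y|² φ_y`; the expression is symmetric in `x` and `y`. -/
noncomputable def eigenfunction {n : ℕ} (ν : Fin n → ℝ) (y x : Fin n → ℝ) : ℝ :=
  ∏ j, Real.sqrt (x j * y j) * besselJ (ν j) (x j * y j)

/-- The Hankel transform `y ↦ ∫ φ_y(x) φ(x) dx` of a test function. -/
noncomputable def hankelTest {n : ℕ} (ν : Fin n → ℝ) (φ : 𝓓(orthant n, ℝ)) (y : Fin n → ℝ) : ℝ :=
  ∫ x, eigenfunction ν y x * φ x ∂(orthantMeasure n)

/-- `h` is the Hankel transform of `f`, for `f, h ∈ L²(ℝ^n_+)`. The Hankel transform on `L²` is the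
continuous extension of the one on test functions. It is unitary, symmetric and its own inverse,
so that `h` is determined by pairing with test functions. -/
def IsHankelTransform {n : ℕ} (ν : Fin n → ℝ) (f h : (Fin n → ℝ) → ℂ) : Prop :=
  MemLp f 2 (orthantMeasure n) ∧ MemLp h 2 (orthantMeasure n) ∧
    ∀ φ : 𝓓(orthant n, ℝ),
      ∫ y, φ y • h y ∂(orthantMeasure n) = ∫ x, hankelTest ν φ x • f x ∂(orthantMeasure n)

/-- `g = Δ_ν^{-s} f` in the sense of the spectral theorem in `L²(ℝ^n_+)`. The Hankel transform
diagonalizes the self-adjoint operator `Δ_ν`, turning it into multiplication by `|y|²`; hence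
`f` lies in the domain of `Δ_ν^{-s}` when `|y|^{-2s}` times its Hankel transform is in `L²`
(that is, `∫ λ^{-2s} d⟨E(λ) f, f⟩ < ∞`), and `Δ_ν^{-s} f` is then the (inverse) Hankel transform of
that product. -/
def IsNegPower {n : ℕ} (ν : Fin n → ℝ) (s : ℝ) (f g : (Fin n → ℝ) → ℂ) : Prop :=
  ∃ h : (Fin n → ℝ) → ℂ, IsHankelTransform ν f h ∧
    IsHankelTransform ν (fun y => ((∑ j, y j ^ 2) ^ (-s)) • h y) g

/-- The formal adjoint `δ_a^* = -∂/∂x_j - (a + 1/2) / x_j`, in the variable `x_j`, of the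
derivative `δ_a = ∂/∂x_j - (a + 1/2) / x_j`. -/
noncomputable def deltaAdj {n : ℕ} (a : ℝ) (j : Fin n) (φ : (Fin n → ℝ) → ℝ) :
    (Fin n → ℝ) → ℝ :=
  fun x => -fderiv ℝ φ x (Pi.single j 1) - (a + 1 / 2) / x j * φ x

/-- The formal adjoint `(δ_{ν_1}^*)^{k_1} ⋯ (δ_{ν_n}^*)^{k_n}` of
`δ_ν^k = δ_{ν_n}^{k_n} ⋯ δ_{ν_1}^{k_1}`. -/
noncomputable def deltaAdjPow {n : ℕ} (ν : Fin n → ℝ) (k : Fin n → ℕ) (φ : (Fin n → ℝ) → ℝ) :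
    (Fin n → ℝ) → ℝ :=
  (List.finRange n).foldr (fun j ψ => (deltaAdj (ν j) j)^[k j] ψ) φ

/-- The distribution `δ_ν^k g` on the orthant, for a locally integrable function `g`. -/
noncomputable def deltaPowDist {n : ℕ} (ν : Fin n → ℝ) (k : Fin n → ℕ) (g : (Fin n → ℝ) → ℂ)
    (φ : 𝓓(orthant n, ℝ)) : ℂ :=
  ∫ x, deltaAdjPow ν k φ x • g x ∂(orthantMeasure n)

/-- `f` lies in the `L²`-domain of `Δ_ν^{-|k|/2}`, and `R` is the distribution
`δ_ν^k Δ_ν^{-|k|/2} f` on the orthant. -/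
def IsRieszTransform {n : ℕ} (ν : Fin n → ℝ) (k : Fin n → ℕ) (f : (Fin n → ℝ) → ℂ)
    (R : 𝓓(orthant n, ℝ) → ℂ) : Prop :=
  ∃ g : (Fin n → ℝ) → ℂ, IsNegPower ν (((∑ j, k j : ℕ) : ℝ) / 2) f g ∧ R = deltaPowDist ν k g

/-- The common `L²`-domain of `δ_ν^k Δ_ν^{-|k|/2}` and `δ_μ^k Δ_μ^{-|k|/2}`, intersected with
`L^p`: the initial domain of the difference of the two Riesz transforms. -/
def differenceDomain {n : ℕ} (ν μ : Fin n → ℝ) (k : Fin n → ℕ) (p : ℝ≥0∞) :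
    Set (Lp ℂ p (orthantMeasure n)) :=
  {f | (∃ R, IsRieszTransform ν k f R) ∧ ∃ R', IsRieszTransform μ k f R'}

end BesselRiesz

/-!
The difference of the two Riesz transforms is an integral operator whose kernel is much less
singular than either of the two kernels.

For `|k| ≥ 1`, subordination `|y|^(-2s) = Γ(s)⁻¹ ∫_0^∞ t^(s-1) e^(-t|y|²) dt` with `s = |k| / 2`
writes `δ_ν^k Δ_ν^(-s)` as `Γ(s)⁻¹ ∫_0^∞ t^(s-1) δ_ν^k e^(-tΔ_ν) dt`. The heat kernel of `Δ_ν` is a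
product of one-dimensional kernels (Weber's second exponential integral,
`integral_gaussian_mul_besselJ`), and Poisson's integral for the modified Bessel function shows each
of these, together with its derivatives, as an average of Gaussians over the Gegenbauer weight
`(1 - s²)^(ν - 1/2)`; see `heatKernel` and `hasDerivAt_heatKernel`. From this representation one
reads off that the `m`-th derivative is bounded by `t^(-(m+1)/2) e^(-(x-z)²/8t)`, and that changing
`ν` to `ν + 1` changes it by at most `(t / xz)^η` times this bound, for every `0 ≤ η ≤ 1/2`
(`abs_heatKernel_le`, `abs_heatKernel_sub_add_nat_le`): away from the boundary the two kernels nearly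
agree. Integrating in `t`, the difference of the two Riesz kernels is dominated by a sum of kernels
(`majorant`) that are homogeneous in one variable `x_j`. The Schur test with a power of `x_j` as
weight bounds these on `L^p` when `η < min(1/p, 1/p')` (`lintegral_majorant_schur`), and
`exists_diffOperator` gives the operator `T`.

To identify `T` with the difference of the distributions `δ_ν^k Δ_ν^(-s) f`, the derivatives are
moved to the test function, and the Hankel transform on `L²` is handled through its values on test
functions: it is bounded (`eLpNorm_hankelTest_le`), symmetric (`integral_mul_hankelTest_comm`) and
its own inverse, all of which follow from the Gaussian-regularized Parseval formula
`integral_gaussian_mul_hankelTest`. This yields `integral_gaussian_hankelTest_smul` and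
`rieszTransform_sub_eq`. For `|k| = 0` the same estimates show that the difference of the two heat
semigroups is integrable against `dt / t`, so that its limit at `t = 0`, the difference of the two
identity operators, is zero.

The domain is dense because it contains the test functions that have sufficiently many vanishing
moments in one variable: their Hankel transforms vanish at the origin to an order that compensates
`|y|^(-|k|)` (`abs_hankelTest_le_pow`). Such functions are dense in `L^p`, since subtracting a
dilate that is spread out far enough kills a moment at a small cost
(`exists_momentVanishes_approx`).
-/

namespace BesselRiesz

variable {n : ℕ}

/-! ### The Gegenbauer weight -/

/-- The measure `(1 - s²)^(ν - 1/2) ds` on `(-1, 1)`. -/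
noncomputable def gegenbauer (ν : ℝ) : Measure ℝ :=
  (volume.restrict (Ioo (-1) 1)).withDensity fun s => ENNReal.ofReal ((1 - s ^ 2) ^ (ν - 1 / 2))

lemma one_sub_sq_pos {s : ℝ} (hs : s ∈ Ioo (-1 : ℝ) 1) : 0 < 1 - s ^ 2 := by
  nlinarith [hs.1, hs.2]

lemma one_sub_sq_rpow_le {a s : ℝ} (hs : s ∈ Ioo (-1 : ℝ) 1) :
    (1 - s ^ 2) ^ a ≤ (1 - s) ^ a + (1 + s) ^ a + 1 := by
  have h1 : 0 < 1 - s := by linarith [hs.2]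
  have h2 : 0 < 1 + s := by linarith [hs.1]
  have e : (1 - s ^ 2) ^ a = (1 - s) ^ a * (1 + s) ^ a := by
    rw [← Real.mul_rpow h1.le h2.le]; ring_nf
  have p1 := Real.rpow_pos_of_pos h1 a
  have p2 := Real.rpow_pos_of_pos h2 a
  rcases le_or_gt 0 a with ha | ha
  · have : (1 - s ^ 2) ^ a ≤ 1 :=
      Real.rpow_le_one (one_sub_sq_pos hs).le (by nlinarith [sq_nonneg s]) ha
    linarith
  · rw [e]
    rcases le_or_gt 0 s with h | h
    · have : (1 + s) ^ a ≤ 1 := Real.rpow_le_one_of_one_le_of_nonpos (by linarith) ha.le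
      nlinarith
    · have : (1 - s) ^ a ≤ 1 := Real.rpow_le_one_of_one_le_of_nonpos (by linarith) ha.le
      nlinarith

lemma integrableOn_one_add_rpow {a : ℝ} (ha : -1 < a) :
    IntegrableOn (fun s : ℝ => (1 + s) ^ a) (Ioo (-1) 1) := by
  have h := (intervalIntegral.intervalIntegrable_rpow' (a := 0) (b := 2) ha).comp_add_left 1
  norm_num at h
  exact ((intervalIntegrable_iff_integrableOn_Ioc_of_le (by norm_num)).1 h).mono_set
    Ioo_subset_Ioc_self

lemma integrableOn_one_sub_rpow {a : ℝ} (ha : -1 < a) :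
    IntegrableOn (fun s : ℝ => (1 - s) ^ a) (Ioo (-1) 1) := by
  have h := (intervalIntegral.intervalIntegrable_rpow' (a := 2) (b := 0) ha).comp_sub_left 1
  norm_num at h
  exact ((intervalIntegrable_iff_integrableOn_Ioc_of_le (by norm_num)).1 h).mono_set
    Ioo_subset_Ioc_self

lemma integrableOn_one_sub_sq_rpow {a : ℝ} (ha : -1 < a) :
    IntegrableOn (fun s : ℝ => (1 - s ^ 2) ^ a) (Ioo (-1) 1) := by
  have h := ((integrableOn_one_sub_rpow ha).add (integrableOn_one_add_rpow ha)).add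
    (integrableOn_const (μ := volume) (s := Ioo (-1 : ℝ) 1) (C := (1 : ℝ)) (by simp))
  refine Integrable.mono' h (Measurable.aestronglyMeasurable (by fun_prop)) ?_
  filter_upwards [ae_restrict_mem measurableSet_Ioo] with s hs
  rw [Real.norm_of_nonneg (Real.rpow_nonneg (one_sub_sq_pos hs).le _)]
  exact one_sub_sq_rpow_le hs

lemma isFiniteMeasure_gegenbauer {ν : ℝ} (hν : -(1 / 2) < ν) : IsFiniteMeasure (gegenbauer ν) := by
  refine isFiniteMeasure_withDensity ?_
  have h := (integrableOn_one_sub_sq_rpow (a := ν - 1 / 2) (by linarith)).lintegral_lt_top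
  exact h.ne

lemma integral_gegenbauer (ν : ℝ) (g : ℝ → ℝ) :
    ∫ s, g s ∂gegenbauer ν = ∫ s in Ioo (-1) 1, (1 - s ^ 2) ^ (ν - 1 / 2) * g s := by
  rw [gegenbauer, integral_withDensity_eq_integral_toReal_smul (by fun_prop) (by simp)]
  refine setIntegral_congr_fun measurableSet_Ioo fun s hs => ?_
  simp only [smul_eq_mul]
  rw [ENNReal.toReal_ofReal (Real.rpow_nonneg (one_sub_sq_pos hs).le _)]

lemma ae_gegenbauer_mem (ν : ℝ) : ∀ᵐ s ∂gegenbauer ν, s ∈ Ioo (-1 : ℝ) 1 := by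
  refine (withDensity_absolutelyContinuous _ _).ae_le ?_
  exact ae_restrict_mem measurableSet_Ioo

lemma integral_gegenbauer_add_one (ν : ℝ) (g : ℝ → ℝ) :
    ∫ s, g s ∂gegenbauer (ν + 1) = ∫ s, (1 - s ^ 2) * g s ∂gegenbauer ν := by
  rw [integral_gegenbauer, integral_gegenbauer]
  refine setIntegral_congr_fun measurableSet_Ioo fun s hs => ?_
  have h := one_sub_sq_pos hs
  rw [show ν + 1 - 1 / 2 = (ν - 1 / 2) + 1 by ring, Real.rpow_add h, Real.rpow_one]
  ring

lemma integrable_gegenbauer {ν : ℝ} (hν : -(1 / 2) < ν) {g : ℝ → ℝ} (hg : Continuous g) :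
    Integrable g (gegenbauer ν) := by
  have := isFiniteMeasure_gegenbauer hν
  obtain ⟨C, hC⟩ := (isCompact_Icc (a := (-1 : ℝ)) (b := 1)).exists_bound_of_continuousOn
    hg.continuousOn
  refine Integrable.of_bound hg.aestronglyMeasurable C ?_
  filter_upwards [ae_gegenbauer_mem ν] with s hs using hC s (Ioo_subset_Icc_self hs)

/-- Integration by parts against the Gegenbauer weight. -/
lemma gegenbauer_integral_by_parts {ν : ℝ} (hν : -(1 / 2) < ν) {G G' : ℝ → ℝ}
    (hG : ∀ s, HasDerivAt G (G' s) s) (hG' : Continuous G') :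
    ∫ s, (1 - s ^ 2) * G' s ∂gegenbauer ν = (2 * ν + 1) * ∫ s, s * G s ∂gegenbauer ν := by
  have hGc : Continuous G := continuous_iff_continuousAt.2 fun s => (hG s).continuousAt
  have i1 := integrable_gegenbauer hν (g := fun s => (1 - s ^ 2) * G' s) (by fun_prop)
  have i2 := integrable_gegenbauer hν (g := fun s => (2 * ν + 1) * (s * G s)) (by fun_prop)
  rw [← integral_const_mul, ← sub_eq_zero, ← integral_sub i1 i2, integral_gegenbauer]
  have key := intervalIntegral.integral_eq_sub_of_hasDerivAt_of_le (a := -1) (b := 1)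
    (f := fun s => (1 - s ^ 2) ^ (ν + 1 / 2) * G s)
    (f' := fun s => (1 - s ^ 2) ^ (ν - 1 / 2) * ((1 - s ^ 2) * G' s - (2 * ν + 1) * (s * G s)))
    (by norm_num) ?_ ?_ ?_
  · rw [intervalIntegral.integral_of_le (by norm_num), integral_Ioc_eq_integral_Ioo] at key
    rw [key]
    simp [Real.zero_rpow (show ν + 2⁻¹ ≠ 0 by linarith)]
  · refine ContinuousOn.mul ?_ hGc.continuousOn
    refine Continuous.continuousOn (Continuous.rpow_const (by fun_prop) fun s => Or.inr ?_)
    linarith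
  · intro s hs
    have h := one_sub_sq_pos hs
    have d1 : HasDerivAt (fun s : ℝ => 1 - s ^ 2) (-(2 * s)) s := by
      simpa using (hasDerivAt_pow 2 s).const_sub 1
    have d2 := (d1.rpow_const (p := ν + 1 / 2) (Or.inl h.ne')).mul (hG s)
    refine d2.congr_deriv ?_
    rw [show ν + 1 / 2 - 1 = ν - 1 / 2 by ring, show ν + 1 / 2 = ν - 1 / 2 + 1 by ring,
      Real.rpow_add h, Real.rpow_one]
    ring
  · rw [intervalIntegrable_iff_integrableOn_Ioo_of_le (by norm_num)]
    obtain ⟨C, hC⟩ := (isCompact_Icc (a := (-1 : ℝ)) (b := 1)).exists_bound_of_continuousOn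
      (f := fun s => (1 - s ^ 2) * G' s - (2 * ν + 1) * (s * G s)) (by fun_prop)
    refine Integrable.mul_bdd (c := C) (integrableOn_one_sub_sq_rpow (by linarith)) (by fun_prop) ?_
    filter_upwards [ae_restrict_mem measurableSet_Ioo] with s hs using hC s (Ioo_subset_Icc_self hs)

/-- The total mass of the Gegenbauer weight. -/
noncomputable def gegenbauerMass (ν : ℝ) : ℝ := ∫ _s, 1 ∂gegenbauer ν

lemma gegenbauerMass_pos {ν : ℝ} (hν : -(1 / 2) < ν) : 0 < gegenbauerMass ν := by
  rw [gegenbauerMass, integral_gegenbauer]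
  simp only [mul_one]
  rw [setIntegral_pos_iff_support_of_nonneg_ae]
  · have : Ioo (-1 : ℝ) 1 ⊆ Function.support (fun s : ℝ => (1 - s ^ 2) ^ (ν - 1 / 2)) :=
      fun s hs => (Real.rpow_pos_of_pos (one_sub_sq_pos hs) _).ne'
    rw [inter_eq_right.2 this]
    simp
  · filter_upwards [ae_restrict_mem measurableSet_Ioo] with s hs
    exact Real.rpow_nonneg (one_sub_sq_pos hs).le _
  · exact integrableOn_one_sub_sq_rpow (by linarith)

/-- The recursion between the moments of the Gegenbauer weight. -/
lemma gegenbauer_moment_succ {ν : ℝ} (hν : -(1 / 2) < ν) (m : ℕ) :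
    (m + 2 * ν + 2) * ∫ s, s ^ (m + 2) ∂gegenbauer ν
      = (m + 1) * ∫ s, s ^ m ∂gegenbauer ν := by
  have h := gegenbauer_integral_by_parts hν (G := fun s => s ^ (m + 1))
    (G' := fun s => (m + 1) * s ^ m) (fun s => by simpa using hasDerivAt_pow (m + 1) s)
    (by fun_prop)
  have e1 : ∀ s : ℝ, (1 - s ^ 2) * ((m + 1) * s ^ m)
      = (m + 1) * s ^ m - (m + 1) * s ^ (m + 2) := fun s => by ring
  have e2 : ∀ s : ℝ, s * s ^ (m + 1) = s ^ (m + 2) := fun s => by ring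
  simp only [e1, e2] at h
  rw [integral_sub (integrable_gegenbauer hν (by fun_prop))
    (integrable_gegenbauer hν (by fun_prop)), integral_const_mul, integral_const_mul] at h
  linarith

lemma gegenbauer_moment_odd {ν : ℝ} (hν : -(1 / 2) < ν) (j : ℕ) :
    ∫ s, s ^ (2 * j + 1) ∂gegenbauer ν = 0 := by
  induction j with
  | zero =>
    have h := gegenbauer_integral_by_parts hν (G := fun _ => 1) (G' := fun _ => 0)
      (fun s => hasDerivAt_const s 1) (by fun_prop)
    simp only [mul_zero, integral_zero, mul_one] at h
    have : 2 * ν + 1 ≠ 0 := by linarith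
    simpa [this] using h.symm
  | succ j ih =>
    have h := gegenbauer_moment_succ hν (2 * j + 1)
    rw [ih, mul_zero] at h
    have : ((2 * j + 1 : ℕ) : ℝ) + 2 * ν + 2 ≠ 0 := by push_cast; have := j.cast_nonneg (α := ℝ); linarith
    exact (mul_eq_zero.1 h).resolve_left this

lemma gegenbauer_moment_even {ν : ℝ} (hν : -(1 / 2) < ν) (j : ℕ) :
    (∫ s, s ^ (2 * j) ∂gegenbauer ν) / ((2 * j).factorial : ℝ)
      = gegenbauerMass ν * Real.Gamma (ν + 1) / (4 ^ j * j.factorial * Real.Gamma (j + ν + 1)) := by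
  have hG : ∀ j : ℕ, 0 < Real.Gamma (j + ν + 1) := fun j =>
    Real.Gamma_pos_of_pos (by have := j.cast_nonneg (α := ℝ); linarith)
  induction j with
  | zero =>
    have := (hG 0).ne'
    simp only [Nat.cast_zero, zero_add] at this
    simp [gegenbauerMass]
    field_simp
  | succ j ih =>
    have h := gegenbauer_moment_succ hν (2 * j)
    have e : Real.Gamma ((j + 1 : ℕ) + ν + 1) = (j + ν + 1) * Real.Gamma (j + ν + 1) := by
      rw [← Real.Gamma_add_one (by have := j.cast_nonneg (α := ℝ); linarith)]
      push_cast; ring_nf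
    have hj : (0 : ℝ) < j + ν + 1 := by have := j.cast_nonneg (α := ℝ); linarith
    have hG' := hG j
    rw [e, show 2 * (j + 1) = 2 * j + 2 by ring, Nat.factorial_succ, Nat.factorial_succ,
      Nat.factorial_succ]
    have h2 : ∫ s, s ^ (2 * j + 2) ∂gegenbauer ν
        = (2 * j + 1) / (2 * (j + ν + 1)) * ∫ s, s ^ (2 * j) ∂gegenbauer ν := by
      push_cast at h
      field_simp
      linarith
    have h3 : ∫ s, s ^ (2 * j) ∂gegenbauer ν = gegenbauerMass ν * Real.Gamma (ν + 1)
        / (4 ^ j * j.factorial * Real.Gamma (j + ν + 1)) * ((2 * j).factorial : ℝ) := by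
      rw [← ih]; field_simp
    rw [h2, h3]
    push_cast
    field_simp
    ring

lemma gegenbauerMass_add_one {ν : ℝ} (hν : -(1 / 2) < ν) :
    (2 * ν + 2) * gegenbauerMass (ν + 1) = (2 * ν + 1) * gegenbauerMass ν := by
  have h := gegenbauer_moment_succ hν 0
  have h1 : gegenbauerMass (ν + 1)
      = gegenbauerMass ν - ∫ s, s ^ 2 ∂gegenbauer ν := by
    rw [gegenbauerMass, integral_gegenbauer_add_one, gegenbauerMass,
      ← integral_sub (integrable_gegenbauer hν (by fun_prop))
        (integrable_gegenbauer hν (by fun_prop))]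
    simp
  simp only [Nat.cast_zero, zero_add, one_mul, pow_zero] at h
  rw [h1]
  simp only [gegenbauerMass] at *
  linarith

/-- Poisson's integral for the modified Bessel function, as a power series. -/
lemma hasSum_integral_exp_gegenbauer {ν : ℝ} (hν : -(1 / 2) < ν) (w : ℝ) :
    HasSum (fun j : ℕ => gegenbauerMass ν * Real.Gamma (ν + 1) *
      ((w / 2) ^ (2 * j) / (j.factorial * Real.Gamma (j + ν + 1))))
      (∫ s, Real.exp (-(w * s)) ∂gegenbauer ν) := by
  have := isFiniteMeasure_gegenbauer hν
  have hs : ∀ s : ℝ, ∑' N : ℕ, (-(w * s)) ^ N / (N.factorial : ℝ) = Real.exp (-(w * s)) :=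
    fun s => by rw [Real.exp_eq_exp_ℝ, NormedSpace.exp_eq_tsum_div]
  have h := hasSum_integral_of_summable_integral_norm (μ := gegenbauer ν)
    (F := fun (N : ℕ) s => (-(w * s)) ^ N / (N.factorial : ℝ))
    (fun N => integrable_gegenbauer hν (by fun_prop)) ?_
  · simp only [hs] at h
    have hinj : Function.Injective (fun j : ℕ => 2 * j) := fun a b h => by simpa using h
    rw [← hinj.hasSum_iff] at h
    · have e2 : ((fun N : ℕ => ∫ s, (-(w * s)) ^ N / (N.factorial : ℝ) ∂gegenbauer ν) ∘
          fun j => 2 * j) = fun j : ℕ => gegenbauerMass ν * Real.Gamma (ν + 1) *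
            ((w / 2) ^ (2 * j) / (j.factorial * Real.Gamma (j + ν + 1))) := by
        funext j
        have e : ∀ s : ℝ, (-(w * s)) ^ (2 * j) / ((2 * j).factorial : ℝ)
            = w ^ (2 * j) * (s ^ (2 * j) / ((2 * j).factorial : ℝ)) := fun s => by
          rw [pow_mul, neg_sq, ← pow_mul]; ring
        simp only [Function.comp, e]
        rw [integral_const_mul, integral_div, gegenbauer_moment_even hν, div_pow, pow_mul 2 2 j]
        norm_num
        ring
      rw [e2] at h
      exact h
    · intro N hN
      obtain ⟨j, rfl⟩ : Odd N := by
        rw [← Nat.not_even_iff_odd, even_iff_exists_two_mul]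
        rintro ⟨j, rfl⟩
        exact hN ⟨j, rfl⟩
      have e : ∀ s : ℝ, (-(w * s)) ^ (2 * j + 1) / ((2 * j + 1).factorial : ℝ)
          = (-w) ^ (2 * j + 1) / ((2 * j + 1).factorial : ℝ) * s ^ (2 * j + 1) := fun s => by
        rw [← neg_mul, mul_pow]; ring
      simp only [e]
      rw [integral_const_mul, gegenbauer_moment_odd hν, mul_zero]
  · refine Summable.of_nonneg_of_le (fun N => integral_nonneg fun s => norm_nonneg _)
      (f := fun N : ℕ => gegenbauerMass ν * (|w| ^ N / (N.factorial : ℝ))) (fun N => ?_)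
      ((Real.summable_pow_div_factorial |w|).mul_left _)
    rw [mul_comm, gegenbauerMass, ← integral_const_mul]
    refine integral_mono_ae (integrable_gegenbauer hν (by fun_prop)).norm
      (integrable_gegenbauer hν (by fun_prop)) ?_
    filter_upwards [ae_gegenbauer_mem ν] with s hs
    simp only [norm_div, norm_pow, norm_neg, norm_mul, Real.norm_eq_abs, mul_one, Nat.abs_cast]
    gcongr
    have : |s| ≤ 1 := abs_le.2 ⟨hs.1.le, hs.2.le⟩
    nlinarith [abs_nonneg w]

/-! ### Bessel functions and Weber's integral -/

/-- The coefficient `(-1)^m / (m! Γ(m + ν + 1))` in the series of the Bessel function `J_ν`. -/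
noncomputable def besselCoeff (ν : ℝ) (m : ℕ) : ℝ :=
  (-1) ^ m / ((m.factorial : ℝ) * Real.Gamma (m + ν + 1))

/-- The even entire part `(w / 2)^(-ν) J_ν(w)` of the Bessel function. -/
noncomputable def besselEntire (ν w : ℝ) : ℝ := ∑' m : ℕ, besselCoeff ν m * (w / 2) ^ (2 * m)

lemma Gamma_nat_add_pos {ν : ℝ} (hν : -(1 / 2) < ν) (m : ℕ) : 0 < Real.Gamma (m + ν + 1) :=
  Real.Gamma_pos_of_pos (by have := m.cast_nonneg (α := ℝ); linarith)

lemma Gamma_nat_succ_add {ν : ℝ} (hν : -(1 / 2) < ν) (m : ℕ) :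
    Real.Gamma ((m + 1 : ℕ) + ν + 1) = (m + ν + 1) * Real.Gamma (m + ν + 1) := by
  rw [← Real.Gamma_add_one (by have := m.cast_nonneg (α := ℝ); linarith)]
  push_cast; ring_nf

lemma le_Gamma_nat_add {ν : ℝ} (hν : -(1 / 2) < ν) (m : ℕ) :
    Real.Gamma (ν + 1) * m.factorial / 2 ^ m ≤ Real.Gamma (m + ν + 1) := by
  induction m with
  | zero => simp
  | succ m ih =>
    rw [Gamma_nat_succ_add hν, Nat.factorial_succ]
    have h0 := Gamma_nat_add_pos hν m
    have hm := m.cast_nonneg (α := ℝ)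
    calc Real.Gamma (ν + 1) * ((m + 1) * m.factorial : ℕ) / 2 ^ (m + 1)
        = (m + 1) / 2 * (Real.Gamma (ν + 1) * m.factorial / 2 ^ m) := by
          push_cast; field_simp; ring
      _ ≤ (m + 1) / 2 * Real.Gamma (m + ν + 1) := by gcongr
      _ ≤ (m + ν + 1) * Real.Gamma (m + ν + 1) := by gcongr; linarith

/-- The bound `|besselEntire ν w| ≤ C e^(ε w²)` holds for every `ε > 0`, with the constant below. -/
noncomputable def besselConst (ν ε : ℝ) : ℝ := Real.exp (1 / (2 * ε)) / Real.Gamma (ν + 1)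

lemma besselConst_pos {ν : ℝ} (hν : -(1 / 2) < ν) (ε : ℝ) : 0 < besselConst ν ε := by
  have := Gamma_nat_add_pos hν 0
  simp only [Nat.cast_zero, zero_add] at this
  exact div_pos (Real.exp_pos _) this

lemma abs_bessel_term_le {ν ε : ℝ} (hν : -(1 / 2) < ν) (hε : 0 < ε) (w : ℝ) (m : ℕ) :
    |besselCoeff ν m * (w / 2) ^ (2 * m)|
      ≤ besselConst ν ε * ((ε * w ^ 2) ^ m / (m.factorial : ℝ)) := by
  have hG := Gamma_nat_add_pos hν m
  have hG0 := Gamma_nat_add_pos hν 0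
  simp only [Nat.cast_zero, zero_add] at hG0
  have hf : (0 : ℝ) < m.factorial := by positivity
  have e : |besselCoeff ν m * (w / 2) ^ (2 * m)|
      = (w / 2) ^ (2 * m) / (m.factorial * Real.Gamma (m + ν + 1)) := by
    rw [besselCoeff, abs_mul, abs_div, abs_pow, abs_neg, abs_one, one_pow, abs_of_pos (by positivity),
      abs_of_nonneg (by rw [pow_mul]; positivity)]
    ring
  rw [e]
  have h1 : (1 / (2 * ε)) ^ m / (m.factorial : ℝ) ≤ Real.exp (1 / (2 * ε)) :=
    Real.pow_div_factorial_le_exp _ (by positivity) m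
  calc (w / 2) ^ (2 * m) / (m.factorial * Real.Gamma (m + ν + 1))
      ≤ (w / 2) ^ (2 * m) / (m.factorial * (Real.Gamma (ν + 1) * m.factorial / 2 ^ m)) := by
        gcongr
        · rw [pow_mul]; positivity
        · exact le_Gamma_nat_add hν m
    _ = (1 / (2 * ε)) ^ m / (m.factorial : ℝ) / Real.Gamma (ν + 1)
          * ((ε * w ^ 2) ^ m / (m.factorial : ℝ)) := by
        have : (w / 2) ^ (2 * m) * 2 ^ m = (1 / (2 * ε)) ^ m * (ε * w ^ 2) ^ m := by
          rw [pow_mul, ← mul_pow, ← mul_pow]; congr 1; field_simp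
        field_simp
        linear_combination this
    _ ≤ _ := by
        rw [besselConst]
        gcongr

lemma hasSum_exp_sq (c : ℝ) : HasSum (fun m : ℕ => c ^ m / (m.factorial : ℝ)) (Real.exp c) := by
  rw [Real.exp_eq_exp_ℝ]; exact NormedSpace.expSeries_div_hasSum_exp c

lemma hasSum_besselEntire {ν : ℝ} (hν : -(1 / 2) < ν) (w : ℝ) :
    HasSum (fun m : ℕ => besselCoeff ν m * (w / 2) ^ (2 * m)) (besselEntire ν w) := by
  refine Summable.hasSum (Summable.of_norm_bounded
    (g := fun m => besselConst ν 1 * ((1 * w ^ 2) ^ m / (m.factorial : ℝ)))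
    ((hasSum_exp_sq _).summable.mul_left _) fun m => ?_)
  exact abs_bessel_term_le hν one_pos w m

lemma abs_besselEntire_le {ν ε : ℝ} (hν : -(1 / 2) < ν) (hε : 0 < ε) (w : ℝ) :
    |besselEntire ν w| ≤ besselConst ν ε * Real.exp (ε * w ^ 2) := by
  rw [besselEntire]
  exact tsum_of_norm_bounded (f := fun m => besselCoeff ν m * (w / 2) ^ (2 * m))
    ((hasSum_exp_sq (ε * w ^ 2)).mul_left _) fun m => abs_bessel_term_le hν hε w m

lemma continuous_besselEntire {ν : ℝ} (hν : -(1 / 2) < ν) : Continuous (besselEntire ν) := by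
  rw [continuous_iff_continuousAt]
  intro w
  have h : ContinuousOn (besselEntire ν) (Metric.ball 0 (|w| + 1)) := by
    refine continuousOn_tsum (f := fun (m : ℕ) w => besselCoeff ν m * (w / 2) ^ (2 * m)) (u := fun m => besselConst ν 1 *
      ((1 * (|w| + 1) ^ 2) ^ m / (m.factorial : ℝ))) (fun m => by fun_prop)
      ((hasSum_exp_sq _).summable.mul_left _) fun m x hx => ?_
    refine (abs_bessel_term_le hν one_pos x m).trans ?_
    have hx' : |x| ≤ |w| + 1 := by simpa using (mem_ball_zero_iff.1 hx).le
    have := besselConst_pos hν 1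
    have h2 : x ^ 2 ≤ (|w| + 1) ^ 2 := by rw [← sq_abs x]; gcongr
    gcongr
  exact h.continuousAt (Metric.isOpen_ball.mem_nhds (by simp))

lemma besselJ_eq {z : ℝ} (hz : 0 < z) (ν : ℝ) :
    besselJ ν z = (z / 2) ^ ν * besselEntire ν z := by
  rw [besselJ, besselEntire, ← tsum_mul_left]
  congr 1
  funext m
  rw [Real.rpow_add (by positivity), besselCoeff, show (2 * (m : ℝ)) = ((2 * m : ℕ) : ℝ) by push_cast; ring,
    Real.rpow_natCast]
  ring

/-- Termwise integration of the Bessel series against a function with Gaussian decay. -/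
lemma hasSum_integral_besselEntire {ν : ℝ} (hν : -(1 / 2) < ν) {G : ℝ → ℝ} {C q δ : ℝ}
    (hG : AEStronglyMeasurable G (volume.restrict (Ioi 0))) (hq : -1 < q) (hδ : 0 < δ)
    (hGb : ∀ y, 0 < y → |G y| ≤ C * (y ^ q * Real.exp (-δ * y ^ 2))) (x : ℝ) :
    HasSum (fun m : ℕ => besselCoeff ν m * (x / 2) ^ (2 * m) * ∫ y in Ioi 0, y ^ (2 * m) * G y)
      (∫ y in Ioi 0, besselEntire ν (x * y) * G y) := by
  set ε := δ / (2 * (x ^ 2 + 1)) with hε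
  have hε0 : 0 < ε := by positivity
  have hεx : ε * x ^ 2 ≤ δ / 2 := by
    rw [hε, div_mul_eq_mul_div, div_le_iff₀ (by positivity)]
    nlinarith [sq_nonneg x]
  have hB := besselConst_pos hν ε
  have h := hasSum_integral_of_dominated_convergence (μ := volume.restrict (Ioi (0 : ℝ)))
    (F := fun (m : ℕ) y => besselCoeff ν m * ((x * y) / 2) ^ (2 * m) * G y)
    (bound := fun m y => besselConst ν ε * ((ε * (x * y) ^ 2) ^ m / (m.factorial : ℝ)) *
      (C * (y ^ q * Real.exp (-δ * y ^ 2))))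
    (f := fun y => besselEntire ν (x * y) * G y) ?_ ?_ ?_ ?_ ?_
  · refine (congrArg (fun f => HasSum f _) (funext fun m => ?_)).mpr h
    rw [← integral_const_mul]
    congr 1
    funext y
    rw [mul_div_right_comm, mul_pow]
    ring
  · intro m
    exact AEStronglyMeasurable.mul (Continuous.aestronglyMeasurable (by fun_prop)) hG
  · intro m
    filter_upwards [ae_restrict_mem measurableSet_Ioi] with y hy
    rw [norm_mul]
    gcongr
    · exact abs_bessel_term_le hν hε0 _ m
    · exact hGb y hy
  · filter_upwards with y
    exact ((hasSum_exp_sq _).summable.mul_left _).mul_right _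
  · simp_rw [tsum_mul_right, tsum_mul_left, (hasSum_exp_sq _).tsum_eq]
    have hi := (integrableOn_rpow_mul_exp_neg_mul_sq (b := δ / 2) (by positivity) hq).const_mul
      (besselConst ν ε * |C|)
    refine Integrable.mono' hi (Measurable.aestronglyMeasurable (by fun_prop)) ?_
    filter_upwards [ae_restrict_mem measurableSet_Ioi] with y hy
    have hy' : 0 < y := hy
    have e1 : Real.exp (ε * (x * y) ^ 2) * Real.exp (-δ * y ^ 2) ≤ Real.exp (-(δ / 2) * y ^ 2) := by
      rw [← Real.exp_add]
      apply Real.exp_le_exp.2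
      nlinarith [sq_nonneg y]
    have hyq := Real.rpow_pos_of_pos hy' q
    rw [norm_mul, norm_mul, norm_mul, norm_mul, Real.norm_of_nonneg hB.le, Real.norm_of_nonneg (Real.exp_pos _).le,
      Real.norm_of_nonneg hyq.le, Real.norm_of_nonneg (Real.exp_pos _).le, Real.norm_eq_abs C]
    calc besselConst ν ε * Real.exp (ε * (x * y) ^ 2) * (|C| * (y ^ q * Real.exp (-δ * y ^ 2)))
        = besselConst ν ε * |C| * (y ^ q * (Real.exp (ε * (x * y) ^ 2) * Real.exp (-δ * y ^ 2))) := by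
          ring
      _ ≤ _ := by gcongr
  · filter_upwards with y
    exact (hasSum_besselEntire hν (x * y)).mul_right _

lemma integral_rpow_mul_gaussian {c t : ℝ} (hc : 0 < c) (ht : 0 < t) :
    ∫ y in Ioi 0, y ^ (2 * c - 1) * Real.exp (-t * y ^ 2) = Real.Gamma c * t ^ (-c) / 2 := by
  have h := integral_rpow_mul_exp_neg_mul_rpow (p := 2) (q := 2 * c - 1) (b := t) (by norm_num)
    (by linarith) ht
  simp only [Real.rpow_two] at h
  rw [h]
  ring_nf

/-- A form of the Vandermonde convolution for Gamma functions. -/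
lemma sum_choose_descFactorial_div_Gamma (m : ℕ) : ∀ {ν : ℝ}, -(1 / 2) < ν → ∀ l : ℕ,
    ∑ j ∈ Finset.range (m + 1), (m.choose j : ℝ) * (l.descFactorial j : ℝ) / Real.Gamma (j + ν + 1)
      = Real.Gamma (m + l + ν + 1) / (Real.Gamma (m + ν + 1) * Real.Gamma (l + ν + 1)) := by
  induction m with
  | zero =>
    intro ν hν l
    have h0 := Gamma_nat_add_pos hν 0
    have hl := Gamma_nat_add_pos hν l
    simp at h0 ⊢
    field_simp
  | succ m ih =>
    intro ν hν l
    have h1 := ih hν l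
    rw [Finset.sum_range_succ'] at h1 ⊢
    have h0 : ∑ j ∈ Finset.range (m + 1), (m.choose (j + 1) : ℝ) * (l.descFactorial (j + 1) : ℝ) /
        Real.Gamma ((j + 1 : ℕ) + ν + 1) = ∑ j ∈ Finset.range m, (m.choose (j + 1) : ℝ) *
          (l.descFactorial (j + 1) : ℝ) / Real.Gamma ((j + 1 : ℕ) + ν + 1) := by
      rw [Finset.sum_range_succ]; simp
    -- Pascal's rule: the sum for `(m + 1, ν, l)` is the one for `(m, ν, l)` plus `l` times the one
    -- for `(m, ν + 1, l - 1)`.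
    have split : ∑ j ∈ Finset.range (m + 1), ((m + 1).choose (j + 1) : ℝ) *
        (l.descFactorial (j + 1) : ℝ) / Real.Gamma ((j + 1 : ℕ) + ν + 1)
        = ∑ j ∈ Finset.range (m + 1), (m.choose j : ℝ) *
            (l.descFactorial (j + 1) : ℝ) / Real.Gamma ((j + 1 : ℕ) + ν + 1)
          + ∑ j ∈ Finset.range (m + 1), (m.choose (j + 1) : ℝ) *
            (l.descFactorial (j + 1) : ℝ) / Real.Gamma ((j + 1 : ℕ) + ν + 1) := by
      rw [← Finset.sum_add_distrib]
      refine Finset.sum_congr rfl fun j _ => ?_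
      rw [Nat.choose_succ_succ]; push_cast; ring
    rw [split, h0, add_assoc]
    simp only [Nat.choose_zero_right, Nat.descFactorial_zero, Nat.cast_one, Nat.cast_zero] at h1 ⊢
    rw [h1]
    have hGm := Gamma_nat_add_pos hν m
    have hGl := Gamma_nat_add_pos hν l
    have hm := m.cast_nonneg (α := ℝ)
    have hl' := l.cast_nonneg (α := ℝ)
    have ep : Real.Gamma ((m + 1 : ℕ) + l + ν + 1)
        = (m + l + ν + 1) * Real.Gamma (m + l + ν + 1) := by
      have := Gamma_nat_succ_add hν (m + l)
      push_cast at this ⊢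
      rw [← this]; ring_nf
    rw [ep, Gamma_nat_succ_add hν m]
    cases l with
    | zero =>
      simp
      simp at hGl
      have : (m : ℝ) + ν + 1 ≠ 0 := by linarith
      field_simp
    | succ l =>
      have h2 := ih (ν := ν + 1) (by linarith) l
      have e : ∑ j ∈ Finset.range (m + 1), (m.choose j : ℝ) *
            ((l + 1).descFactorial (j + 1) : ℝ) / Real.Gamma ((j + 1 : ℕ) + ν + 1)
          = (l + 1) * ∑ j ∈ Finset.range (m + 1), (m.choose j : ℝ) * (l.descFactorial j : ℝ) /
            Real.Gamma (j + (ν + 1) + 1) := by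
        rw [Finset.mul_sum]
        refine Finset.sum_congr rfl fun j _ => ?_
        rw [Nat.succ_descFactorial_succ]
        push_cast
        rw [show (j : ℝ) + 1 + ν + 1 = j + (ν + 1) + 1 by ring]
        ring
      rw [e, h2]
      have e1 : Real.Gamma (m + (ν + 1) + 1) = (m + ν + 1) * Real.Gamma (m + ν + 1) := by
        rw [← Gamma_nat_succ_add hν]; push_cast; ring_nf
      have e2 : Real.Gamma (l + (ν + 1) + 1) = Real.Gamma ((l + 1 : ℕ) + ν + 1) := by
        push_cast; ring_nf
      have e3 : Real.Gamma (m + l + (ν + 1) + 1) = Real.Gamma (m + (l + 1 : ℕ) + ν + 1) := by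
        push_cast; ring_nf
      rw [e1, e2, e3]
      have : (m : ℝ) + ν + 1 ≠ 0 := by linarith
      field_simp
      push_cast
      ring

lemma hasSum_descFactorial (b : ℝ) (j : ℕ) :
    HasSum (fun l : ℕ => (-1) ^ l * (l.descFactorial j : ℝ) / (l.factorial : ℝ) * b ^ l)
      ((-1) ^ j * b ^ j * Real.exp (-b)) := by
  have hinj : Function.Injective (fun i : ℕ => i + j) := fun a b h => by simpa using h
  rw [← hinj.hasSum_iff]
  · have h := (hasSum_exp_sq (-b)).mul_left ((-1) ^ j * b ^ j)
    refine (congrArg (fun f => HasSum f _) (funext fun i => ?_)).mpr h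
    simp only [Function.comp]
    have h1 : ((i + j).descFactorial j : ℝ) * i.factorial = (i + j).factorial := by
      have := Nat.factorial_mul_descFactorial (Nat.le_add_left j i)
      rw [Nat.add_sub_cancel] at this
      exact_mod_cast (mul_comm _ _).trans this
    rw [← h1, neg_pow b]
    have : (i.factorial : ℝ) ≠ 0 := by positivity
    have h2 : ((i + j).descFactorial j : ℝ) ≠ 0 := by
      intro h; rw [h, zero_mul] at h1; exact absurd h1.symm (by positivity)
    field_simp
    ring
  · intro l hl
    have : l < j := by
      by_contra h
      exact hl ⟨l - j, by simp only; omega⟩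
    simp [Nat.descFactorial_eq_zero_iff_lt.2 this]

/-- Kummer's transformation for the integrals `∫ y^(2m + 2ν + 1) e^(-t y²) J_ν(z y)`. -/
lemma hasSum_kummer {ν : ℝ} (hν : -(1 / 2) < ν) (m : ℕ) (b : ℝ) :
    HasSum (fun l : ℕ => (-1) ^ l * Real.Gamma (m + l + ν + 1) /
        (m.factorial * Real.Gamma (m + ν + 1) * (l.factorial * Real.Gamma (l + ν + 1))) * b ^ l)
      (∑ j ∈ Finset.range (m + 1), (-1) ^ j * b ^ j * Real.exp (-b) /
        ((m - j).factorial * (j.factorial * Real.Gamma (j + ν + 1)))) := by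
  have h : HasSum _ _ := hasSum_sum (s := Finset.range (m + 1)) fun j _ =>
    (hasSum_descFactorial b j).mul_left
      ((m.choose j : ℝ) / (m.factorial * Real.Gamma (j + ν + 1)))
  have e1 : ∀ l : ℕ, ∑ j ∈ Finset.range (m + 1), (m.choose j : ℝ) /
      (m.factorial * Real.Gamma (j + ν + 1)) *
        ((-1) ^ l * (l.descFactorial j : ℝ) / (l.factorial : ℝ) * b ^ l)
      = (-1) ^ l * Real.Gamma (m + l + ν + 1) /
        (m.factorial * Real.Gamma (m + ν + 1) * (l.factorial * Real.Gamma (l + ν + 1))) * b ^ l := by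
    intro l
    have := sum_choose_descFactorial_div_Gamma m hν l
    calc _ = (-1) ^ l * b ^ l / (l.factorial * m.factorial) *
          ∑ j ∈ Finset.range (m + 1), (m.choose j : ℝ) * (l.descFactorial j : ℝ) /
            Real.Gamma (j + ν + 1) := by
            rw [Finset.mul_sum]
            refine Finset.sum_congr rfl fun j _ => ?_
            ring
      _ = _ := by rw [this]; ring
  have e2 : ∀ j ∈ Finset.range (m + 1), (m.choose j : ℝ) / (m.factorial * Real.Gamma (j + ν + 1)) *
      ((-1) ^ j * b ^ j * Real.exp (-b)) = (-1) ^ j * b ^ j * Real.exp (-b) /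
        ((m - j).factorial * (j.factorial * Real.Gamma (j + ν + 1))) := by
    intro j hj
    rw [Nat.cast_choose ℝ (Nat.lt_succ_iff.1 (Finset.mem_range.1 hj))]
    have : (m.factorial : ℝ) ≠ 0 := by positivity
    field_simp
  simp only [e1] at h
  rwa [Finset.sum_congr rfl e2] at h

/-- Absolute convergence of the series of `(w / 2)^(-ν) I_ν(w)`, with `I_ν` the modified Bessel
function. -/
lemma summable_modified {ν : ℝ} (hν : -(1 / 2) < ν) (w : ℝ) :
    Summable fun j : ℕ => ‖(w / 2) ^ (2 * j) / (j.factorial * Real.Gamma (j + ν + 1))‖ := by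
  refine Summable.of_nonneg_of_le (fun _ => norm_nonneg _) (fun m => ?_)
    ((hasSum_exp_sq (1 * w ^ 2)).summable.mul_left (besselConst ν 1))
  refine le_trans (le_of_eq ?_) (abs_bessel_term_le hν one_pos w m)
  rw [besselCoeff, Real.norm_eq_abs, abs_mul, abs_div, abs_div, abs_pow (-1 : ℝ), abs_neg, abs_one,
    one_pow]
  ring

/-- **Weber's second exponential integral**, for the entire parts of the Bessel functions. -/
lemma weber_entire {ν : ℝ} (hν : -(1 / 2) < ν) {t : ℝ} (ht : 0 < t) (x z : ℝ) :
    ∫ y in Ioi 0, besselEntire ν (x * y) *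
        (besselEntire ν (z * y) * (y ^ (2 * ν + 1) * Real.exp (-t * y ^ 2)))
      = t ^ (-(ν + 1)) / 2 * Real.exp (-(x ^ 2 + z ^ 2) / (4 * t)) *
        ∑' j : ℕ, ((x * z / (2 * t)) / 2) ^ (2 * j) / (j.factorial * Real.Gamma (j + ν + 1)) := by
  set a := x ^ 2 / (4 * t) with ha
  set b := z ^ 2 / (4 * t) with hb
  -- Termwise integration of the series in `z y`; Kummer's transformation turns the resulting
  -- `₁F₁(m + ν + 1; ν + 1; -b)` into `e^(-b)` times a polynomial.
  have inner : ∀ m : ℕ, ∫ y in Ioi 0, y ^ (2 * m) *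
      (besselEntire ν (z * y) * (y ^ (2 * ν + 1) * Real.exp (-t * y ^ 2)))
      = t ^ (-(ν + 1)) / 2 * (t⁻¹ ^ m * (m.factorial * Real.Gamma (m + ν + 1)) *
      ∑ j ∈ Finset.range (m + 1), (-1) ^ j * b ^ j * Real.exp (-b) /
        ((m - j).factorial * (j.factorial * Real.Gamma (j + ν + 1)))) := by
    intro m
    have hc : ∀ l : ℕ, 0 < (m : ℝ) + l + ν + 1 := fun l => by
      have := m.cast_nonneg (α := ℝ)
      have := l.cast_nonneg (α := ℝ)
      linarith
    have pw : ∀ l : ℕ, ∀ y : ℝ, 0 < y → y ^ (2 * l) * (y ^ (2 * m) * (y ^ (2 * ν + 1) *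
        Real.exp (-t * y ^ 2))) = y ^ (2 * (m + l + ν + 1) - 1) * Real.exp (-t * y ^ 2) := by
      intro l y hy
      rw [← Real.rpow_natCast y (2 * l), ← Real.rpow_natCast y (2 * m), ← mul_assoc, ← mul_assoc,
        ← Real.rpow_add hy, ← Real.rpow_add hy]
      congr 2
      push_cast; ring
    have h1 := hasSum_integral_besselEntire hν (C := 1) (q := 2 * (m + (0 : ℕ) + ν + 1) - 1) (δ := t)
      (G := fun y => y ^ (2 * m) * (y ^ (2 * ν + 1) * Real.exp (-t * y ^ 2)))
      (Measurable.aestronglyMeasurable (by fun_prop)) (by linarith [hc 0]) ht (fun y hy => by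
        rw [← pw 0 y hy, abs_of_nonneg (by positivity)]; simp) z
    have h2 := ((hasSum_kummer hν m b).mul_left
      (t ^ (-(ν + 1)) / 2 * (t⁻¹ ^ m * (m.factorial * Real.Gamma (m + ν + 1)))))
    have e : ∀ l : ℕ, besselCoeff ν l * (z / 2) ^ (2 * l) * ∫ y in Ioi 0, y ^ (2 * l) *
        (y ^ (2 * m) * (y ^ (2 * ν + 1) * Real.exp (-t * y ^ 2)))
        = t ^ (-(ν + 1)) / 2 * (t⁻¹ ^ m * (m.factorial * Real.Gamma (m + ν + 1))) *
        ((-1) ^ l * Real.Gamma (m + l + ν + 1) /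
        (m.factorial * Real.Gamma (m + ν + 1) * (l.factorial * Real.Gamma (l + ν + 1))) * b ^ l) := by
      intro l
      rw [setIntegral_congr_fun measurableSet_Ioi (fun y hy => pw l y hy),
        integral_rpow_mul_gaussian (hc l) ht, besselCoeff]
      have hGm := (Gamma_nat_add_pos hν m).ne'
      have hGl := (Gamma_nat_add_pos hν l).ne'
      have e1 : t ^ (-((m : ℝ) + l + ν + 1)) = t ^ (-(ν + 1)) * t⁻¹ ^ m * t⁻¹ ^ l := by
        rw [← Real.rpow_natCast, ← Real.rpow_natCast, Real.inv_rpow ht.le, Real.inv_rpow ht.le,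
          ← Real.rpow_neg ht.le, ← Real.rpow_neg ht.le, ← Real.rpow_add ht, ← Real.rpow_add ht]
        congr 1; ring
      have e2 : b ^ l = (z / 2) ^ (2 * l) * t⁻¹ ^ l := by
        rw [pow_mul, ← mul_pow, hb]; congr 1; field_simp; norm_num
      rw [e1, e2]
      field_simp
    simp only [e] at h1
    rw [← mul_assoc, ← h1.unique h2]
    refine setIntegral_congr_fun measurableSet_Ioi fun y _ => ?_
    ring
  -- Termwise integration of the series in `x y`; half of the Gaussian is spent on the growth of
  -- `besselEntire ν (z y)`.
  obtain ⟨ε, hε, hεt⟩ : ∃ ε > 0, ε * z ^ 2 ≤ t / 2 :=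
    ⟨t / (2 * (z ^ 2 + 1)), by positivity, by
      rw [div_mul_eq_mul_div, div_le_iff₀ (by positivity)]; nlinarith [sq_nonneg z]⟩
  have h1 := hasSum_integral_besselEntire hν (C := besselConst ν ε) (q := 2 * ν + 1) (δ := t / 2)
      (G := fun y => besselEntire ν (z * y) * (y ^ (2 * ν + 1) * Real.exp (-t * y ^ 2)))
      (Measurable.aestronglyMeasurable (by
        have := (continuous_besselEntire hν).measurable
        fun_prop)) (by linarith) (by positivity) (fun y hy => by
        have h := abs_besselEntire_le hν hε (z * y)
        have hyq := Real.rpow_pos_of_pos hy (2 * ν + 1)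
        rw [abs_mul, abs_mul, abs_of_pos hyq, abs_of_pos (Real.exp_pos _)]
        have hB := besselConst_pos hν ε
        calc _ ≤ besselConst ν ε * Real.exp (ε * (z * y) ^ 2) *
              (y ^ (2 * ν + 1) * Real.exp (-t * y ^ 2)) := by gcongr
          _ = besselConst ν ε * (y ^ (2 * ν + 1) *
              Real.exp (ε * (z * y) ^ 2 + -t * y ^ 2)) := by rw [Real.exp_add]; ring
          _ ≤ _ := by
            gcongr
            nlinarith [sq_nonneg y]) x
  simp only [inner] at h1
  set f : ℕ → ℝ := fun k => Real.exp (-b) *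
    (((x * z / (2 * t)) / 2) ^ (2 * k) / (k.factorial * Real.Gamma (k + ν + 1))) with hf
  set g : ℕ → ℝ := fun i => (-a) ^ i / (i.factorial : ℝ) with hg
  -- The double sum is the Cauchy product of the series of `e^(-a)` with that of `I_ν`.
  have hprod := tsum_mul_tsum_eq_tsum_sum_range_of_summable_norm (f := f) (g := g)
    (by simp only [hf, norm_mul]; exact (summable_modified hν _).mul_left _)
    (hasSum_exp_sq (-a)).summable.norm
  have e3 : ∀ m : ℕ, besselCoeff ν m * (x / 2) ^ (2 * m) *
      (t ^ (-(ν + 1)) / 2 * (t⁻¹ ^ m * (m.factorial * Real.Gamma (m + ν + 1)) *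
      ∑ j ∈ Finset.range (m + 1), (-1) ^ j * b ^ j * Real.exp (-b) /
        ((m - j).factorial * (j.factorial * Real.Gamma (j + ν + 1)))))
      = t ^ (-(ν + 1)) / 2 * ∑ k ∈ Finset.range (m + 1), f k * g (m - k) := by
    intro m
    have hGm := (Gamma_nat_add_pos hν m).ne'
    have e4 : a ^ m = (x / 2) ^ (2 * m) * t⁻¹ ^ m := by
      rw [pow_mul, ← mul_pow, ha]; congr 1; field_simp; norm_num
    have e5 : besselCoeff ν m * (x / 2) ^ (2 * m) * (t⁻¹ ^ m * (m.factorial *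
        Real.Gamma (m + ν + 1))) = (-a) ^ m := by
      rw [neg_pow a, e4, besselCoeff]; field_simp
    calc _ = t ^ (-(ν + 1)) / 2 * ((besselCoeff ν m * (x / 2) ^ (2 * m) * (t⁻¹ ^ m * (m.factorial *
        Real.Gamma (m + ν + 1)))) * ∑ j ∈ Finset.range (m + 1), (-1) ^ j * b ^ j * Real.exp (-b) /
        ((m - j).factorial * (j.factorial * Real.Gamma (j + ν + 1)))) := by ring
      _ = _ := by
        rw [e5, Finset.mul_sum]
        congr 1
        refine Finset.sum_congr rfl fun j hj => ?_
        have hjm : j ≤ m := Nat.lt_succ_iff.1 (Finset.mem_range.1 hj)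
        have e6 : (-a) ^ m * ((-1) ^ j * b ^ j) = (-a) ^ (m - j) *
            ((x * z / (2 * t)) / 2) ^ (2 * j) := by
          obtain ⟨i, rfl⟩ := Nat.exists_eq_add_of_le hjm
          rw [Nat.add_sub_cancel_left, add_comm j i, pow_add, mul_assoc, ← mul_pow, ← mul_pow,
            pow_mul ((x * z / (2 * t)) / 2)]
          congr 2
          rw [ha, hb]; field_simp; ring
        rw [hf, hg]
        simp only
        calc _ = (-a) ^ m * ((-1) ^ j * b ^ j) * (Real.exp (-b) /
              ((m - j).factorial * (j.factorial * Real.Gamma (j + ν + 1)))) := by ring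
          _ = _ := by rw [e6]; ring
  simp only [e3] at h1
  rw [← h1.tsum_eq, tsum_mul_left, ← hprod, hf, hg, tsum_mul_left, (hasSum_exp_sq (-a)).tsum_eq]
  rw [show -(x ^ 2 + z ^ 2) / (4 * t) = -b + -a by rw [ha, hb]; ring, Real.exp_add]
  ring

/-! ### The one-dimensional heat kernel -/

/-- The probabilists' Hermite polynomial as a function. -/
noncomputable def hermiteFun (m : ℕ) (u : ℝ) : ℝ := Polynomial.aeval u (Polynomial.hermite m)

lemma derivative_hermite_succ (m : ℕ) : Polynomial.derivative (Polynomial.hermite (m + 1))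
    = (m + 1 : ℤ) • Polynomial.hermite m := by
  induction m with
  | zero => simp
  | succ m ih =>
    rw [Polynomial.hermite_succ (m + 1), Polynomial.derivative_sub, Polynomial.derivative_mul, ih,
      Polynomial.hermite_succ m]
    simp only [zsmul_eq_mul, Polynomial.derivative_X, Polynomial.derivative_mul]
    push_cast
    simp
    ring

lemma hasDerivAt_hermiteFun (m : ℕ) (u : ℝ) :
    HasDerivAt (hermiteFun m) (m * hermiteFun (m - 1) u) u := by
  have h := (Polynomial.hermite m).hasDerivAt_aeval u
  refine h.congr_deriv ?_
  cases m with
  | zero => simp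
  | succ m => rw [derivative_hermite_succ]; simp [hermiteFun]

lemma hermiteFun_succ (m : ℕ) (u : ℝ) :
    hermiteFun (m + 1) u = u * hermiteFun m u - m * hermiteFun (m - 1) u := by
  have h := ((Polynomial.hermite m).hasDerivAt_aeval u).unique (hasDerivAt_hermiteFun m u)
  simp only [hermiteFun] at h ⊢
  rw [Polynomial.hermite_succ, map_sub, map_mul, Polynomial.aeval_X, h]

lemma continuous_hermiteFun (m : ℕ) : Continuous (hermiteFun m) :=
  Polynomial.continuous_aeval _

lemma abs_polynomial_le_gaussian (p : Polynomial ℤ) :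
    ∃ C, 0 ≤ C ∧ ∀ u : ℝ, |Polynomial.aeval u p| ≤ C * Real.exp (u ^ 2 / 4) := by
  induction p using Polynomial.induction_on' with
  | add p q hp hq =>
    obtain ⟨C, hC0, hC⟩ := hp
    obtain ⟨D, hD0, hD⟩ := hq
    refine ⟨C + D, by positivity, fun u => ?_⟩
    rw [map_add, add_mul]
    exact (abs_add_le _ _).trans (add_le_add (hC u) (hD u))
  | monomial n a =>
    refine ⟨|(a : ℝ)| * (4 ^ n * n.factorial * Real.exp (1 / 4)), by positivity, fun u => ?_⟩
    rw [Polynomial.aeval_monomial, abs_mul, mul_assoc]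
    simp only [eq_intCast]
    gcongr
    rw [abs_pow]
    have h1 := Real.pow_div_factorial_le_exp ((1 + u ^ 2) / 4) (by positivity) n
    rw [div_le_iff₀ (by positivity), div_pow, div_le_iff₀ (by positivity), add_div,
      Real.exp_add] at h1
    have h2 : |u| ≤ 1 + u ^ 2 := by nlinarith [sq_nonneg (|u| - 1), sq_abs u, abs_nonneg u]
    calc |u| ^ n ≤ (1 + u ^ 2) ^ n := by gcongr
      _ ≤ _ := h1
      _ = _ := by ring

/-- The `m`-th derivative in `x` of the Gaussian `exp (-(x² + z² + 2 x z s) / (4 t))`. -/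
noncomputable def gaussDeriv (m : ℕ) (t x z s : ℝ) : ℝ :=
  (-(√(2 * t))⁻¹) ^ m * hermiteFun m ((x + z * s) / √(2 * t)) *
    Real.exp (-(x ^ 2 + z ^ 2 + 2 * x * z * s) / (4 * t))

lemma hasDerivAt_gaussDeriv {t : ℝ} (ht : 0 < t) (m : ℕ) (x z s : ℝ) :
    HasDerivAt (fun x => gaussDeriv m t x z s) (gaussDeriv (m + 1) t x z s) x := by
  have hr : 0 < √(2 * t) := Real.sqrt_pos.2 (by positivity)
  have hrt : √(2 * t) ^ 2 = 2 * t := Real.sq_sqrt (by positivity)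
  have d1 : HasDerivAt (fun x => (x + z * s) / √(2 * t)) (√(2 * t))⁻¹ x := by
    simpa using ((hasDerivAt_id x).add_const (z * s)).div_const (√(2 * t))
  have d2 : HasDerivAt (fun x : ℝ => -(x ^ 2 + z ^ 2 + 2 * x * z * s) / (4 * t))
      (-(2 * x + 2 * z * s) / (4 * t)) x := by
    have := ((((hasDerivAt_pow 2 x).add_const (z ^ 2)).add
      ((hasDerivAt_id x).const_mul (2 * z * s))).neg).div_const (4 * t)
    refine (this.congr_deriv (by simp)).congr_of_eventuallyEq (Filter.Eventually.of_forall fun y => ?_)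
    simp; ring
  have d := (((hasDerivAt_hermiteFun m _).comp x d1).const_mul ((-(√(2 * t))⁻¹) ^ m)).mul d2.exp
  refine d.congr_deriv ?_
  rw [gaussDeriv, hermiteFun_succ, pow_succ, show -(2 * x + 2 * z * s) / (4 * t)
    = -((x + z * s) / √(2 * t)) * (√(2 * t))⁻¹ by
      rw [show 4 * t = 2 * √(2 * t) ^ 2 by rw [hrt]; ring]; field_simp]
  simp only [Function.comp]
  ring

/-- The derivative of `gaussDeriv` in the variable `s` of the Gegenbauer weight. For `m = 0` the
truncated subtraction is harmless, because of the factor `m`. -/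
lemma hasDerivAt_gaussDeriv_angle {t : ℝ} (ht : 0 < t) (m : ℕ) (x z s : ℝ) :
    HasDerivAt (fun s => gaussDeriv m t x z s)
      (-(x * z / (2 * t)) * gaussDeriv m t x z s
        - m * (z / (2 * t)) * gaussDeriv (m - 1) t x z s) s := by
  have hr : 0 < √(2 * t) := Real.sqrt_pos.2 (by positivity)
  have hrt : √(2 * t) ^ 2 = 2 * t := Real.sq_sqrt (by positivity)
  have d1 : HasDerivAt (fun s => (x + z * s) / √(2 * t)) (z / √(2 * t)) s := by
    simpa using (((hasDerivAt_id s).const_mul z).const_add x).div_const (√(2 * t))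
  have d2 : HasDerivAt (fun s : ℝ => -(x ^ 2 + z ^ 2 + 2 * x * z * s) / (4 * t))
      (-(2 * x * z) / (4 * t)) s := by
    have := ((((hasDerivAt_id s).const_mul (2 * x * z)).const_add (x ^ 2 + z ^ 2)).neg).div_const
      (4 * t)
    refine (this.congr_deriv (by simp)).congr_of_eventuallyEq (Filter.Eventually.of_forall fun y => ?_)
    simp
  have d := (((hasDerivAt_hermiteFun m _).comp s d1).const_mul ((-(√(2 * t))⁻¹) ^ m)).mul d2.exp
  refine d.congr_deriv ?_
  simp only [gaussDeriv]
  rw [show 4 * t = 2 * √(2 * t) ^ 2 by rw [hrt]; ring,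
    show x * z / (2 * t) = x * z / √(2 * t) ^ 2 by rw [hrt],
    show z / (2 * t) = z / √(2 * t) ^ 2 by rw [hrt]]
  simp only [Function.comp]
  cases m with
  | zero => simp; field_simp
  | succ m =>
    rw [pow_succ, Nat.add_sub_cancel]
    field_simp
    ring

lemma measurable_gaussDeriv (m : ℕ) :
    Measurable fun p : (ℝ × ℝ × ℝ) × ℝ => gaussDeriv m p.1.1 p.1.2.1 p.1.2.2 p.2 := by
  have := (continuous_hermiteFun m).measurable
  unfold gaussDeriv
  fun_prop

lemma continuous_gaussDeriv (m : ℕ) (t x z : ℝ) : Continuous fun s => gaussDeriv m t x z s := by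
  have := continuous_hermiteFun m
  unfold gaussDeriv
  fun_prop

/-- Gaussian bound; half of the exponent absorbs the Hermite polynomial. -/
lemma abs_gaussDeriv_le (m : ℕ) : ∃ C, 0 ≤ C ∧ ∀ t x z s : ℝ, 0 < t →
    |gaussDeriv m t x z s| ≤ C * (√t)⁻¹ ^ m *
      (Real.exp (-(x ^ 2 + z ^ 2 + 2 * x * z * s) / (8 * t)) *
        Real.exp (-(z ^ 2 * (1 - s ^ 2)) / (8 * t))) := by
  obtain ⟨C, hC0, hC⟩ := abs_polynomial_le_gaussian (Polynomial.hermite m)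
  refine ⟨C, hC0, fun t x z s ht => ?_⟩
  have hr : 0 < √(2 * t) := Real.sqrt_pos.2 (by positivity)
  have hrt : √(2 * t) ^ 2 = 2 * t := Real.sq_sqrt (by positivity)
  have h1 : (√(2 * t))⁻¹ ≤ (√t)⁻¹ := by
    gcongr
    linarith
  have h2 := hC ((x + z * s) / √(2 * t))
  rw [gaussDeriv, abs_mul, abs_mul, abs_pow, abs_neg, abs_of_pos (inv_pos.2 hr), Real.abs_exp,
    ← Real.exp_add]
  calc (√(2 * t))⁻¹ ^ m * |hermiteFun m ((x + z * s) / √(2 * t))| *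
        Real.exp (-(x ^ 2 + z ^ 2 + 2 * x * z * s) / (4 * t))
      ≤ (√t)⁻¹ ^ m * (C * Real.exp (((x + z * s) / √(2 * t)) ^ 2 / 4)) *
        Real.exp (-(x ^ 2 + z ^ 2 + 2 * x * z * s) / (4 * t)) := by gcongr; exact h2
    _ = C * (√t)⁻¹ ^ m * Real.exp (((x + z * s) / √(2 * t)) ^ 2 / 4 +
        -(x ^ 2 + z ^ 2 + 2 * x * z * s) / (4 * t)) := by rw [Real.exp_add]; ring
    _ = _ := by
      congr 2
      rw [div_pow, hrt]
      field_simp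
      ring

/-- The constant normalizing the heat kernel. -/
noncomputable def weberConst (ν : ℝ) : ℝ :=
  1 / (2 * 4 ^ ν * Real.Gamma (ν + 1) * gegenbauerMass ν)

lemma weberConst_pos {ν : ℝ} (hν : -(1 / 2) < ν) : 0 < weberConst ν := by
  have h := Gamma_nat_add_pos hν 0
  simp only [Nat.cast_zero, zero_add] at h
  have := gegenbauerMass_pos hν
  unfold weberConst
  positivity

lemma weberConst_add_one {ν : ℝ} (hν : -(1 / 2) < ν) :
    weberConst (ν + 1) = weberConst ν / (2 * (2 * ν + 1)) := by
  have h := Gamma_nat_add_pos hν 0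
  simp only [Nat.cast_zero, zero_add] at h
  have h1 := gegenbauerMass_pos hν
  have h2 := gegenbauerMass_add_one hν
  have e1 : Real.Gamma (ν + 1 + 1) = (ν + 1) * Real.Gamma (ν + 1) :=
    Real.Gamma_add_one (by linarith)
  have e2 : gegenbauerMass (ν + 1) = (2 * ν + 1) * gegenbauerMass ν / (2 * ν + 2) := by
    rw [eq_div_iff (by linarith)]; linarith
  have h3 : 2 * ν + 1 ≠ 0 := by linarith
  have h4 : ν + 1 ≠ 0 := by linarith
  have h5 : 2 * ν + 2 ≠ 0 := by linarith
  rw [weberConst, weberConst, e1, e2, Real.rpow_add_one (by norm_num)]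
  have : (4 : ℝ) ^ ν ≠ 0 := (Real.rpow_pos_of_pos (by norm_num) _).ne'
  field_simp
  ring

/-- The kernel `δ_ν^m p_t(x, z)`, where `p_t` is the heat kernel of the one-dimensional Bessel
operator, `δ_ν` acts in `x`, and `p_t` is written by means of Poisson's integral for the modified
Bessel function `I_ν`. -/
noncomputable def heatKernel (ν : ℝ) (m : ℕ) (t x z : ℝ) : ℝ :=
  weberConst ν * (x * z) ^ (ν + 1 / 2) * t ^ (-(ν + 1)) * ∫ s, gaussDeriv m t x z s ∂gegenbauer ν

instance (ν : ℝ) : SFinite (gegenbauer ν) := by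
  unfold gegenbauer
  infer_instance

lemma measurable_heatKernel (ν : ℝ) (m : ℕ) :
    Measurable fun p : ℝ × ℝ × ℝ => heatKernel ν m p.1 p.2.1 p.2.2 := by
  have h := ((measurable_gaussDeriv m).stronglyMeasurable.integral_prod_right'
    (ν := gegenbauer ν)).measurable
  unfold heatKernel
  fun_prop

/-- **Weber's second exponential integral.** -/
lemma integral_gaussian_mul_besselJ {ν : ℝ} (hν : -(1 / 2) < ν) {t x z : ℝ} (ht : 0 < t)
    (hx : 0 < x) (hz : 0 < z) :
    ∫ y in Ioi 0, Real.exp (-t * y ^ 2) * ((√(x * y) * besselJ ν (x * y)) *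
      (√(z * y) * besselJ ν (z * y))) = heatKernel ν 0 t x z := by
  have e : ∀ y ∈ Ioi (0 : ℝ), Real.exp (-t * y ^ 2) * ((√(x * y) * besselJ ν (x * y)) *
      (√(z * y) * besselJ ν (z * y))) = (x * z) ^ (ν + 1 / 2) / 4 ^ ν *
      (besselEntire ν (x * y) * (besselEntire ν (z * y) *
        (y ^ (2 * ν + 1) * Real.exp (-t * y ^ 2)))) := by
    intro y hy
    have hy : 0 < y := hy
    have hxy : 0 < x * y := by positivity
    have hzy : 0 < z * y := by positivity
    have e1 : ∀ w : ℝ, 0 < w → √w * (w / 2) ^ ν = w ^ (ν + 1 / 2) / 2 ^ ν := fun w hw => by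
      rw [Real.sqrt_eq_rpow, Real.div_rpow hw.le (by norm_num), Real.rpow_add hw]; ring
    have e2 : (x * y) ^ (ν + 1 / 2) * (z * y) ^ (ν + 1 / 2)
        = (x * z) ^ (ν + 1 / 2) * y ^ (2 * ν + 1) := by
      rw [show 2 * ν + 1 = 2 * (ν + 1 / 2) by ring, Real.rpow_mul hy.le, Real.rpow_two,
        ← Real.mul_rpow (by positivity) (by positivity),
        ← Real.mul_rpow (by positivity) (by positivity)]
      ring_nf
    have e3 : (4 : ℝ) ^ ν = 2 ^ ν * 2 ^ ν := by
      rw [← Real.mul_rpow (by norm_num) (by norm_num)]; norm_num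
    rw [besselJ_eq hxy, besselJ_eq hzy]
    calc _ = (√(x * y) * (x * y / 2) ^ ν) * (√(z * y) * (z * y / 2) ^ ν) *
          (besselEntire ν (x * y) * (besselEntire ν (z * y) * Real.exp (-t * y ^ 2))) := by ring
      _ = _ := by
        rw [e1 _ hxy, e1 _ hzy, e3, div_mul_div_comm, e2]; ring
  rw [setIntegral_congr_fun measurableSet_Ioi e, integral_const_mul, weber_entire hν ht]
  have hP := hasSum_integral_exp_gegenbauer hν (x * z / (2 * t))
  have hG := Gamma_nat_add_pos hν 0
  simp only [Nat.cast_zero, zero_add] at hG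
  have hM := gegenbauerMass_pos hν
  have hE : ∫ s, gaussDeriv 0 t x z s ∂gegenbauer ν = Real.exp (-(x ^ 2 + z ^ 2) / (4 * t)) *
      ∫ s, Real.exp (-(x * z / (2 * t) * s)) ∂gegenbauer ν := by
    rw [← integral_const_mul]
    congr 1
    funext s
    rw [← Real.exp_add]
    simp only [gaussDeriv, hermiteFun]
    simp
    field_simp
    ring
  rw [heatKernel, hE, ← hP.tsum_eq, tsum_mul_left, weberConst]
  have : (4 : ℝ) ^ ν ≠ 0 := (Real.rpow_pos_of_pos (by norm_num) _).ne'
  field_simp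

lemma quadratic_nonneg {x z s : ℝ} (hs : s ∈ Ioo (-1 : ℝ) 1) :
    0 ≤ x ^ 2 + z ^ 2 + 2 * x * z * s := by
  nlinarith [sq_nonneg (x + z * s), mul_nonneg (sq_nonneg z) (one_sub_sq_pos hs).le]

lemma hasDerivAt_heatKernel {ν : ℝ} (hν : -(1 / 2) < ν) (m : ℕ) {t x z : ℝ} (ht : 0 < t)
    (hx : 0 < x) (hz : 0 < z) :
    HasDerivAt (fun x => heatKernel ν m t x z)
      (heatKernel ν (m + 1) t x z + (ν + 1 / 2) / x * heatKernel ν m t x z) x := by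
  have := isFiniteMeasure_gegenbauer hν
  obtain ⟨C, hC0, hC⟩ := abs_gaussDeriv_le (m + 1)
  have d1 := (hasDerivAt_integral_of_dominated_loc_of_deriv_le (μ := gegenbauer ν)
    (F := fun x s => gaussDeriv m t x z s) (F' := fun x s => gaussDeriv (m + 1) t x z s)
    (x₀ := x) (s := univ) (bound := fun _ => C * (√t)⁻¹ ^ (m + 1)) Filter.univ_mem
    (Filter.Eventually.of_forall fun x => (continuous_gaussDeriv m t x z).aestronglyMeasurable)
    (integrable_gegenbauer hν (continuous_gaussDeriv m t x z))
    (continuous_gaussDeriv (m + 1) t x z).aestronglyMeasurable ?_ (integrable_const _)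
    (Filter.Eventually.of_forall fun s x _ => hasDerivAt_gaussDeriv ht m x z s)).2
  · have d2 : HasDerivAt (fun x => (x * z) ^ (ν + 1 / 2))
        (z * (ν + 1 / 2) * (x * z) ^ (ν + 1 / 2 - 1)) x := by
      have := (((hasDerivAt_id x).mul_const z).rpow_const (p := ν + 1 / 2)
        (Or.inl (mul_pos hx hz).ne'))
      simpa using this
    have d := ((d2.const_mul (weberConst ν)).mul_const (t ^ (-(ν + 1)))).mul d1
    refine d.congr_deriv ?_
    rw [heatKernel, heatKernel, Real.rpow_sub_one (by positivity)]
    field_simp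
    ring
  · filter_upwards [ae_gegenbauer_mem ν] with s hs x _
    refine (hC t x z s ht).trans ?_
    rw [← Real.exp_add]
    refine mul_le_of_le_one_right (by positivity) (Real.exp_le_one_iff.2 ?_)
    have h1 := quadratic_nonneg (x := x) (z := z) hs
    have h2 := mul_nonneg (sq_nonneg z) (one_sub_sq_pos hs).le
    rw [neg_div, neg_div]
    have h3 := div_nonneg h1 (by positivity : 0 ≤ 8 * t)
    have h4 := div_nonneg h2 (by positivity : 0 ≤ 8 * t)
    linarith

/-- Laplace-type bound: near `s = -1` the weight behaves like `(1 + s)^(ν - 1/2)`. -/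
lemma gegenbauer_laplace_bound {ν : ℝ} (hν : -(1 / 2) < ν) {η : ℝ} (hη : 0 ≤ η) :
    ∃ C, 0 ≤ C ∧ ∀ v : ℝ, 0 < v → v ^ (ν + 1 / 2 + η) *
      ∫ s, Real.exp (-(v * (1 + s) / 4)) * (1 + s) ^ η ∂gegenbauer ν ≤ C := by
  set b := ν + 1 / 2 + η with hb
  have hb0 : 0 < b := by linarith
  set K : ℝ := 1 + 2 ^ (ν - 1 / 2) with hK
  have hK0 : 0 < K := by positivity
  set L : ℝ := ∫ s in Ioo (-1 : ℝ) 1, 2 ^ η * (1 - s ^ 2) ^ (ν - 1 / 2) with hL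
  have hL0 : 0 ≤ L := setIntegral_nonneg measurableSet_Ioo fun s hs =>
    mul_nonneg (by positivity) (Real.rpow_nonneg (one_sub_sq_pos hs).le _)
  obtain ⟨D, hD0, hD⟩ : ∃ D, 0 ≤ D ∧ ∀ v : ℝ, 0 < v → v ^ b * Real.exp (-(v / 4)) ≤ D := by
    obtain ⟨N, hN⟩ := exists_nat_ge b
    refine ⟨1 + 4 ^ N * N.factorial, by positivity, fun v hv => ?_⟩
    have h1 := Real.pow_div_factorial_le_exp (v / 4) (by positivity) N
    rw [Real.exp_neg, ← div_eq_mul_inv, div_le_iff₀ (Real.exp_pos _)]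
    rcases le_or_gt v 1 with h | h
    · have := Real.rpow_le_one hv.le h hb0.le
      have h2 : 1 ≤ Real.exp (v / 4) := Real.one_le_exp (by positivity)
      have : (1 : ℝ) ≤ 1 + 4 ^ N * N.factorial := by
        have : (0 : ℝ) ≤ 4 ^ N * N.factorial := by positivity
        linarith
      nlinarith
    · have h2 : v ^ b ≤ v ^ N := by
        rw [← Real.rpow_natCast]; exact Real.rpow_le_rpow_of_exponent_le h.le hN
      rw [div_le_iff₀ (by positivity), div_pow, div_le_iff₀ (by positivity)] at h1
      nlinarith [Real.exp_pos (v / 4)]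
  refine ⟨K * (4 ^ b * Real.Gamma b) + D * L, by
    have := Real.Gamma_pos_of_pos hb0; positivity, fun v hv => ?_⟩
  have hint : IntegrableOn (fun r : ℝ => r ^ (b - 1) * Real.exp (-(v / 4 * r))) (Ioi 0) := by
    have := Real.GammaIntegral_convergent hb0
    have h2 := (integrableOn_Ioi_comp_mul_left_iff (fun r => Real.exp (-r) * r ^ (b - 1)) 0
      (by positivity : 0 < v / 4)).2 (by simpa using this)
    refine IntegrableOn.congr_fun (h2.const_mul ((v / 4) ^ (-(b - 1)))) (fun r hr => ?_) measurableSet_Ioi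
    have hr : 0 < r := hr
    rw [Real.mul_rpow (by positivity) hr.le, Real.rpow_neg (by positivity)]
    have := (Real.rpow_pos_of_pos (by positivity : 0 < v / 4) (b - 1)).ne'
    field_simp
  have hsub : Ioo (-1 : ℝ) 1 ⊆ (fun s => 1 + s) ⁻¹' (Ioi 0) := fun s hs => by
    simp only [mem_preimage, mem_Ioi]; linarith [hs.1]
  have mp : MeasurePreserving (fun s : ℝ => 1 + s) volume volume := measurePreserving_add_left _ 1
  have hint2 : IntegrableOn (fun s : ℝ => (1 + s) ^ (b - 1) * Real.exp (-(v / 4 * (1 + s))))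
      ((fun s => 1 + s) ⁻¹' (Ioi 0)) :=
    (mp.integrableOn_comp_preimage (measurableEmbedding_addLeft 1)).2 hint
  have hval : ∫ s in Ioo (-1 : ℝ) 1, (1 + s) ^ (b - 1) * Real.exp (-(v / 4 * (1 + s)))
      ≤ v ^ (-b) * (4 ^ b * Real.Gamma b) := by
    calc _ ≤ ∫ s in (fun s => 1 + s) ⁻¹' (Ioi (0 : ℝ)),
          (1 + s) ^ (b - 1) * Real.exp (-(v / 4 * (1 + s))) := by
          refine setIntegral_mono_set hint2 ?_ hsub.eventuallyLE
          filter_upwards [ae_restrict_mem (measurableSet_Ioi.preimage (by fun_prop))] with s hs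
          exact mul_nonneg (Real.rpow_nonneg (le_of_lt hs) _) (Real.exp_pos _).le
      _ = ∫ r in Ioi (0 : ℝ), r ^ (b - 1) * Real.exp (-(v / 4 * r)) :=
          mp.setIntegral_preimage_emb (measurableEmbedding_addLeft 1)
            (fun r => r ^ (b - 1) * Real.exp (-(v / 4 * r))) _
      _ = _ := by
          rw [Real.integral_rpow_mul_exp_neg_mul_Ioi hb0 (by positivity), one_div, inv_div,
            Real.div_rpow (by norm_num) hv.le, Real.rpow_neg hv.le]
          ring
  -- For `s ≤ 0` the weight is at most `K (1 + s)^(ν - 1/2)`, and the integral becomes part of a Gamma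
  -- integral; for `s > 0` the exponential is at most `e^(-v/4)`.
  have hmono : ∫ s, Real.exp (-(v * (1 + s) / 4)) * (1 + s) ^ η ∂gegenbauer ν
      ≤ K * (∫ s in Ioo (-1 : ℝ) 1, (1 + s) ^ (b - 1) * Real.exp (-(v / 4 * (1 + s))))
        + Real.exp (-(v / 4)) * L := by
    rw [integral_gegenbauer, hL, ← integral_const_mul, ← integral_const_mul,
      ← integral_add ((hint2.mono_set hsub).const_mul K)
        (((integrableOn_one_sub_sq_rpow (by linarith)).const_mul _).const_mul _)]
    refine integral_mono_of_nonneg ?_ (((hint2.mono_set hsub).const_mul K).add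
        (((integrableOn_one_sub_sq_rpow (by linarith)).const_mul _).const_mul _)) ?_
    · filter_upwards [ae_restrict_mem measurableSet_Ioo] with s hs
      have h1 : 0 < 1 + s := by linarith [hs.1]
      have := Real.rpow_nonneg (one_sub_sq_pos hs).le (ν - 1 / 2)
      have := Real.rpow_nonneg h1.le η
      positivity
    · filter_upwards [ae_restrict_mem measurableSet_Ioo] with s hs
      have h1 : 0 < 1 + s := by linarith [hs.1]
      have h2 : 0 < 1 - s := by linarith [hs.2]
      have p1 := Real.rpow_nonneg (one_sub_sq_pos hs).le (ν - 1 / 2)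
      have p2 := Real.rpow_nonneg h1.le η
      have p3 := Real.rpow_nonneg h1.le (b - 1)
      have p4 := Real.rpow_nonneg h1.le (ν - 1 / 2)
      rcases le_or_gt s 0 with h | h
      · have hk : (1 - s) ^ (ν - 1 / 2) ≤ K := by
          rcases le_or_gt 0 (ν - 1 / 2) with hn | hn
          · have : (1 - s) ^ (ν - 1 / 2) ≤ 2 ^ (ν - 1 / 2) :=
              Real.rpow_le_rpow h2.le (by linarith [hs.1]) hn
            linarith
          · have : (1 - s) ^ (ν - 1 / 2) ≤ 1 :=
              Real.rpow_le_one_of_one_le_of_nonpos (by linarith) hn.le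
            have : (0 : ℝ) < 2 ^ (ν - 1 / 2) := by positivity
            linarith
        have e1 : (1 - s ^ 2) ^ (ν - 1 / 2) = (1 - s) ^ (ν - 1 / 2) * (1 + s) ^ (ν - 1 / 2) := by
          rw [← Real.mul_rpow h2.le h1.le]; ring_nf
        have e2 : (1 + s) ^ (b - 1) = (1 + s) ^ (ν - 1 / 2) * (1 + s) ^ η := by
          rw [← Real.rpow_add h1, hb]; ring_nf
        have e3 : v * (1 + s) / 4 = v / 4 * (1 + s) := by ring
        rw [e1, e2, e3]
        have : 0 ≤ Real.exp (-(v / 4)) * (2 ^ η * ((1 - s) ^ (ν - 1 / 2) * (1 + s) ^ (ν - 1 / 2))) := by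
          rw [← e1]; positivity
        calc _ = (1 - s) ^ (ν - 1 / 2) * ((1 + s) ^ (ν - 1 / 2) * (1 + s) ^ η *
              Real.exp (-(v / 4 * (1 + s)))) := by ring
          _ ≤ K * ((1 + s) ^ (ν - 1 / 2) * (1 + s) ^ η * Real.exp (-(v / 4 * (1 + s)))) := by
              gcongr
          _ ≤ _ := by linarith
      · have : 0 ≤ K * ((1 + s) ^ (b - 1) * Real.exp (-(v / 4 * (1 + s)))) := by positivity
        have h5 : (1 + s) ^ η ≤ 2 ^ η := Real.rpow_le_rpow h1.le (by linarith [hs.2]) hη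
        have h6 : Real.exp (-(v * (1 + s) / 4)) ≤ Real.exp (-(v / 4)) := by
          apply Real.exp_le_exp.2; nlinarith
        calc _ = Real.exp (-(v * (1 + s) / 4)) * ((1 + s) ^ η * (1 - s ^ 2) ^ (ν - 1 / 2)) := by ring
          _ ≤ Real.exp (-(v / 4)) * (2 ^ η * (1 - s ^ 2) ^ (ν - 1 / 2)) := by gcongr
          _ ≤ _ := by linarith
  have hvb := Real.rpow_pos_of_pos hv b
  calc _ ≤ v ^ b * (K * (v ^ (-b) * (4 ^ b * Real.Gamma b)) + Real.exp (-(v / 4)) * L) := by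
        gcongr
        exact hmono.trans (by gcongr)
    _ = K * (4 ^ b * Real.Gamma b) + (v ^ b * Real.exp (-(v / 4))) * L := by
        rw [Real.rpow_neg hv.le]; field_simp
    _ ≤ _ := by gcongr; exact hD v hv

/-- A pointwise bound of the integrand by `A e^(-(x-z)²/8t) e^(-v(1+s)/4) (1 + s)^η`, `v = x z / t`,
gives a Gaussian bound with a gain `v^(-η)`. -/
lemma abs_kernel_le_of_integrand_le {ν : ℝ} (hν : -(1 / 2) < ν) {η : ℝ} (hη : 0 ≤ η) :
    ∃ C, 0 ≤ C ∧ ∀ (t x z A : ℝ) (g : ℝ → ℝ), 0 < t → 0 < x → 0 < z → 0 ≤ A →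
      (∀ s ∈ Ioo (-1 : ℝ) 1, |g s| ≤ A * (Real.exp (-(x ^ 2 + z ^ 2 + 2 * x * z * s) / (8 * t)) *
        (1 + s) ^ η)) →
      |(x * z) ^ (ν + 1 / 2) * t ^ (-(ν + 1)) * ∫ s, g s ∂gegenbauer ν|
        ≤ A * C * ((√t)⁻¹ * (t / (x * z)) ^ η * Real.exp (-(x - z) ^ 2 / (8 * t))) := by
  obtain ⟨C, hC0, hC⟩ := gegenbauer_laplace_bound hν hη
  refine ⟨C, hC0, fun t x z A g ht hx hz hA hg => ?_⟩
  set v := x * z / t with hv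
  have hv0 : 0 < v := by positivity
  have e1 : (x * z) ^ (ν + 1 / 2) * t ^ (-(ν + 1)) = (√t)⁻¹ * (t / (x * z)) ^ η *
      v ^ (ν + 1 / 2 + η) := by
    have hxz : 0 < x * z := by positivity
    rw [hv, Real.div_rpow ht.le hxz.le, Real.div_rpow hxz.le ht.le, Real.sqrt_eq_rpow,
      Real.rpow_add hxz _ η, Real.rpow_add ht _ η, Real.rpow_neg ht.le,
      show ν + 1 = (ν + 1 / 2) + 1 / 2 by ring, Real.rpow_add ht _ (1 / 2)]
    have := (Real.rpow_pos_of_pos ht η).ne'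
    have := (Real.rpow_pos_of_pos hxz η).ne'
    field_simp
  have e2 : ∀ s : ℝ, Real.exp (-(x ^ 2 + z ^ 2 + 2 * x * z * s) / (8 * t))
      = Real.exp (-(x - z) ^ 2 / (8 * t)) * Real.exp (-(v * (1 + s) / 4)) := fun s => by
    rw [← Real.exp_add, hv]
    congr 1
    field_simp
    ring
  have h1 : |∫ s, g s ∂gegenbauer ν| ≤ A * Real.exp (-(x - z) ^ 2 / (8 * t)) *
      ∫ s, Real.exp (-(v * (1 + s) / 4)) * (1 + s) ^ η ∂gegenbauer ν := by
    rw [← integral_const_mul, ← Real.norm_eq_abs]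
    refine norm_integral_le_of_norm_le (integrable_gegenbauer hν ?_) ?_
    · exact Continuous.mul (by fun_prop)
        (Continuous.mul (by fun_prop) (Continuous.rpow_const (by fun_prop) fun _ => Or.inr hη))
    · filter_upwards [ae_gegenbauer_mem ν] with s hs
      refine (hg s hs).trans (le_of_eq ?_)
      rw [e2]; ring
  rw [e1, abs_mul, abs_of_nonneg (by positivity)]
  calc _ ≤ (√t)⁻¹ * (t / (x * z)) ^ η * v ^ (ν + 1 / 2 + η) *
        (A * Real.exp (-(x - z) ^ 2 / (8 * t)) *
      ∫ s, Real.exp (-(v * (1 + s) / 4)) * (1 + s) ^ η ∂gegenbauer ν) := by gcongr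
    _ = A * ((√t)⁻¹ * (t / (x * z)) ^ η * Real.exp (-(x - z) ^ 2 / (8 * t))) *
        (v ^ (ν + 1 / 2 + η) *
      ∫ s, Real.exp (-(v * (1 + s) / 4)) * (1 + s) ^ η ∂gegenbauer ν) := by ring
    _ ≤ A * ((√t)⁻¹ * (t / (x * z)) ^ η * Real.exp (-(x - z) ^ 2 / (8 * t))) * C := by
        gcongr; exact hC v hv0
    _ = _ := by ring

/-- Gaussian bound for the derivatives of the heat kernel. -/
lemma abs_heatKernel_le {ν : ℝ} (hν : -(1 / 2) < ν) (m : ℕ) : ∃ C, 0 ≤ C ∧ ∀ t x z : ℝ,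
    0 < t → 0 < x → 0 < z → |heatKernel ν m t x z|
      ≤ C * (√t)⁻¹ ^ m * ((√t)⁻¹ * Real.exp (-(x - z) ^ 2 / (8 * t))) := by
  obtain ⟨C, hC0, hC⟩ := abs_kernel_le_of_integrand_le hν (le_refl 0)
  obtain ⟨D, hD0, hD⟩ := abs_gaussDeriv_le m
  have hw := weberConst_pos hν
  refine ⟨weberConst ν * D * C, by positivity, fun t x z ht hx hz => ?_⟩
  have h := hC t x z (D * (√t)⁻¹ ^ m) (fun s => gaussDeriv m t x z s) ht hx hz (by positivity)
    (fun s hs => by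
      refine (hD t x z s ht).trans ?_
      rw [Real.rpow_zero]
      gcongr
      refine Real.exp_le_one_iff.2 ?_
      have h2 := mul_nonneg (sq_nonneg z) (one_sub_sq_pos hs).le
      rw [neg_div]
      have h4 := div_nonneg h2 (by positivity : 0 ≤ 8 * t)
      linarith)
  rw [heatKernel, mul_assoc (weberConst ν), mul_assoc (weberConst ν), abs_mul, abs_of_pos hw]
  rw [Real.rpow_zero, mul_one] at h
  calc _ ≤ _ := mul_le_mul_of_nonneg_left h hw.le
    _ = _ := by ring

/-- The difference of the heat kernels for `ν` and `ν + 1`: integrating by parts in Poisson's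
integral produces factors vanishing at `s = -1`, where the Gaussian concentrates. -/
lemma heatKernel_sub_heatKernel_add_one {ν : ℝ} (hν : -(1 / 2) < ν) (m : ℕ) {t x z : ℝ}
    (ht : 0 < t) (hx : 0 < x) (hz : 0 < z) :
    heatKernel ν m t x z - heatKernel (ν + 1) m t x z
      = weberConst ν * ((x * z) ^ (ν + 1 / 2) * t ^ (-(ν + 1)) *
        ∫ s, ((1 + s) * gaussDeriv m t x z s + m * z / (2 * t * (2 * ν + 1)) *
          ((1 - s ^ 2) * gaussDeriv (m - 1) t x z s)) ∂gegenbauer ν) := by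
  have c1 := continuous_gaussDeriv m t x z
  have c2 := continuous_gaussDeriv (m - 1) t x z
  have h := gegenbauer_integral_by_parts hν
    (fun s => hasDerivAt_gaussDeriv_angle ht m x z s) (by fun_prop)
  have e0 : ∀ s, (1 - s ^ 2) * (-(x * z / (2 * t)) * gaussDeriv m t x z s
        - m * (z / (2 * t)) * gaussDeriv (m - 1) t x z s)
      = -(x * z / (2 * t)) * ((1 - s ^ 2) * gaussDeriv m t x z s)
        - m * (z / (2 * t)) * ((1 - s ^ 2) * gaussDeriv (m - 1) t x z s) := fun s => by ring
  simp only [e0] at h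
  rw [integral_sub ((integrable_gegenbauer hν (by fun_prop)).const_mul _)
    ((integrable_gegenbauer hν (by fun_prop)).const_mul _), integral_const_mul,
    integral_const_mul] at h
  have e1 : ∫ s, ((1 + s) * gaussDeriv m t x z s + m * z / (2 * t * (2 * ν + 1)) *
      ((1 - s ^ 2) * gaussDeriv (m - 1) t x z s)) ∂gegenbauer ν
      = ∫ s, gaussDeriv m t x z s ∂gegenbauer ν + ∫ s, s * gaussDeriv m t x z s ∂gegenbauer ν
        + m * z / (2 * t * (2 * ν + 1)) *
          ∫ s, (1 - s ^ 2) * gaussDeriv (m - 1) t x z s ∂gegenbauer ν := by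
    rw [integral_add (integrable_gegenbauer hν (by fun_prop))
      ((integrable_gegenbauer hν (by fun_prop)).const_mul _), integral_const_mul]
    congr 1
    rw [← integral_add (integrable_gegenbauer hν (by fun_prop))
      (integrable_gegenbauer hν (by fun_prop))]
    congr 1
    funext s
    ring
  have hxz : 0 < x * z := by positivity
  have h3 : 2 * ν + 1 ≠ 0 := by linarith
  rw [e1, heatKernel, heatKernel, integral_gegenbauer_add_one, weberConst_add_one hν,
    show ν + 1 + 1 / 2 = (ν + 1 / 2) + 1 by ring, Real.rpow_add_one hxz.ne',
    show -(ν + 1 + 1) = -(ν + 1) - 1 by ring, Real.rpow_sub_one ht.ne']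
  set A := ∫ s, gaussDeriv m t x z s ∂gegenbauer ν
  set B := ∫ s, s * gaussDeriv m t x z s ∂gegenbauer ν
  set P := ∫ s, (1 - s ^ 2) * gaussDeriv m t x z s ∂gegenbauer ν
  set Q := ∫ s, (1 - s ^ 2) * gaussDeriv (m - 1) t x z s ∂gegenbauer ν
  have hB : B = (-(x * z / (2 * t)) * P - m * (z / (2 * t)) * Q) / (2 * ν + 1) := by
    rw [h]; field_simp
  rw [hB]
  field_simp
  ring

lemma abs_heatKernel_sub_add_one_le {ν : ℝ} (hν : -(1 / 2) < ν) (m : ℕ) {η : ℝ} (hη : 0 ≤ η)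
    (hη' : η ≤ 1 / 2) : ∃ C, 0 ≤ C ∧ ∀ t x z : ℝ, 0 < t → 0 < x → 0 < z →
      |heatKernel ν m t x z - heatKernel (ν + 1) m t x z|
      ≤ C * (√t)⁻¹ ^ m * ((√t)⁻¹ * Real.exp (-(x - z) ^ 2 / (8 * t))) * (t / (x * z)) ^ η := by
  obtain ⟨C, hC0, hC⟩ := abs_kernel_le_of_integrand_le hν hη
  obtain ⟨D, hD0, hD⟩ := abs_gaussDeriv_le m
  obtain ⟨D', hD'0, hD'⟩ := abs_gaussDeriv_le (m - 1)
  have hw := weberConst_pos hν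
  have h21 : 0 < 2 * ν + 1 := by linarith
  set M : ℝ := 2 * D + m * (8 * D') / (2 * (2 * ν + 1)) with hM
  refine ⟨weberConst ν * M * C, by positivity, fun t x z ht hx hz => ?_⟩
  have hst : 0 < √t := Real.sqrt_pos.2 ht
  rw [heatKernel_sub_heatKernel_add_one hν m ht hx hz]
  have h := hC t x z (M * (√t)⁻¹ ^ m) (fun s => (1 + s) * gaussDeriv m t x z s +
    m * z / (2 * t * (2 * ν + 1)) * ((1 - s ^ 2) * gaussDeriv (m - 1) t x z s)) ht hx hz
    (by positivity) (fun s hs => by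
      have h1 : 0 < 1 + s := by linarith [hs.1]
      have h1' : 1 + s ≤ 2 := by linarith [hs.2]
      have h2 := one_sub_sq_pos hs
      set q := Real.exp (-(x ^ 2 + z ^ 2 + 2 * x * z * s) / (8 * t)) with hq
      have hq0 : 0 < q := Real.exp_pos _
      have b0 : ∀ a : ℝ, 0 ≤ a → a ≤ 1 → (1 + s) ^ a ≤ 2 := fun a ha ha1 => by
        calc (1 + s) ^ a ≤ 2 ^ a := Real.rpow_le_rpow h1.le h1' ha
          _ ≤ 2 ^ (1 : ℝ) := Real.rpow_le_rpow_of_exponent_le (by norm_num) ha1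
          _ = 2 := by norm_num
      have hη1 := Real.rpow_pos_of_pos h1 η
      -- Both `1 + s` and `√(1 - s²)` gain a factor `(1 + s)^η`; for the second this needs `η ≤ 1/2`.
      have b1 : (1 + s) ≤ 2 * (1 + s) ^ η := by
        calc 1 + s = (1 + s) ^ (1 - η) * (1 + s) ^ η := by
              rw [← Real.rpow_add h1]; simp
          _ ≤ _ := by gcongr; exact b0 _ (by linarith) (by linarith)
      have b2 : √(1 - s ^ 2) ≤ 4 * (1 + s) ^ η := by
        calc √(1 - s ^ 2) ≤ √(2 * (1 + s)) := Real.sqrt_le_sqrt (by nlinarith)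
          _ = √2 * ((1 + s) ^ (1 / 2 - η) * (1 + s) ^ η) := by
              rw [← Real.rpow_add h1, Real.sqrt_mul (by norm_num), Real.sqrt_eq_rpow (1 + s)]
              simp
          _ ≤ 2 * (2 * (1 + s) ^ η) := by
              gcongr
              · rw [Real.sqrt_le_left (by norm_num)]; norm_num
              · exact b0 _ (by linarith) (by linarith)
          _ = _ := by ring
      have t1 : |(1 + s) * gaussDeriv m t x z s| ≤ 2 * D * (√t)⁻¹ ^ m * (q * (1 + s) ^ η) := by
        rw [abs_mul, abs_of_pos h1]
        have : Real.exp (-(z ^ 2 * (1 - s ^ 2)) / (8 * t)) ≤ 1 := by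
          refine Real.exp_le_one_iff.2 ?_
          rw [neg_div]
          have h4 := div_nonneg (mul_nonneg (sq_nonneg z) h2.le) (by positivity : 0 ≤ 8 * t)
          linarith
        calc _ ≤ 2 * (1 + s) ^ η * (D * (√t)⁻¹ ^ m * (q * 1)) := by
              gcongr
              refine (hD t x z s ht).trans ?_
              gcongr
          _ = _ := by ring
      have t2 : |m * z / (2 * t * (2 * ν + 1)) * ((1 - s ^ 2) * gaussDeriv (m - 1) t x z s)|
          ≤ m * (8 * D') / (2 * (2 * ν + 1)) * (√t)⁻¹ ^ m * (q * (1 + s) ^ η) := by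
        rcases Nat.eq_zero_or_pos m with rfl | hm
        · simp
        -- The factor `z` is absorbed, together with the other half of `1 - s²`, by the Gaussian
        -- `e^(-z²(1 - s²)/8t)` in the bound for `gaussDeriv`.
        set r := z * √(1 - s ^ 2) / √t with hr
        have hr0 : 0 ≤ r := by positivity
        have hr2 : z ^ 2 * (1 - s ^ 2) / (8 * t) = r ^ 2 / 8 := by
          rw [hr, div_pow, mul_pow, Real.sq_sqrt h2.le, Real.sq_sqrt ht.le]; field_simp
        have hre : r * Real.exp (-(z ^ 2 * (1 - s ^ 2)) / (8 * t)) ≤ 2 := by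
          rw [neg_div, hr2, Real.exp_neg, ← div_eq_mul_inv, div_le_iff₀ (Real.exp_pos _)]
          nlinarith [Real.add_one_le_exp (r ^ 2 / 8), sq_nonneg (r / 2 - 1)]
        have hpow : (√t)⁻¹ ^ m = (√t)⁻¹ ^ (m - 1) * (√t)⁻¹ := by
          rw [← pow_succ, Nat.sub_add_cancel hm]
        rw [abs_mul, abs_mul, abs_of_nonneg (by positivity), abs_of_pos h2]
        calc _ ≤ m * z / (2 * t * (2 * ν + 1)) * ((1 - s ^ 2) * (D' * (√t)⁻¹ ^ (m - 1) *
              (q * Real.exp (-(z ^ 2 * (1 - s ^ 2)) / (8 * t))))) := by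
              gcongr
              exact hD' t x z s ht
          _ = m / (2 * (2 * ν + 1)) * D' * (√t)⁻¹ ^ m * q * √(1 - s ^ 2) *
              (r * Real.exp (-(z ^ 2 * (1 - s ^ 2)) / (8 * t))) := by
              rw [hpow, hr]
              have e5 : 1 - s ^ 2 = √(1 - s ^ 2) * √(1 - s ^ 2) :=
                (Real.mul_self_sqrt h2.le).symm
              have e6 : t = √t * √t := (Real.mul_self_sqrt ht.le).symm
              have e7 : z / t * (1 - s ^ 2) = (√t)⁻¹ * √(1 - s ^ 2) * (z * √(1 - s ^ 2) / √t) := by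
                nth_rewrite 1 [e5]
                nth_rewrite 1 [e6]
                field_simp
              calc _ = m / (2 * (2 * ν + 1)) * D' * (√t)⁻¹ ^ (m - 1) * q *
                    Real.exp (-(z ^ 2 * (1 - s ^ 2)) / (8 * t)) * (z / t * (1 - s ^ 2)) := by
                    field_simp
                _ = _ := by rw [e7]; ring
          _ ≤ m / (2 * (2 * ν + 1)) * D' * (√t)⁻¹ ^ m * q * (4 * (1 + s) ^ η) * 2 := by
              gcongr
          _ = _ := by ring
      calc _ ≤ _ := abs_add_le _ _
        _ ≤ _ := add_le_add t1 t2
        _ = _ := by rw [hM]; ring)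
  rw [abs_mul, abs_of_pos hw]
  calc _ ≤ _ := mul_le_mul_of_nonneg_left h hw.le
    _ = _ := by ring

/-- The heat kernels for `ν` and `ν + a`, `a ∈ ℕ`, differ by a factor `(t / (x z))^η` less than
their common Gaussian bound. -/
lemma abs_heatKernel_sub_add_nat_le {ν : ℝ} (hν : -(1 / 2) < ν) (a m : ℕ) {η : ℝ} (hη : 0 ≤ η)
    (hη' : η ≤ 1 / 2) : ∃ C, 0 ≤ C ∧ ∀ t x z : ℝ, 0 < t → 0 < x → 0 < z →
      |heatKernel ν m t x z - heatKernel (ν + a) m t x z|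
      ≤ C * (√t)⁻¹ ^ m * ((√t)⁻¹ * Real.exp (-(x - z) ^ 2 / (8 * t))) * (t / (x * z)) ^ η := by
  induction a with
  | zero => exact ⟨0, le_rfl, fun t x z _ _ _ => by simp⟩
  | succ a ih =>
    obtain ⟨C, hC0, hC⟩ := ih
    obtain ⟨D, hD0, hD⟩ := abs_heatKernel_sub_add_one_le (ν := ν + a)
      (by have := a.cast_nonneg (α := ℝ); linarith) m hη hη'
    refine ⟨C + D, by positivity, fun t x z ht hx hz => ?_⟩
    have e : ν + (a + 1 : ℕ) = ν + a + 1 := by push_cast; ring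
    rw [e]
    calc _ = |(heatKernel ν m t x z - heatKernel (ν + a) m t x z) +
          (heatKernel (ν + a) m t x z - heatKernel (ν + a + 1) m t x z)| := by ring_nf
      _ ≤ _ := abs_add_le _ _
      _ ≤ _ := add_le_add (hC t x z ht hx hz) (hD t x z ht hx hz)
      _ = _ := by ring

/-! ### Measure theory on the orthant -/

lemma orthantMeasure_eq_pi (n : ℕ) :
    orthantMeasure n = Measure.pi fun _ : Fin n => (volume : Measure ℝ).restrict (Ioi 0) := by
  rw [← Measure.restrict_pi_pi, orthantMeasure, volume_pi]
  congr 1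
  ext x
  simp [orthant]

lemma measurableSet_orthant (n : ℕ) : MeasurableSet (orthant n : Set (Fin n → ℝ)) :=
  (orthant n).isOpen.measurableSet

lemma ae_orthant (n : ℕ) : ∀ᵐ x ∂orthantMeasure n, ∀ j, 0 < x j := by
  filter_upwards [ae_restrict_mem (measurableSet_orthant n)] with x hx using hx

instance (n : ℕ) : SigmaFinite (orthantMeasure n) := by
  unfold orthantMeasure; infer_instance

instance (n : ℕ) : IsFiniteMeasureOnCompacts (orthantMeasure n) := by
  unfold orthantMeasure; infer_instance

/-- Tonelli's theorem for products of functions of one variable. -/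
lemma lintegral_pi_prod {n : ℕ} (μ : Fin n → Measure ℝ) [∀ i, SigmaFinite (μ i)]
    {f : Fin n → ℝ → ℝ≥0∞} (hf : ∀ i, Measurable (f i)) :
    ∫⁻ x, ∏ i, f i (x i) ∂Measure.pi μ = ∏ i, ∫⁻ x, f i x ∂μ i := by
  induction n with
  | zero => simp
  | succ n ih =>
    have hm : Measurable fun x : Fin n → ℝ => ∏ i : Fin n, f i.succ (x i) :=
      Finset.measurable_prod _ fun i _ => (hf _).comp (measurable_pi_apply i)
    rw [← (measurePreserving_piFinSuccAbove μ 0).symm.lintegral_comp_emb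
      (MeasurableEquiv.measurableEmbedding _), Fin.prod_univ_succ]
    simp_rw [MeasurableEquiv.piFinSuccAbove_symm_apply, Fin.insertNthEquiv,
      Fin.prod_univ_succ, Fin.insertNth_zero, Equiv.coe_fn_mk, Fin.cons_succ,
      Fin.zero_succAbove, cast_eq, Fin.cons_zero]
    rw [lintegral_prod_mul (hf 0).aemeasurable hm.aemeasurable]
    congr 1
    exact ih (fun i => μ i.succ) fun i => hf i.succ

lemma lintegral_orthant_prod {n : ℕ} {f : Fin n → ℝ → ℝ≥0∞} (hf : ∀ i, Measurable (f i)) :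
    ∫⁻ x, ∏ i, f i (x i) ∂orthantMeasure n = ∏ i, ∫⁻ x in Ioi 0, f i x := by
  rw [orthantMeasure_eq_pi, lintegral_pi_prod _ hf]

lemma integral_orthant_prod {n : ℕ} (f : Fin n → ℝ → ℝ) :
    ∫ x, ∏ i, f i (x i) ∂orthantMeasure n = ∏ i, ∫ x in Ioi 0, f i x := by
  rw [orthantMeasure_eq_pi, integral_fintype_prod_eq_prod]

/-- The Gaussian `t^(-1/2) e^(-(x - z)² / (8 t))` in one variable. -/
noncomputable def gauss (t x z : ℝ) : ℝ := (√t)⁻¹ * Real.exp (-(x - z) ^ 2 / (8 * t))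

lemma gauss_nonneg (t x z : ℝ) : 0 ≤ gauss t x z := by unfold gauss; positivity

lemma gauss_comm (t x z : ℝ) : gauss t x z = gauss t z x := by
  unfold gauss; rw [← neg_sub z x, neg_sq]

lemma measurable_gauss : Measurable fun p : ℝ × ℝ × ℝ => gauss p.1 p.2.1 p.2.2 := by
  unfold gauss; fun_prop

lemma lintegral_gauss_le {t : ℝ} (ht : 0 < t) (x : ℝ) :
    ∫⁻ z in Ioi 0, ENNReal.ofReal (gauss t x z) ≤ ENNReal.ofReal √(8 * Real.pi) := by
  have hi : Integrable (fun z : ℝ => Real.exp (-(1 / (8 * t)) * z ^ 2)) :=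
    integrable_exp_neg_mul_sq (by positivity)
  have e : ∀ z, gauss t x z = (√t)⁻¹ * Real.exp (-(1 / (8 * t)) * (x - z) ^ 2) := fun z => by
    rw [gauss]; congr 2; ring
  calc _ ≤ ∫⁻ z, ENNReal.ofReal (gauss t x z) := setLIntegral_le_lintegral _ _
    _ = ENNReal.ofReal (∫ z, (√t)⁻¹ * Real.exp (-(1 / (8 * t)) * (x - z) ^ 2)) := by
        simp_rw [e]
        rw [ofReal_integral_eq_lintegral_ofReal]
        · exact (hi.comp_sub_left x).const_mul _
        · exact Filter.Eventually.of_forall fun z => by positivity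
    _ = _ := by
        rw [integral_const_mul, integral_sub_left_eq_self
          (fun z => Real.exp (-(1 / (8 * t)) * z ^ 2)) volume x, integral_gaussian]
        congr 1
        rw [show Real.pi / (1 / (8 * t)) = 8 * Real.pi * t by field_simp,
          Real.sqrt_mul (by positivity)]
        have : √t ≠ 0 := (Real.sqrt_pos.2 ht).ne'
        field_simp

/-- The Gaussian `t^(-n/2) e^(-|x - z|² / (8 t))`. -/
noncomputable def gaussProd {n : ℕ} (t : ℝ) (x z : Fin n → ℝ) : ℝ := ∏ j, gauss t (x j) (z j)

lemma gaussProd_nonneg {n : ℕ} (t : ℝ) (x z : Fin n → ℝ) : 0 ≤ gaussProd t x z :=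
  Finset.prod_nonneg fun _ _ => gauss_nonneg _ _ _

lemma gaussProd_comm {n : ℕ} (t : ℝ) (x z : Fin n → ℝ) : gaussProd t x z = gaussProd t z x :=
  Finset.prod_congr rfl fun _ _ => gauss_comm _ _ _

lemma measurable_gaussProd (n : ℕ) :
    Measurable fun p : ℝ × (Fin n → ℝ) × (Fin n → ℝ) => gaussProd p.1 p.2.1 p.2.2 := by
  unfold gaussProd
  refine Finset.measurable_prod _ fun j _ => measurable_gauss.comp (f :=
    fun p : ℝ × (Fin n → ℝ) × (Fin n → ℝ) => (p.1, p.2.1 j, p.2.2 j)) (by fun_prop)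

lemma lintegral_gaussProd_le {n : ℕ} {t : ℝ} (ht : 0 < t) (x : Fin n → ℝ) :
    ∫⁻ z, ENNReal.ofReal (gaussProd t x z) ∂orthantMeasure n
      ≤ ENNReal.ofReal √(8 * Real.pi) ^ n := by
  simp only [gaussProd, ENNReal.ofReal_prod_of_nonneg fun _ _ => gauss_nonneg _ _ _]
  rw [lintegral_orthant_prod (f := fun j z => ENNReal.ofReal (gauss t (x j) z)) fun j =>
    (measurable_gauss.comp (f := fun z => (t, x j, z)) (by fun_prop)).ennreal_ofReal]
  exact (Finset.prod_le_prod' fun j _ => lintegral_gauss_le ht (x j)).trans (by simp)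

/-! ### Test functions -/

open Filter Topology in
/-- Dominated convergence in `L^p`. -/
lemma tendsto_eLpNorm_of_dominated {α F : Type*} [MeasurableSpace α] [NormedAddCommGroup F]
    {μ : Measure α} {p : ℝ≥0∞} (hp0 : p ≠ 0) (hp : p ≠ ∞) {f : ℕ → α → F} {g : α → ℝ}
    (hf : ∀ m, AEStronglyMeasurable (f m) μ) (hg : MemLp g p μ)
    (hfg : ∀ m, ∀ᵐ x ∂μ, ‖f m x‖ ≤ g x) (hlim : ∀ᵐ x ∂μ, Tendsto (fun m => f m x) atTop (𝓝 0)) :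
    Tendsto (fun m => eLpNorm (f m) p μ) atTop (𝓝 0) := by
  have hp' : 0 < p.toReal := ENNReal.toReal_pos hp0 hp
  have h := tendsto_lintegral_of_dominated_convergence' (μ := μ)
    (F := fun m x => ‖f m x‖ₑ ^ p.toReal) (f := fun _ => 0) (fun x => ‖g x‖ₑ ^ p.toReal)
    (fun m => (hf m).enorm.pow_const _) (fun m => ?_) ?_ ?_
  · simp only [eLpNorm_eq_lintegral_rpow_enorm_toReal hp0 hp]
    have h2 := (ENNReal.continuous_rpow_const (y := 1 / p.toReal)).tendsto 0 |>.comp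
      (by simpa using h)
    rwa [ENNReal.zero_rpow_of_pos (by positivity)] at h2
  · filter_upwards [hfg m] with x hx
    gcongr
    rw [enorm_le_iff_norm_le]
    exact hx.trans (le_abs_self _)
  · have := hg.eLpNorm_lt_top
    rw [eLpNorm_eq_lintegral_rpow_enorm_toReal hp0 hp] at this
    exact ((ENNReal.rpow_lt_top_iff_of_pos (by positivity)).1 this).ne
  · filter_upwards [hlim] with x hx
    have h2 := (ENNReal.continuous_rpow_const (y := p.toReal)).tendsto 0 |>.comp
      (by simpa using hx.enorm)
    rwa [ENNReal.zero_rpow_of_pos hp'] at h2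

variable {n : ℕ} {F : Type*} [NormedAddCommGroup F] [NormedSpace ℝ F]

/-- A test function from a smooth function which vanishes unless all coordinates exceed `c > 0`. -/
def testFunctionOfSupport (g : (Fin n → ℝ) → F) (hg : ContDiff ℝ (⊤ : ℕ∞) g)
    (hc : HasCompactSupport g) {c : ℝ} (hc0 : 0 < c) (h : ∀ x, g x ≠ 0 → ∀ j, c ≤ x j) :
    𝓓(orthant n, F) where
  toFun := g
  contDiff' := hg
  hasCompactSupport' := hc
  tsupport_subset' := by
    have hcl : IsClosed {x : Fin n → ℝ | ∀ j, c ≤ x j} := by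
      simp only [ofPred_forall]
      exact isClosed_iInter fun j => isClosed_le continuous_const (continuous_apply j)
    have : tsupport g ⊆ {x : Fin n → ℝ | ∀ j, c ≤ x j} := closure_minimal (fun x hx => h x hx) hcl
    exact fun x hx j => hc0.trans_le (this hx j)

open Filter Topology in
/-- Test functions on the orthant are dense in `L^p`. -/
lemma exists_testFunction_eLpNorm_sub_le {p : ℝ≥0∞} (hp : p ≠ ∞) (hp1 : 1 ≤ p)
    {f : (Fin n → ℝ) → F} (hf : MemLp f p (orthantMeasure n)) {ε : ℝ} (hε : 0 < ε) :
    ∃ g : 𝓓(orthant n, F), eLpNorm (f - ⇑g) p (orthantMeasure n) ≤ ENNReal.ofReal ε := by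
  obtain ⟨g, hgc, hgs, hg⟩ := hf.exist_eLpNorm_sub_le hp hp1 (half_pos hε)
  -- `χ m` is a smooth cutoff that vanishes unless all `x_j > 1 / (m + 1)`.
  set χ : ℕ → (Fin n → ℝ) → ℝ := fun m x => ∏ j, Real.smoothTransition ((m + 1) * x j - 1) with hχ
  have hχs : ∀ m, ContDiff ℝ (⊤ : ℕ∞) (χ m) := fun m =>
    contDiff_prod fun j _ => Real.smoothTransition.contDiff.comp (by fun_prop)
  have hχ0 : ∀ m x, 0 ≤ χ m x := fun m x =>
    Finset.prod_nonneg fun j _ => Real.smoothTransition.nonneg _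
  have hχ1 : ∀ m x, χ m x ≤ 1 := fun m x =>
    Finset.prod_le_one (fun j _ => Real.smoothTransition.nonneg _)
      fun j _ => Real.smoothTransition.le_one _
  set G : ℕ → 𝓓(orthant n, F) := fun m => testFunctionOfSupport (fun x => χ m x • g x)
    ((hχs m).smul hgs) hgc.smul_left (c := 1 / ((m : ℝ) + 1)) (by positivity) (fun x hx j => by
      have h1 : χ m x ≠ 0 := left_ne_zero_of_smul hx
      have h2 := Finset.prod_ne_zero_iff.1 h1 j (Finset.mem_univ j)
      by_contra h3
      refine h2 (Real.smoothTransition.zero_of_nonpos ?_)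
      rw [not_le, lt_div_iff₀ (by positivity)] at h3
      linarith) with hG
  have hGe : ∀ m x, G m x = χ m x • g x := fun m x => rfl
  have hgm : MemLp g p (orthantMeasure n) := hgs.continuous.memLp_of_hasCompactSupport hgc
  have hlim := tendsto_eLpNorm_of_dominated (μ := orthantMeasure n) (p := p)
    (f := fun m => g - ⇑(G m)) (g := fun x => ‖g x‖) (by positivity) hp
    (fun m => (hgs.continuous.sub (G m).continuous).aestronglyMeasurable) hgm.norm
    (fun m => Eventually.of_forall fun x => by
      rw [Pi.sub_apply, hGe, ← one_smul ℝ (g x), smul_smul, ← sub_smul, norm_smul, mul_one, one_smul]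
      refine mul_le_of_le_one_left (norm_nonneg _) ?_
      rw [Real.norm_of_nonneg (by linarith [hχ1 m x])]
      linarith [hχ0 m x])
    (by
      filter_upwards [ae_orthant n] with x hx
      refine tendsto_const_nhds.congr' ?_
      have : ∀ᶠ m : ℕ in atTop, ∀ j, 2 ≤ ((m : ℝ) + 1) * x j := by
        rw [eventually_all]
        intro j
        have := (tendsto_natCast_atTop_atTop (R := ℝ)).eventually_ge_atTop (2 / x j)
        filter_upwards [this] with m hm
        rw [div_le_iff₀ (hx j)] at hm
        nlinarith [hx j]
      filter_upwards [this] with m hm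
      have : χ m x = 1 := Finset.prod_eq_one fun j _ =>
        Real.smoothTransition.one_of_one_le (by linarith [hm j])
      simp [hGe, this])
  obtain ⟨m, hm⟩ := (hlim.eventually_le_const
    (ENNReal.ofReal_pos.2 (half_pos hε))).exists
  refine ⟨G m, ?_⟩
  calc eLpNorm (f - ⇑(G m)) p (orthantMeasure n)
      = eLpNorm ((f - g) + (g - ⇑(G m))) p (orthantMeasure n) := by simp
    _ ≤ _ := eLpNorm_add_le (hf.1.sub hgm.1)
        (hgs.continuous.sub (G m).continuous).aestronglyMeasurable hp1
    _ ≤ _ := add_le_add hg hm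
    _ = _ := by rw [← ENNReal.ofReal_add (by positivity) (by positivity), add_halves]

lemma testFunction_memLp (φ : 𝓓(orthant n, F)) (p : ℝ≥0∞) : MemLp φ p (orthantMeasure n) :=
  φ.continuous.memLp_of_hasCompactSupport φ.hasCompactSupport

lemma testFunction_integrable (φ : 𝓓(orthant n, F)) : Integrable φ (orthantMeasure n) :=
  φ.continuous.integrable_of_hasCompactSupport φ.hasCompactSupport

lemma testFunction_bound (φ : 𝓓(orthant n, F)) : ∃ C, 0 ≤ C ∧ ∀ x, ‖φ x‖ ≤ C := by
  obtain ⟨C, hC⟩ := φ.continuous.bounded_above_of_compact_support φ.hasCompactSupport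
  exact ⟨C, (norm_nonneg _).trans (hC 0), hC⟩

lemma testFunction_support_bound (φ : 𝓓(orthant n, F)) :
    ∃ R, 0 < R ∧ ∀ x, φ x ≠ 0 → ∀ j, 0 < x j ∧ x j ≤ R := by
  obtain ⟨R, hR⟩ := φ.hasCompactSupport.isCompact.isBounded.exists_norm_le
  refine ⟨max R 1, by positivity, fun x hx j => ⟨φ.tsupport_subset (subset_tsupport _ hx) j, ?_⟩⟩
  have h1 := hR x (subset_tsupport _ hx)
  exact ((le_abs_self _).trans ((norm_le_pi_norm x j).trans h1)).trans (le_max_left _ _)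

open Filter Topology in
lemma tendsto_integral_smul_of_L2 {α : Type*} [MeasurableSpace α] {μ : Measure α}
    {a : ℕ → α → ℝ} {u : α → ℝ} {w : α → F} (ha : ∀ m, MemLp (a m) 2 μ) (hu : MemLp u 2 μ)
    (hw : MemLp w 2 μ) (h : Tendsto (fun m => eLpNorm (a m - u) 2 μ) atTop (𝓝 0)) :
    Tendsto (fun m => ∫ x, a m x • w x ∂μ) atTop (𝓝 (∫ x, u x • w x ∂μ)) := by
  refine tendsto_integral_of_L1' _ (memLp_one_iff_integrable.1 (hw.smul hu)).1
    (Eventually.of_forall fun m => memLp_one_iff_integrable.1 (hw.smul (ha m))) ?_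
  have h2 : Tendsto (fun m => eLpNorm (a m - u) 2 μ * eLpNorm w 2 μ) atTop (𝓝 0) := by
    simpa using ENNReal.Tendsto.mul_const h (Or.inr hw.eLpNorm_ne_top)
  refine tendsto_of_tendsto_of_tendsto_of_le_of_le tendsto_const_nhds h2 (fun _ => zero_le) fun m => ?_
  refine le_trans (le_of_eq ?_) (eLpNorm_smul_le_mul_eLpNorm (r := 1) hw.1 ((ha m).1.sub hu.1))
  congr 1
  funext x
  simp [sub_smul]

/-! ### The Hankel transform of test functions -/

/-- The factor `w^(1/2) J_ν(w)` of the generalized eigenfunctions, in a form which is measurable on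
the whole line. -/
noncomputable def besselFactor (ν w : ℝ) : ℝ := √w * ((w / 2) ^ ν * besselEntire ν w)

/-- The generalized eigenfunctions, written with `besselFactor`. -/
noncomputable def hankelKernel (ν y x : Fin n → ℝ) : ℝ := ∏ j, besselFactor (ν j) (x j * y j)

lemma eigenfunction_eq (ν : Fin n → ℝ) {x y : Fin n → ℝ} (hx : ∀ j, 0 < x j)
    (hy : ∀ j, 0 < y j) : eigenfunction ν y x = hankelKernel ν y x :=
  Finset.prod_congr rfl fun j _ => by rw [besselJ_eq (mul_pos (hx j) (hy j)), besselFactor]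

lemma measurable_hankelKernel {ν : Fin n → ℝ} (hν : ∀ j, -(1 / 2 : ℝ) < ν j) :
    Measurable fun p : (Fin n → ℝ) × (Fin n → ℝ) => hankelKernel ν p.1 p.2 := by
  unfold hankelKernel besselFactor
  refine Finset.measurable_prod _ fun j _ => ?_
  have := (continuous_besselEntire (hν j)).measurable
  fun_prop

lemma exists_rpow_le_exp_sq {b ε : ℝ} (hb : 0 ≤ b) (hε : 0 < ε) :
    ∃ C, 0 ≤ C ∧ ∀ w : ℝ, 0 < w → w ^ b ≤ C * Real.exp (ε * w ^ 2) := by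
  obtain ⟨N, hN⟩ := exists_nat_ge b
  refine ⟨1 + N.factorial / ε ^ N, by positivity, fun w hw => ?_⟩
  have h1 : 1 ≤ Real.exp (ε * w ^ 2) := Real.one_le_exp (by positivity)
  have h0 : (0 : ℝ) ≤ N.factorial / ε ^ N := by positivity
  rcases le_or_gt w 1 with h | h
  · have := Real.rpow_le_one hw.le h hb
    nlinarith
  · have h2 := Real.pow_div_factorial_le_exp (ε * w ^ 2) (by positivity) N
    rw [div_le_iff₀ (by positivity), mul_pow] at h2
    have h3 : w ^ b ≤ (w ^ 2) ^ N := by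
      rw [← pow_mul, ← Real.rpow_natCast]
      refine Real.rpow_le_rpow_of_exponent_le h.le ?_
      push_cast
      have := N.cast_nonneg (α := ℝ)
      linarith
    calc w ^ b ≤ (w ^ 2) ^ N := h3
      _ ≤ N.factorial / ε ^ N * Real.exp (ε * w ^ 2) := by
        rw [div_mul_eq_mul_div, le_div_iff₀ (by positivity)]; linarith
      _ ≤ _ := by nlinarith

lemma abs_besselFactor_le {ν ε : ℝ} (hν : -(1 / 2) < ν) (hε : 0 < ε) :
    ∃ C, 0 ≤ C ∧ ∀ w : ℝ, 0 < w → |besselFactor ν w| ≤ C * Real.exp (ε * w ^ 2) := by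
  obtain ⟨D, hD0, hD⟩ := exists_rpow_le_exp_sq (b := ν + 1 / 2) (by linarith) (half_pos hε)
  have hB := besselConst_pos hν (ε / 2)
  have h2 : (0 : ℝ) < 2 ^ ν := by positivity
  refine ⟨D / 2 ^ ν * besselConst ν (ε / 2), by positivity, fun w hw => ?_⟩
  have h := abs_besselEntire_le hν (half_pos hε) w
  have e1 : √w * (w / 2) ^ ν = w ^ (ν + 1 / 2) / 2 ^ ν := by
    rw [Real.sqrt_eq_rpow, Real.div_rpow hw.le (by norm_num), Real.rpow_add hw]; ring
  rw [besselFactor, ← mul_assoc, e1, abs_mul, abs_of_nonneg (by positivity)]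
  calc _ ≤ D * Real.exp (ε / 2 * w ^ 2) / 2 ^ ν * (besselConst ν (ε / 2) *
        Real.exp (ε / 2 * w ^ 2)) := by
        gcongr
        exact hD w hw
    _ = D / 2 ^ ν * besselConst ν (ε / 2) * Real.exp (ε / 2 * w ^ 2 + ε / 2 * w ^ 2) := by
        rw [Real.exp_add]; ring
    _ = _ := by ring_nf

lemma hankelKernel_bound {ν : Fin n → ℝ} (hν : ∀ j, -(1 / 2 : ℝ) < ν j) {R δ : ℝ} (hR : 0 < R)
    (hδ : 0 < δ) : ∃ C, 0 ≤ C ∧ ∀ y x : Fin n → ℝ, (∀ j, 0 < y j) → (∀ j, 0 < x j ∧ x j ≤ R) →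
      |hankelKernel ν y x| ≤ C * Real.exp (δ * ∑ j, y j ^ 2) := by
  have hε : 0 < δ / R ^ 2 := by positivity
  choose C hC0 hC using fun j => abs_besselFactor_le (hν j) hε
  refine ⟨∏ j, C j, Finset.prod_nonneg fun j _ => hC0 j, fun y x hy hx => ?_⟩
  rw [hankelKernel, Finset.abs_prod, Finset.mul_sum, Real.exp_sum, ← Finset.prod_mul_distrib]
  refine Finset.prod_le_prod (fun j _ => abs_nonneg _) fun j _ => ?_
  refine (hC j _ (mul_pos (hx j).1 (hy j))).trans ?_
  refine mul_le_mul_of_nonneg_left (Real.exp_le_exp.2 ?_) (hC0 j)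
  have h1 : x j ^ 2 ≤ R ^ 2 := by
    have := hx j
    gcongr
    · exact this.1.le
    · exact this.2
  rw [div_mul_eq_mul_div, div_le_iff₀ (by positivity), mul_pow]
  calc δ * (x j ^ 2 * y j ^ 2) ≤ δ * (R ^ 2 * y j ^ 2) := by gcongr
    _ = _ := by ring

lemma hankelKernel_mul_test_bound {ν : Fin n → ℝ} (hν : ∀ j, -(1 / 2 : ℝ) < ν j)
    (φ : 𝓓(orthant n, ℝ)) {δ : ℝ} (hδ : 0 < δ) :
    ∃ C, 0 ≤ C ∧ ∀ y x : Fin n → ℝ, (∀ j, 0 < y j) →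
      |hankelKernel ν y x * φ x| ≤ C * Real.exp (δ * ∑ j, y j ^ 2) * |φ x| := by
  obtain ⟨R, hR, hφ⟩ := testFunction_support_bound φ
  obtain ⟨C, hC0, hC⟩ := hankelKernel_bound hν hR hδ
  refine ⟨C, hC0, fun y x hy => ?_⟩
  rw [abs_mul]
  by_cases h : φ x = 0
  · simp [h]
  · gcongr
    exact hC y x hy (hφ x h)

lemma integrable_hankelKernel_mul {ν : Fin n → ℝ} (hν : ∀ j, -(1 / 2 : ℝ) < ν j)
    (φ : 𝓓(orthant n, ℝ)) {y : Fin n → ℝ} (hy : ∀ j, 0 < y j) :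
    Integrable (fun x => hankelKernel ν y x * φ x) (orthantMeasure n) := by
  obtain ⟨C, hC0, hC⟩ := hankelKernel_mul_test_bound hν φ one_pos
  refine Integrable.mono' ((testFunction_integrable φ).norm.const_mul
    (C * Real.exp (1 * ∑ j, y j ^ 2))) ?_ (Filter.Eventually.of_forall fun x => hC y x hy)
  exact (((measurable_hankelKernel hν).comp (f := fun x => (y, x)) (by fun_prop)).mul
    φ.continuous.measurable).aestronglyMeasurable

lemma hankelTest_eq (ν : Fin n → ℝ) (φ : 𝓓(orthant n, ℝ)) {y : Fin n → ℝ} (hy : ∀ j, 0 < y j) :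
    hankelTest ν φ y = ∫ x, hankelKernel ν y x * φ x ∂orthantMeasure n := by
  refine integral_congr_ae ?_
  filter_upwards [ae_orthant n] with x hx
  rw [eigenfunction_eq ν hx hy]

lemma hankelTest_sub {ν : Fin n → ℝ} (hν : ∀ j, -(1 / 2 : ℝ) < ν j) (φ ψ : 𝓓(orthant n, ℝ))
    {y : Fin n → ℝ} (hy : ∀ j, 0 < y j) :
    hankelTest ν (φ - ψ) y = hankelTest ν φ y - hankelTest ν ψ y := by
  rw [hankelTest_eq ν _ hy, hankelTest_eq ν _ hy, hankelTest_eq ν _ hy,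
    ← integral_sub (integrable_hankelKernel_mul hν φ hy) (integrable_hankelKernel_mul hν ψ hy)]
  congr 1
  funext x
  rw [← mul_sub]
  rfl

lemma aestronglyMeasurable_hankelTest {ν : Fin n → ℝ} (hν : ∀ j, -(1 / 2 : ℝ) < ν j)
    (φ : 𝓓(orthant n, ℝ)) : AEStronglyMeasurable (hankelTest ν φ) (orthantMeasure n) := by
  have h : StronglyMeasurable fun y => ∫ x, hankelKernel ν y x * φ x ∂orthantMeasure n := by
    refine StronglyMeasurable.integral_prod_right (f := fun y x => hankelKernel ν y x * φ x) ?_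
    exact ((measurable_hankelKernel hν).mul
      (φ.continuous.measurable.comp measurable_snd)).stronglyMeasurable
  refine h.aestronglyMeasurable.congr ?_
  filter_upwards [ae_orthant n] with y hy
  rw [hankelTest_eq ν φ hy]

/-- The kernel `δ_ν^k p_t(x, z)` with `p_t` the heat kernel of `Δ_ν` and `δ_ν^k` acting in `x`. -/
noncomputable def heatProd (ν : Fin n → ℝ) (k : Fin n → ℕ) (t : ℝ) (x z : Fin n → ℝ) : ℝ :=
  ∏ j, heatKernel (ν j) (k j) t (x j) (z j)

lemma measurable_heatProd (ν : Fin n → ℝ) (k : Fin n → ℕ) :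
    Measurable fun p : ℝ × (Fin n → ℝ) × (Fin n → ℝ) => heatProd ν k p.1 p.2.1 p.2.2 := by
  unfold heatProd
  refine Finset.measurable_prod _ fun j _ => (measurable_heatKernel (ν j) (k j)).comp (f :=
    fun p : ℝ × (Fin n → ℝ) × (Fin n → ℝ) => (p.1, p.2.1 j, p.2.2 j)) (by fun_prop)

lemma abs_heatProd_le {ν : Fin n → ℝ} (hν : ∀ j, -(1 / 2 : ℝ) < ν j) (k : Fin n → ℕ) :
    ∃ C, 0 ≤ C ∧ ∀ (t : ℝ) (x z : Fin n → ℝ), 0 < t → (∀ j, 0 < x j) → (∀ j, 0 < z j) →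
      |heatProd ν k t x z| ≤ C * (√t)⁻¹ ^ (∑ j, k j) * gaussProd t x z := by
  choose C hC0 hC using fun j => abs_heatKernel_le (hν j) (k j)
  refine ⟨∏ j, C j, Finset.prod_nonneg fun j _ => hC0 j, fun t x z ht hx hz => ?_⟩
  rw [heatProd, Finset.abs_prod, ← Finset.prod_pow_eq_pow_sum, gaussProd, ← Finset.prod_mul_distrib,
    ← Finset.prod_mul_distrib]
  exact Finset.prod_le_prod (fun j _ => abs_nonneg _) fun j _ => hC j t _ _ ht (hx j) (hz j)

lemma integral_gaussian_mul_hankelKernel {ν : Fin n → ℝ} (hν : ∀ j, -(1 / 2 : ℝ) < ν j) {t : ℝ}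
    (ht : 0 < t) {x z : Fin n → ℝ} (hx : ∀ j, 0 < x j) (hz : ∀ j, 0 < z j) :
    ∫ y, Real.exp (-t * ∑ j, y j ^ 2) * (hankelKernel ν y x * hankelKernel ν y z)
      ∂orthantMeasure n = heatProd ν 0 t x z := by
  have e : ∀ y : Fin n → ℝ, Real.exp (-t * ∑ j, y j ^ 2) *
      (hankelKernel ν y x * hankelKernel ν y z) = ∏ j, (Real.exp (-t * y j ^ 2) *
        (besselFactor (ν j) (x j * y j) * besselFactor (ν j) (z j * y j))) := fun y => by
    rw [Finset.prod_mul_distrib, Finset.prod_mul_distrib, Finset.mul_sum, Real.exp_sum]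
    rfl
  simp_rw [e]
  rw [integral_orthant_prod (fun j y => Real.exp (-t * y ^ 2) *
        (besselFactor (ν j) (x j * y) * besselFactor (ν j) (z j * y)))]
  refine Finset.prod_congr rfl fun j _ => ?_
  rw [Pi.zero_apply, ← integral_gaussian_mul_besselJ (hν j) ht (hx j) (hz j)]
  refine setIntegral_congr_fun measurableSet_Ioi fun y hy => ?_
  have hy : 0 < y := hy
  rw [besselJ_eq (mul_pos (hx j) hy), besselJ_eq (mul_pos (hz j) hy), besselFactor, besselFactor]

lemma integrable_gaussian_orthant {t : ℝ} (ht : 0 < t) :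
    Integrable (fun y : Fin n → ℝ => Real.exp (-t * ∑ j, y j ^ 2)) (orthantMeasure n) := by
  have e : (fun y : Fin n → ℝ => Real.exp (-t * ∑ j, y j ^ 2))
      = fun y => ∏ j, Real.exp (-t * y j ^ 2) := by
    funext y; rw [Finset.mul_sum, Real.exp_sum]
  rw [e, orthantMeasure_eq_pi]
  exact Integrable.fintype_prod (f := fun _ y => Real.exp (-t * y ^ 2)) fun j =>
    (integrable_exp_neg_mul_sq ht).restrict

lemma integrable_hankel_triple {ν : Fin n → ℝ} (hν : ∀ j, -(1 / 2 : ℝ) < ν j) {t : ℝ} (ht : 0 < t)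
    (φ ψ : 𝓓(orthant n, ℝ)) :
    Integrable (fun q : (Fin n → ℝ) × (Fin n → ℝ) × (Fin n → ℝ) =>
      Real.exp (-t * ∑ j, q.1 j ^ 2) * ((hankelKernel ν q.1 q.2.1 * φ q.2.1) *
        (hankelKernel ν q.1 q.2.2 * ψ q.2.2)))
      ((orthantMeasure n).prod ((orthantMeasure n).prod (orthantMeasure n))) := by
  obtain ⟨C, hC0, hC⟩ := hankelKernel_mul_test_bound hν φ (δ := t / 4) (by positivity)
  obtain ⟨D, hD0, hD⟩ := hankelKernel_mul_test_bound hν ψ (δ := t / 4) (by positivity)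
  have hi := ((integrable_gaussian_orthant (n := n) (half_pos ht)).const_mul (C * D)).mul_prod
    ((testFunction_integrable φ).norm.mul_prod (testFunction_integrable ψ).norm)
  refine Integrable.mono' hi (Measurable.aestronglyMeasurable ?_) ?_
  · have m1 := (measurable_hankelKernel hν).comp (f := fun q : (Fin n → ℝ) × (Fin n → ℝ) ×
      (Fin n → ℝ) => (q.1, q.2.1)) (by fun_prop)
    have m2 := (measurable_hankelKernel hν).comp (f := fun q : (Fin n → ℝ) × (Fin n → ℝ) ×
      (Fin n → ℝ) => (q.1, q.2.2)) (by fun_prop)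
    have m3 := φ.continuous.measurable
    have m4 := ψ.continuous.measurable
    simp only [Function.comp_def] at m1 m2
    fun_prop
  · have hae : ∀ᵐ q ∂((orthantMeasure n).prod ((orthantMeasure n).prod (orthantMeasure n))),
        ∀ j, 0 < q.1 j := Measure.quasiMeasurePreserving_fst.ae (ae_orthant n)
    filter_upwards [hae] with q hq
    rw [norm_mul, norm_mul, Real.norm_of_nonneg (Real.exp_pos _).le]
    set Y := ∑ j, q.1 j ^ 2
    calc _ ≤ Real.exp (-t * Y) * ((C * Real.exp (t / 4 * Y) * |φ q.2.1|) *
          (D * Real.exp (t / 4 * Y) * |ψ q.2.2|)) := by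
          gcongr
          · exact hC q.1 q.2.1 hq
          · exact hD q.1 q.2.2 hq
      _ = C * D * Real.exp (-t * Y + t / 4 * Y + t / 4 * Y) * (‖φ q.2.1‖ * ‖ψ q.2.2‖) := by
          rw [Real.exp_add, Real.exp_add, Real.norm_eq_abs, Real.norm_eq_abs]; ring
      _ = _ := by
          rw [show -t * Y + t / 4 * Y + t / 4 * Y = -(t / 2) * Y by ring]

lemma hankelTest_mul_eq_integral_prod {ν : Fin n → ℝ} {t : ℝ}
    (φ ψ : 𝓓(orthant n, ℝ)) {y : Fin n → ℝ} (hy : ∀ j, 0 < y j) :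
    Real.exp (-t * ∑ j, y j ^ 2) * (hankelTest ν φ y * hankelTest ν ψ y)
      = ∫ p : (Fin n → ℝ) × (Fin n → ℝ), Real.exp (-t * ∑ j, y j ^ 2) *
        ((hankelKernel ν y p.1 * φ p.1) * (hankelKernel ν y p.2 * ψ p.2))
          ∂((orthantMeasure n).prod (orthantMeasure n)) := by
  rw [integral_const_mul, integral_prod_mul (fun x => hankelKernel ν y x * φ x)
    (fun x => hankelKernel ν y x * ψ x), hankelTest_eq ν φ hy, hankelTest_eq ν ψ hy]

lemma integrable_gaussian_mul_hankelTest {ν : Fin n → ℝ} (hν : ∀ j, -(1 / 2 : ℝ) < ν j) {t : ℝ}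
    (ht : 0 < t) (φ ψ : 𝓓(orthant n, ℝ)) :
    Integrable (fun y => Real.exp (-t * ∑ j, y j ^ 2) * (hankelTest ν φ y * hankelTest ν ψ y))
      (orthantMeasure n) := by
  refine (integrable_hankel_triple hν ht φ ψ).integral_prod_left.congr ?_
  filter_upwards [ae_orthant n] with y hy
  exact (hankelTest_mul_eq_integral_prod φ ψ hy).symm

/-- The heat semigroup, tested against two test functions. -/
lemma integral_gaussian_mul_hankelTest {ν : Fin n → ℝ} (hν : ∀ j, -(1 / 2 : ℝ) < ν j) {t : ℝ}
    (ht : 0 < t) (φ ψ : 𝓓(orthant n, ℝ)) :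
    ∫ y, Real.exp (-t * ∑ j, y j ^ 2) * (hankelTest ν φ y * hankelTest ν ψ y) ∂orthantMeasure n
      = ∫ p : (Fin n → ℝ) × (Fin n → ℝ), heatProd ν 0 t p.1 p.2 * (φ p.1 * ψ p.2)
          ∂((orthantMeasure n).prod (orthantMeasure n)) := by
  have h1 : ∫ y, Real.exp (-t * ∑ j, y j ^ 2) * (hankelTest ν φ y * hankelTest ν ψ y)
      ∂orthantMeasure n = ∫ y, ∫ p : (Fin n → ℝ) × (Fin n → ℝ), Real.exp (-t * ∑ j, y j ^ 2) *
        ((hankelKernel ν y p.1 * φ p.1) * (hankelKernel ν y p.2 * ψ p.2))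
          ∂((orthantMeasure n).prod (orthantMeasure n)) ∂orthantMeasure n := by
    refine integral_congr_ae ?_
    filter_upwards [ae_orthant n] with y hy
    exact hankelTest_mul_eq_integral_prod φ ψ hy
  rw [h1, integral_integral_swap (integrable_hankel_triple hν ht φ ψ)]
  refine integral_congr_ae ?_
  have ha1 : ∀ᵐ p ∂((orthantMeasure n).prod (orthantMeasure n)), ∀ j, 0 < p.1 j :=
    Measure.quasiMeasurePreserving_fst.ae (ae_orthant n)
  have ha2 : ∀ᵐ p ∂((orthantMeasure n).prod (orthantMeasure n)), ∀ j, 0 < p.2 j :=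
    Measure.quasiMeasurePreserving_snd.ae (ae_orthant n)
  filter_upwards [ha1, ha2] with p h1 h2
  rw [← integral_gaussian_mul_hankelKernel hν ht h1 h2, ← integral_mul_const]
  congr 1
  funext y
  ring

lemma ENNReal_mul_le_sq_add_sq (a b : ℝ≥0∞) : a * b ≤ a ^ 2 + b ^ 2 := by
  rcases le_total a b with h | h
  · calc a * b ≤ b * b := by gcongr
      _ = b ^ 2 := (sq b).symm
      _ ≤ _ := le_add_self
  · calc a * b ≤ a * a := by gcongr
      _ = a ^ 2 := (sq a).symm
      _ ≤ _ := le_self_add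

/-- A Schur estimate: the heat kernel is dominated by a Gaussian whose integral in either variable
is bounded uniformly in `t`. -/
lemma lintegral_gaussian_hankelTest_sq_le {ν : Fin n → ℝ} (hν : ∀ j, -(1 / 2 : ℝ) < ν j) :
    ∃ K : ℝ≥0∞, K ≠ ∞ ∧ ∀ (φ : 𝓓(orthant n, ℝ)) (t : ℝ), 0 < t →
      ∫⁻ y, ENNReal.ofReal (Real.exp (-t * ∑ j, y j ^ 2)) * ‖hankelTest ν φ y‖ₑ ^ 2
        ∂orthantMeasure n ≤ K * ∫⁻ x, ‖φ x‖ₑ ^ 2 ∂orthantMeasure n := by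
  obtain ⟨C, hC0, hC⟩ := abs_heatProd_le hν 0
  simp only [Pi.zero_apply, Finset.sum_const_zero, pow_zero, mul_one] at hC
  set c := ENNReal.ofReal √(8 * Real.pi) ^ n with hc
  refine ⟨ENNReal.ofReal C * (c + c), by finiteness, fun φ t ht => ?_⟩
  set μ := orthantMeasure n with hμ
  have e : ∀ y, ENNReal.ofReal (Real.exp (-t * ∑ j, y j ^ 2)) * ‖hankelTest ν φ y‖ₑ ^ 2
      = ENNReal.ofReal (Real.exp (-t * ∑ j, y j ^ 2) * (hankelTest ν φ y * hankelTest ν φ y)) :=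
    fun y => by
      rw [ENNReal.ofReal_mul (Real.exp_pos _).le, ← abs_mul_abs_self (hankelTest ν φ y),
        ENNReal.ofReal_mul (abs_nonneg _), ← Real.enorm_eq_ofReal_abs, sq]
  simp_rw [e]
  rw [← ofReal_integral_eq_lintegral_ofReal (integrable_gaussian_mul_hankelTest hν ht φ φ)
    (Filter.Eventually.of_forall fun y => mul_nonneg (Real.exp_pos _).le (mul_self_nonneg _)),
    integral_gaussian_mul_hankelTest hν ht]
  have m3 := φ.continuous.measurable
  have mg : Measurable fun p : (Fin n → ℝ) × (Fin n → ℝ) => gaussProd t p.1 p.2 :=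
    (measurable_gaussProd n).comp (f := fun p => (t, p)) (by fun_prop)
  have ha1 : ∀ᵐ p ∂(μ.prod μ), ∀ j, 0 < p.1 j :=
    Measure.quasiMeasurePreserving_fst.ae (ae_orthant n)
  have ha2 : ∀ᵐ p ∂(μ.prod μ), ∀ j, 0 < p.2 j :=
    Measure.quasiMeasurePreserving_snd.ae (ae_orthant n)
  calc _ ≤ ∫⁻ p, ‖heatProd ν 0 t p.1 p.2 * (φ p.1 * φ p.2)‖ₑ ∂(μ.prod μ) := by
        refine le_trans ?_ (enorm_integral_le_lintegral_enorm _)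
        rw [Real.enorm_eq_ofReal_abs]
        exact ENNReal.ofReal_le_ofReal (le_abs_self _)
    _ ≤ ∫⁻ p, ENNReal.ofReal C * (ENNReal.ofReal (gaussProd t p.1 p.2) * ‖φ p.1‖ₑ ^ 2
          + ENNReal.ofReal (gaussProd t p.1 p.2) * ‖φ p.2‖ₑ ^ 2) ∂(μ.prod μ) := by
        refine lintegral_mono_ae ?_
        filter_upwards [ha1, ha2] with p h1 h2
        rw [enorm_mul, enorm_mul, Real.enorm_eq_ofReal_abs (heatProd _ _ _ _ _)]
        calc _ ≤ ENNReal.ofReal (C * gaussProd t p.1 p.2) * (‖φ p.1‖ₑ ^ 2 + ‖φ p.2‖ₑ ^ 2) := by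
              gcongr
              · exact hC t p.1 p.2 ht h1 h2
              · exact ENNReal_mul_le_sq_add_sq _ _
          _ = _ := by rw [ENNReal.ofReal_mul hC0]; ring
    _ = ENNReal.ofReal C * (∫⁻ p, ENNReal.ofReal (gaussProd t p.1 p.2) * ‖φ p.1‖ₑ ^ 2 ∂(μ.prod μ)
          + ∫⁻ p, ENNReal.ofReal (gaussProd t p.1 p.2) * ‖φ p.2‖ₑ ^ 2 ∂(μ.prod μ)) := by
        rw [lintegral_const_mul _ (by fun_prop), lintegral_add_left (by fun_prop)]
    _ ≤ ENNReal.ofReal C * (c * ∫⁻ x, ‖φ x‖ₑ ^ 2 ∂μ + c * ∫⁻ x, ‖φ x‖ₑ ^ 2 ∂μ) := by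
        gcongr
        · rw [lintegral_prod _ (by fun_prop), ← lintegral_const_mul _ (by fun_prop)]
          refine lintegral_mono fun x => ?_
          simp only
          rw [lintegral_mul_const _ (by fun_prop)]
          gcongr
          exact lintegral_gaussProd_le ht x
        · rw [lintegral_prod_symm _ (by fun_prop), ← lintegral_const_mul _ (by fun_prop)]
          refine lintegral_mono fun x => ?_
          simp only [gaussProd_comm t _ x]
          rw [lintegral_mul_const _ (by fun_prop)]
          gcongr
          exact lintegral_gaussProd_le ht x
    _ = _ := by ring

open Filter Topology in
/-- The Hankel transform is bounded in `L²` on test functions. -/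
lemma eLpNorm_hankelTest_le {ν : Fin n → ℝ} (hν : ∀ j, -(1 / 2 : ℝ) < ν j) :
    ∃ K : ℝ≥0∞, K ≠ ∞ ∧ ∀ φ : 𝓓(orthant n, ℝ), eLpNorm (hankelTest ν φ) 2 (orthantMeasure n)
      ≤ K * eLpNorm φ 2 (orthantMeasure n) := by
  obtain ⟨K, hK, hKb⟩ := lintegral_gaussian_hankelTest_sq_le hν
  refine ⟨K ^ (1 / 2 : ℝ), by finiteness, fun φ => ?_⟩
  have hm := aestronglyMeasurable_hankelTest hν φ
  have h : ∫⁻ y, ‖hankelTest ν φ y‖ₑ ^ 2 ∂orthantMeasure n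
      ≤ K * ∫⁻ x, ‖φ x‖ₑ ^ 2 ∂orthantMeasure n := by
    -- Monotone convergence as `t = 1 / (m + 1)` tends to zero.
    refine le_of_tendsto (lintegral_tendsto_of_tendsto_of_monotone (f := fun (m : ℕ) y =>
      ENNReal.ofReal (Real.exp (-(1 / ((m : ℝ) + 1)) * ∑ j, y j ^ 2)) * ‖hankelTest ν φ y‖ₑ ^ 2)
      (fun m => AEMeasurable.mul (Measurable.aemeasurable (by fun_prop)) (hm.enorm.pow_const 2)) ?_ ?_)
      (Eventually.of_forall fun m => hKb φ _ (by positivity))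
    · refine Eventually.of_forall fun y m m' hmm => ?_
      have h0 : 0 ≤ ∑ j, y j ^ 2 := Finset.sum_nonneg fun j _ => sq_nonneg _
      have h1 : 1 / ((m' : ℝ) + 1) ≤ 1 / ((m : ℝ) + 1) := by gcongr
      simp only
      gcongr
    · refine Eventually.of_forall fun y => ?_
      have h1 : Tendsto (fun m : ℕ => Real.exp (-(1 / ((m : ℝ) + 1)) * ∑ j, y j ^ 2)) atTop
          (𝓝 1) := by
        have := (((tendsto_one_div_add_atTop_nhds_zero_nat (𝕜 := ℝ)).neg.mul_const
          (∑ j, y j ^ 2)).rexp)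
        simpa using this
      have h2 := ENNReal.tendsto_ofReal h1
      have h3 := ENNReal.Tendsto.mul_const (b := ‖hankelTest ν φ y‖ₑ ^ 2) h2 (Or.inl (by simp))
      simpa using h3
  rw [eLpNorm_eq_lintegral_rpow_enorm_toReal two_ne_zero ENNReal.ofNat_ne_top,
    eLpNorm_eq_lintegral_rpow_enorm_toReal two_ne_zero ENNReal.ofNat_ne_top]
  simp only [ENNReal.toReal_ofNat, ENNReal.rpow_ofNat]
  rw [← ENNReal.mul_rpow_of_nonneg _ _ (by norm_num)]
  gcongr

lemma hankelTest_memLp {ν : Fin n → ℝ} (hν : ∀ j, -(1 / 2 : ℝ) < ν j) (φ : 𝓓(orthant n, ℝ)) :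
    MemLp (hankelTest ν φ) 2 (orthantMeasure n) := by
  obtain ⟨K, hK, hKb⟩ := eLpNorm_hankelTest_le hν
  have := (testFunction_memLp φ 2).eLpNorm_ne_top
  exact ⟨aestronglyMeasurable_hankelTest hν φ, (hKb φ).trans_lt (by finiteness)⟩

/-- The Hankel transform is symmetric. -/
lemma integral_mul_hankelTest_comm {ν : Fin n → ℝ} (hν : ∀ j, -(1 / 2 : ℝ) < ν j)
    (φ ψ : 𝓓(orthant n, ℝ)) :
    ∫ y, φ y * hankelTest ν ψ y ∂orthantMeasure n
      = ∫ x, hankelTest ν φ x * ψ x ∂orthantMeasure n := by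
  obtain ⟨R, hR, hφ⟩ := testFunction_support_bound φ
  obtain ⟨C, hC0, hC⟩ := hankelKernel_mul_test_bound hν ψ one_pos
  have hint : Integrable (Function.uncurry fun y x : Fin n → ℝ => φ y * (hankelKernel ν y x * ψ x))
      ((orthantMeasure n).prod (orthantMeasure n)) := by
    refine Integrable.mono' (((testFunction_integrable φ).norm.const_mul
      (C * Real.exp (1 * (n * R ^ 2)))).mul_prod (testFunction_integrable ψ).norm) ?_ ?_
    · have m1 := measurable_hankelKernel hν
      have m3 := φ.continuous.measurable
      have m4 := ψ.continuous.measurable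
      refine Measurable.aestronglyMeasurable ?_
      exact (m3.comp measurable_fst).mul (m1.mul (m4.comp measurable_snd))
    · refine Filter.Eventually.of_forall fun p => ?_
      simp only [Function.uncurry]
      rw [norm_mul]
      by_cases h : φ p.1 = 0
      · simp [h]
      · have hp := hφ p.1 h
        have h2 : ∑ j, p.1 j ^ 2 ≤ n * R ^ 2 := by
          calc _ ≤ ∑ _j : Fin n, R ^ 2 := Finset.sum_le_sum fun j _ => by
                have := hp j
                have := this.1.le
                gcongr
                exact (hp j).2
            _ = _ := by simp
        calc _ ≤ ‖φ p.1‖ * (C * Real.exp (1 * ∑ j, p.1 j ^ 2) * |ψ p.2|) := by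
              gcongr
              exact hC p.1 p.2 fun j => (hp j).1
          _ ≤ ‖φ p.1‖ * (C * Real.exp (1 * (n * R ^ 2)) * |ψ p.2|) := by gcongr
          _ = _ := by rw [Real.norm_eq_abs (ψ p.2)]; ring
  have h := integral_integral_swap hint
  have e1 : ∫ y, φ y * hankelTest ν ψ y ∂orthantMeasure n
      = ∫ y, ∫ x, φ y * (hankelKernel ν y x * ψ x) ∂orthantMeasure n ∂orthantMeasure n := by
    refine integral_congr_ae ?_
    filter_upwards [ae_orthant n] with y hy
    rw [integral_const_mul, hankelTest_eq ν ψ hy]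
  rw [e1, h]
  refine integral_congr_ae ?_
  filter_upwards [ae_orthant n] with x hx
  rw [hankelTest_eq ν φ hx, ← integral_mul_const]
  congr 1
  funext y
  have : hankelKernel ν y x = hankelKernel ν x y :=
    Finset.prod_congr rfl fun j _ => by rw [mul_comm]
  rw [this]; ring

open Filter Topology in
/-- The `L²` extension of the Hankel transform, by approximation with test functions. -/
lemma exists_hankel_approx {ν : Fin n → ℝ} (hν : ∀ j, -(1 / 2 : ℝ) < ν j) {u : (Fin n → ℝ) → ℝ}
    (hu : MemLp u 2 (orthantMeasure n)) :
    ∃ (φ : ℕ → 𝓓(orthant n, ℝ)) (g : (Fin n → ℝ) → ℝ), MemLp g 2 (orthantMeasure n) ∧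
      Tendsto (fun m => eLpNorm (⇑(φ m) - u) 2 (orthantMeasure n)) atTop (𝓝 0) ∧
      Tendsto (fun m => eLpNorm (hankelTest ν (φ m) - g) 2 (orthantMeasure n)) atTop (𝓝 0) := by
  obtain ⟨K, hK, hKb⟩ := eLpNorm_hankelTest_le hν
  have hex : ∀ m : ℕ, ∃ φ : 𝓓(orthant n, ℝ), eLpNorm (u - ⇑φ) 2 (orthantMeasure n)
      ≤ ENNReal.ofReal (1 / ((m : ℝ) + 1)) := fun m =>
    exists_testFunction_eLpNorm_sub_le ENNReal.ofNat_ne_top one_le_two hu (by positivity)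
  choose φ hφ using hex
  have hlim : Tendsto (fun m => eLpNorm (⇑(φ m) - u) 2 (orthantMeasure n)) atTop (𝓝 0) := by
    have h0 : Tendsto (fun m : ℕ => ENNReal.ofReal (1 / ((m : ℝ) + 1))) atTop (𝓝 0) := by
      simpa using ENNReal.tendsto_ofReal (tendsto_one_div_add_atTop_nhds_zero_nat (𝕜 := ℝ))
    refine tendsto_of_tendsto_of_tendsto_of_le_of_le tendsto_const_nhds h0 (fun _ => zero_le)
      fun m => ?_
    rw [eLpNorm_sub_comm]
    exact hφ m
  set μ := orthantMeasure n
  have hmem := fun m => testFunction_memLp (φ m) 2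
  have hHmem := fun m => hankelTest_memLp hν (φ m)
  have hc1 : CauchySeq fun m => (hmem m).toLp := by
    have : Tendsto (fun m => (hmem m).toLp) atTop (𝓝 hu.toLp) := by
      rw [Lp.tendsto_Lp_iff_tendsto_eLpNorm'']
      exact hlim
    exact this.cauchySeq
  have hd : ∀ m m', edist (hHmem m).toLp (hHmem m').toLp
      ≤ K * edist (hmem m).toLp (hmem m').toLp := fun m m' => by
    rw [Lp.edist_toLp_toLp, Lp.edist_toLp_toLp]
    refine le_trans (le_of_eq (eLpNorm_congr_ae ?_)) ((hKb (φ m - φ m')).trans (le_of_eq rfl))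
    filter_upwards [ae_orthant n] with y hy
    rw [hankelTest_sub hν _ _ hy]
    rfl
  have hc2 : CauchySeq fun m => (hHmem m).toLp := by
    rw [EMetric.cauchySeq_iff] at hc1 ⊢
    intro ε hε
    obtain ⟨N, hN⟩ := hc1 (ε / (K + 1)) (ENNReal.div_pos hε.ne' (by finiteness))
    refine ⟨N, fun m hm m' hm' => ?_⟩
    have h1 := hN m hm m' hm'
    rcases eq_or_ne ε ∞ with rfl | hε'
    · exact edist_lt_top _ _
    calc _ ≤ K * edist (hmem m).toLp (hmem m').toLp := hd m m'
      _ ≤ (K + 1) * edist (hmem m).toLp (hmem m').toLp := by gcongr; exact le_self_add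
      _ < (K + 1) * (ε / (K + 1)) := by
          refine (ENNReal.mul_lt_mul_iff_right (by simp) (by finiteness)).2 h1
      _ = ε := ENNReal.mul_div_cancel (by simp) (by finiteness)
  obtain ⟨g, hg⟩ := cauchySeq_tendsto_of_complete hc2
  refine ⟨φ, g, Lp.memLp g, hlim, ?_⟩
  rw [Lp.tendsto_Lp_iff_tendsto_eLpNorm'] at hg
  refine hg.congr fun m => eLpNorm_congr_ae ?_
  filter_upwards [(hHmem m).coeFn_toLp] with x hx
  simp [hx]

/-! ### The derivatives on test functions -/

lemma testFunction_eventually_zero (φ : 𝓓(orthant n, ℝ)) {x : Fin n → ℝ}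
    (hx : x ∉ (orthant n : Set (Fin n → ℝ))) : φ =ᶠ[nhds x] 0 :=
  notMem_tsupport_iff_eventuallyEq.1 fun h => hx (φ.tsupport_subset h)

/-- The adjoint derivative `δ_a^*` as an operator on test functions. -/
noncomputable def deltaAdjTest (a : ℝ) (j : Fin n) (φ : 𝓓(orthant n, ℝ)) : 𝓓(orthant n, ℝ) :=
  have hs : Function.support (deltaAdj a j φ) ⊆ tsupport φ := fun x hx => by
    by_contra h
    have h0 := notMem_tsupport_iff_eventuallyEq.1 h
    refine hx ?_
    rw [deltaAdj, h0.fderiv_eq, h0.eq_of_nhds]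
    simp
  { toFun := deltaAdj a j φ
    contDiff' := by
      rw [contDiff_iff_contDiffAt]
      intro x
      have h1 : ContDiffAt ℝ (⊤ : ℕ∞) (fun x => -fderiv ℝ φ x (Pi.single j 1)) x :=
        ((φ.contDiff.fderiv_right (m := (⊤ : ℕ∞)) (by simp)).clm_apply
          contDiff_const).neg.contDiffAt
      refine h1.sub ?_
      by_cases hx : x ∈ (orthant n : Set (Fin n → ℝ))
      · exact (contDiffAt_const.div (contDiff_apply ℝ ℝ j).contDiffAt (hx j).ne').mul
          φ.contDiff.contDiffAt
      · refine (contDiffAt_const (c := (0 : ℝ))).congr_of_eventuallyEq ?_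
        filter_upwards [testFunction_eventually_zero φ hx] with y hy
        simp [hy]
    hasCompactSupport' := φ.hasCompactSupport.mono' hs
    tsupport_subset' := (closure_minimal hs (isClosed_tsupport _)).trans φ.tsupport_subset }

@[simp] lemma coe_deltaAdjTest (a : ℝ) (j : Fin n) (φ : 𝓓(orthant n, ℝ)) :
    ⇑(deltaAdjTest a j φ) = deltaAdj a j φ := rfl

lemma continuous_mul_testFunction {u : (Fin n → ℝ) → ℝ} (hu : ContinuousOn u (orthant n))
    (φ : 𝓓(orthant n, ℝ)) : Continuous fun x => u x * φ x := by
  rw [continuous_iff_continuousAt]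
  intro x
  by_cases hx : x ∈ (orthant n : Set (Fin n → ℝ))
  · exact (hu.continuousAt ((orthant n).isOpen.mem_nhds hx)).mul φ.continuous.continuousAt
  · refine (continuousAt_const (y := (0 : ℝ))).congr ?_
    filter_upwards [testFunction_eventually_zero φ hx] with y hy
    simp [hy]

lemma integrable_mul_testFunction {u : (Fin n → ℝ) → ℝ} (hu : ContinuousOn u (orthant n))
    (φ : 𝓓(orthant n, ℝ)) : Integrable fun x => u x * φ x :=
  (continuous_mul_testFunction hu φ).integrable_of_hasCompactSupport φ.hasCompactSupport.mul_left

lemma integral_orthant_mul_testFunction (u : (Fin n → ℝ) → ℝ) (φ : 𝓓(orthant n, ℝ)) :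
    ∫ x, u x * φ x ∂orthantMeasure n = ∫ x, u x * φ x := by
  refine setIntegral_eq_integral_of_forall_compl_eq_zero fun x hx => ?_
  rw [(testFunction_eventually_zero φ hx).eq_of_nhds]
  simp

/-- Integration by parts on the orthant. -/
lemma integral_mul_deltaAdj (a : ℝ) (j : Fin n) (φ : 𝓓(orthant n, ℝ))
    {u u' : (Fin n → ℝ) → ℝ} (hu : ContinuousOn u (orthant n)) (hu' : ContinuousOn u' (orthant n))
    (hd : ∀ x : Fin n → ℝ, (∀ i, 0 < x i) →
      HasLineDerivAt ℝ u (u' x + (a + 1 / 2) / x j * u x) x (Pi.single j 1)) :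
    ∫ x, u x * deltaAdjTest a j φ x ∂orthantMeasure n = ∫ x, u' x * φ x ∂orthantMeasure n := by
  rw [integral_orthant_mul_testFunction, integral_orthant_mul_testFunction]
  have hinv : ContinuousOn (fun x : Fin n → ℝ => (a + 1 / 2) / x j * u x) (orthant n) :=
    (continuousOn_const.div (continuous_apply j).continuousOn fun x hx => (hx j).ne').mul hu
  have i1 := integrable_mul_testFunction hu' φ
  have i2 := integrable_mul_testFunction hinv φ
  have i3 := integrable_mul_testFunction hu (deltaAdjTest a j φ)
  have e : ∀ x, u x * deltaAdjTest a j φ x = -(u x * fderiv ℝ φ x (Pi.single j 1))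
      - (a + 1 / 2) / x j * u x * φ x := fun x => by
    rw [coe_deltaAdjTest, deltaAdj]; ring
  have i4 : Integrable fun x => u x * fderiv ℝ φ x (Pi.single j 1) := by
    refine (i3.add i2).neg.congr (Filter.Eventually.of_forall fun x => ?_)
    simp only [Pi.neg_apply, Pi.add_apply, e]
    ring
  have key := integral_bilinear_hasLineDerivAt_right_eq_neg_left_of_integrable
    (μ := (volume : Measure (Fin n → ℝ))) (f := u) (f' := fun x => u' x + (a + 1 / 2) / x j * u x)
    (g := φ) (g' := fun x => fderiv ℝ φ x (Pi.single j 1)) (v := Pi.single j 1)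
    (B := ContinuousLinearMap.mul ℝ ℝ)
    (by
      refine (i1.add i2).congr (Filter.Eventually.of_forall fun x => ?_)
      simp only [Pi.add_apply, ContinuousLinearMap.mul_apply']
      ring)
    (by simpa using i4) (by simpa using integrable_mul_testFunction hu φ)
    (fun x hx => hd x (φ.tsupport_subset hx))
    (fun x _ => ((φ.contDiff.differentiable (by simp)) x).hasFDerivAt.hasLineDerivAt _)
  simp only [ContinuousLinearMap.mul_apply'] at key
  have i4' : Integrable fun x => -(u x * fderiv ℝ φ x (Pi.single j 1)) := i4.neg
  simp_rw [e]
  rw [integral_sub i4' i2, integral_neg, key, neg_neg, ← integral_sub _ i2]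
  · congr 1
    funext x
    ring
  · refine (i1.add i2).congr (Filter.Eventually.of_forall fun x => ?_)
    simp only [Pi.add_apply]
    ring

lemma continuousOn_heatProd {ν : Fin n → ℝ} (hν : ∀ j, -(1 / 2 : ℝ) < ν j) (k : Fin n → ℕ) {t : ℝ}
    (ht : 0 < t) {z : Fin n → ℝ} (hz : ∀ j, 0 < z j) :
    ContinuousOn (fun x => heatProd ν k t x z) (orthant n) := by
  unfold heatProd
  refine continuousOn_finsetProd _ fun j _ x hx => ContinuousAt.continuousWithinAt ?_
  exact ContinuousAt.comp (f := fun x : Fin n → ℝ => x j)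
    (hasDerivAt_heatKernel (hν j) (k j) ht (hx j) (hz j)).continuousAt
    (continuous_apply j).continuousAt

lemma hasLineDerivAt_heatProd {ν : Fin n → ℝ} (hν : ∀ j, -(1 / 2 : ℝ) < ν j) (k : Fin n → ℕ)
    {t : ℝ} (ht : 0 < t) {x z : Fin n → ℝ} (hx : ∀ j, 0 < x j) (hz : ∀ j, 0 < z j) (j : Fin n) :
    HasLineDerivAt ℝ (fun x => heatProd ν k t x z)
      (heatProd ν (k + Pi.single j 1) t x z + (ν j + 1 / 2) / x j * heatProd ν k t x z) x
      (Pi.single j 1) := by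
  have e : ∀ s : ℝ, heatProd ν k t (x + s • Pi.single j 1) z
      = heatKernel (ν j) (k j) t (x j + s) (z j) *
        ∏ i ∈ Finset.univ.erase j, heatKernel (ν i) (k i) t (x i) (z i) := fun s => by
    rw [heatProd, ← Finset.mul_prod_erase _ _ (Finset.mem_univ j)]
    congr 1
    · simp
    · refine Finset.prod_congr rfl fun i hi => ?_
      simp [Pi.single_eq_of_ne (Finset.ne_of_mem_erase hi)]
  have e1 : heatProd ν (k + Pi.single j 1) t x z = heatKernel (ν j) (k j + 1) t (x j) (z j) *
      ∏ i ∈ Finset.univ.erase j, heatKernel (ν i) (k i) t (x i) (z i) := by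
    rw [heatProd, ← Finset.mul_prod_erase _ _ (Finset.mem_univ j)]
    congr 1
    · simp
    · refine Finset.prod_congr rfl fun i hi => ?_
      simp [Pi.single_eq_of_ne (Finset.ne_of_mem_erase hi)]
  have e2 := e 0
  rw [zero_smul, add_zero, add_zero] at e2
  have d0 := hasDerivAt_heatKernel (hν j) (k j) ht (hx j) (hz j)
  rw [← add_zero (x j)] at d0
  have d := (HasDerivAt.comp_const_add (x j) 0 d0).mul_const
      (∏ i ∈ Finset.univ.erase j, heatKernel (ν i) (k i) t (x i) (z i))
  rw [HasLineDerivAt]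
  simp_rw [e]
  refine d.congr_deriv ?_
  rw [e1, e2, add_zero]
  ring

lemma integral_heatProd_mul_deltaAdj_iterate {ν : Fin n → ℝ} (hν : ∀ j, -(1 / 2 : ℝ) < ν j) {t : ℝ}
    (ht : 0 < t) {z : Fin n → ℝ} (hz : ∀ j, 0 < z j) (j : Fin n) (φ : 𝓓(orthant n, ℝ)) (r : ℕ) :
    ∀ m : Fin n → ℕ, ∫ x, heatProd ν m t x z * ((deltaAdjTest (ν j) j)^[r] φ) x ∂orthantMeasure n
      = ∫ x, heatProd ν (m + Pi.single j r) t x z * φ x ∂orthantMeasure n := by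
  induction r with
  | zero => intro m; simp
  | succ r ih =>
    intro m
    have h := fun ψ => integral_mul_deltaAdj (ν j) j ψ (u := fun x => heatProd ν m t x z)
      (u' := fun x => heatProd ν (m + Pi.single j 1) t x z)
      (continuousOn_heatProd hν m ht hz) (continuousOn_heatProd hν (m + Pi.single j 1) ht hz)
      fun x hx => hasLineDerivAt_heatProd hν m ht hx hz j
    have e : m + Pi.single j 1 + Pi.single j r = m + Pi.single j (r + 1) := by
      rw [add_assoc, ← Pi.single_add, add_comm 1 r]
    have e' : (deltaAdjTest (ν j) j)^[r + 1] φ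
      = deltaAdjTest (ν j) j ((deltaAdjTest (ν j) j)^[r] φ) := Function.iterate_succ_apply' _ _ _
    rw [e', ← e, ← ih]
    exact h _

/-- The test function `(δ_ν^k)^* φ`. -/
noncomputable def deltaAdjPowTest (ν : Fin n → ℝ) (k : Fin n → ℕ) (φ : 𝓓(orthant n, ℝ)) :
    𝓓(orthant n, ℝ) :=
  (List.finRange n).foldr (fun j ψ => (deltaAdjTest (ν j) j)^[k j] ψ) φ

lemma coe_deltaAdjPowTest (ν : Fin n → ℝ) (k : Fin n → ℕ) (φ : 𝓓(orthant n, ℝ)) :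
    ⇑(deltaAdjPowTest ν k φ) = deltaAdjPow ν k φ := by
  rw [deltaAdjPowTest, deltaAdjPow]
  have h1 : ∀ (j : Fin n) (r : ℕ) (ψ : 𝓓(orthant n, ℝ)),
      ⇑((deltaAdjTest (ν j) j)^[r] ψ) = (deltaAdj (ν j) j)^[r] ψ := fun j r ψ => by
    induction r with
    | zero => rfl
    | succ r ih => rw [Function.iterate_succ_apply', Function.iterate_succ_apply', coe_deltaAdjTest, ih]
  induction List.finRange n with
  | nil => rfl
  | cons j l ih => rw [List.foldr_cons, List.foldr_cons, h1, ih]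

/-- The derivatives `δ_ν^k` can be moved from the test function to the heat kernel. -/
lemma integral_heatProd_mul_deltaAdjPow {ν : Fin n → ℝ} (hν : ∀ j, -(1 / 2 : ℝ) < ν j)
    (k : Fin n → ℕ) {t : ℝ} (ht : 0 < t) {z : Fin n → ℝ} (hz : ∀ j, 0 < z j)
    (φ : 𝓓(orthant n, ℝ)) :
    ∫ x, heatProd ν 0 t x z * deltaAdjPowTest ν k φ x ∂orthantMeasure n
      = ∫ x, heatProd ν k t x z * φ x ∂orthantMeasure n := by
  have key : ∀ (l : List (Fin n)) (m : Fin n → ℕ), ∫ x, heatProd ν m t x z *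
      (l.foldr (fun j ψ => (deltaAdjTest (ν j) j)^[k j] ψ) φ) x ∂orthantMeasure n
      = ∫ x, heatProd ν (m + (l.map fun j => Pi.single j (k j)).sum) t x z * φ x
        ∂orthantMeasure n := by
    intro l
    induction l with
    | nil => intro m; simp
    | cons j l ih =>
      intro m
      rw [List.foldr_cons, integral_heatProd_mul_deltaAdj_iterate hν ht hz, ih, List.map_cons,
        List.sum_cons, add_assoc]
  rw [deltaAdjPowTest, key, ← Fin.sum_univ_def, Finset.univ_sum_single, zero_add]

/-! ### The heat semigroup on `L²` -/

lemma lintegral_gaussProd_mul_le {t : ℝ} (ht : 0 < t) {g : (Fin n → ℝ) → ℝ≥0∞} (hg : Measurable g) :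
    ∫⁻ p, ENNReal.ofReal (gaussProd t p.1 p.2) * g p.1
      ∂((orthantMeasure n).prod (orthantMeasure n))
      ≤ ENNReal.ofReal √(8 * Real.pi) ^ n * ∫⁻ x, g x ∂orthantMeasure n := by
  have mg : Measurable fun p : (Fin n → ℝ) × (Fin n → ℝ) => gaussProd t p.1 p.2 :=
    (measurable_gaussProd n).comp (f := fun p => (t, p)) (by fun_prop)
  rw [lintegral_prod _ (by fun_prop), ← lintegral_const_mul _ hg]
  refine lintegral_mono fun x => ?_
  simp only
  rw [lintegral_mul_const _ (by fun_prop)]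
  gcongr
  exact lintegral_gaussProd_le ht x

lemma integrable_heatProd_mul {ν : Fin n → ℝ} (hν : ∀ j, -(1 / 2 : ℝ) < ν j)
    (k : Fin n → ℕ) {t : ℝ} (ht : 0 < t) (φ : 𝓓(orthant n, ℝ)) :
    Integrable (fun p : (Fin n → ℝ) × (Fin n → ℝ) => heatProd ν k t p.1 p.2 * φ p.1)
      ((orthantMeasure n).prod (orthantMeasure n)) := by
  obtain ⟨C, hC0, hC⟩ := abs_heatProd_le hν k
  have mh : Measurable fun p : (Fin n → ℝ) × (Fin n → ℝ) => heatProd ν k t p.1 p.2 :=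
    (measurable_heatProd ν k).comp (f := fun p => (t, p)) (by fun_prop)
  have mφ := φ.continuous.measurable
  have hst : 0 ≤ (√t)⁻¹ ^ (∑ j, k j) := by positivity
  refine ⟨Measurable.aestronglyMeasurable (by fun_prop), ?_⟩
  have ha1 : ∀ᵐ p ∂((orthantMeasure n).prod (orthantMeasure n)), ∀ j, 0 < p.1 j :=
    Measure.quasiMeasurePreserving_fst.ae (ae_orthant n)
  have ha2 : ∀ᵐ p ∂((orthantMeasure n).prod (orthantMeasure n)), ∀ j, 0 < p.2 j :=
    Measure.quasiMeasurePreserving_snd.ae (ae_orthant n)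
  have mg : Measurable fun p : (Fin n → ℝ) × (Fin n → ℝ) => gaussProd t p.1 p.2 :=
    (measurable_gaussProd n).comp (f := fun p => (t, p)) (by fun_prop)
  calc _ ≤ ∫⁻ p, ENNReal.ofReal (C * (√t)⁻¹ ^ (∑ j, k j)) *
        (ENNReal.ofReal (gaussProd t p.1 p.2) * ‖φ p.1‖ₑ)
          ∂((orthantMeasure n).prod (orthantMeasure n)) := by
        refine lintegral_mono_ae ?_
        filter_upwards [ha1, ha2] with p h1 h2
        rw [enorm_mul, Real.enorm_eq_ofReal_abs, ← mul_assoc, ← ENNReal.ofReal_mul (by positivity)]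
        gcongr
        exact hC t _ _ ht h1 h2
    _ ≤ ENNReal.ofReal (C * (√t)⁻¹ ^ (∑ j, k j)) * (ENNReal.ofReal √(8 * Real.pi) ^ n *
        ∫⁻ x, ‖φ x‖ₑ ∂orthantMeasure n) := by
        rw [lintegral_const_mul _ (by fun_prop)]
        gcongr
        exact lintegral_gaussProd_mul_le ht (by fun_prop)
    _ < ∞ := by
        have := (testFunction_integrable φ).2
        rw [HasFiniteIntegral] at this
        have := this.ne
        finiteness

lemma ae_eq_of_integral_testFunction {g P : (Fin n → ℝ) → ℝ}
    (hg : LocallyIntegrable g (orthantMeasure n)) (hP : LocallyIntegrable P (orthantMeasure n))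
    (h : ∀ χ : 𝓓(orthant n, ℝ), ∫ x, χ x * g x ∂orthantMeasure n
      = ∫ x, χ x * P x ∂orthantMeasure n) : g =ᵐ[orthantMeasure n] P := by
  have h0 := (orthant n).isOpen.ae_eq_zero_of_integral_contDiff_smul_eq_zero
    (f := fun x => g x - P x) (μ := orthantMeasure n)
    ((hg.sub hP).locallyIntegrableOn _) fun χ hχ hc hs => by
      have hi : ∀ f : (Fin n → ℝ) → ℝ, LocallyIntegrable f (orthantMeasure n) →
          Integrable (fun x => χ x * f x) (orthantMeasure n) := fun f hf =>
        hf.integrable_smul_left_of_hasCompactSupport hχ.continuous hc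
      simp only [smul_eq_mul, mul_sub]
      rw [integral_sub (hi g hg) (hi P hP), sub_eq_zero]
      exact h ⟨χ, hχ, hc, hs⟩
  filter_upwards [h0, ae_orthant n] with x hx hx'
  exact sub_eq_zero.1 (hx hx')

open Filter Topology in
/-- If `h` is the Hankel transform of `f`, then `e^(-t|y|²) h` corresponds to the heat kernel
integral of `f`; this is where the self-adjointness and the self-inverse property of the Hankel
transform enter. -/
lemma integral_gaussian_hankelTest_smul {ν : Fin n → ℝ} (hν : ∀ j, -(1 / 2 : ℝ) < ν j) {t : ℝ}
    (ht : 0 < t) {f h : (Fin n → ℝ) → ℂ} (hfh : IsHankelTransform ν f h) (ψ : 𝓓(orthant n, ℝ)) :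
    ∫ y, (Real.exp (-t * ∑ j, y j ^ 2) * hankelTest ν ψ y) • h y ∂orthantMeasure n
      = ∫ z, (∫ x, heatProd ν 0 t x z * ψ x ∂orthantMeasure n) • f z ∂orthantMeasure n := by
  obtain ⟨hf, hh, hpair⟩ := hfh
  set μ := orthantMeasure n with hμ
  set u : (Fin n → ℝ) → ℝ := fun y => Real.exp (-t * ∑ j, y j ^ 2) * hankelTest ν ψ y with hu
  set P : (Fin n → ℝ) → ℝ := fun z => ∫ x, heatProd ν 0 t x z * ψ x ∂μ with hP
  have hum : MemLp u 2 μ := by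
    refine (hankelTest_memLp hν ψ).mono
      (AEStronglyMeasurable.mul (Continuous.aestronglyMeasurable (by fun_prop))
        (aestronglyMeasurable_hankelTest hν ψ)) (Eventually.of_forall fun y => ?_)
    rw [hu, norm_mul, Real.norm_of_nonneg (Real.exp_pos _).le]
    refine mul_le_of_le_one_left (norm_nonneg _) (Real.exp_le_one_iff.2 ?_)
    have : 0 ≤ ∑ j, y j ^ 2 := Finset.sum_nonneg fun j _ => sq_nonneg _
    nlinarith
  obtain ⟨φ, g, hg, hφ, hHφ⟩ := exists_hankel_approx hν hum
  have hgP : g =ᵐ[μ] P := by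
    refine ae_eq_of_integral_testFunction (hg.locallyIntegrable one_le_two)
      (integrable_heatProd_mul hν 0 ht ψ).integral_prod_right.locallyIntegrable fun χ => ?_
    have l1 := tendsto_integral_smul_of_L2 (fun m => hankelTest_memLp hν (φ m)) hg
      (testFunction_memLp χ 2) hHφ
    have l2 := tendsto_integral_smul_of_L2 (fun m => testFunction_memLp (φ m) 2) hum
      (hankelTest_memLp hν χ) hφ
    simp only [smul_eq_mul] at l1 l2
    have e1 := fun m => integral_mul_hankelTest_comm hν (φ m) χ
    simp_rw [e1] at l2
    have e2 := tendsto_nhds_unique l1 l2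
    have e3 : ∫ y, u y * hankelTest ν χ y ∂μ
        = ∫ y, Real.exp (-t * ∑ j, y j ^ 2) * (hankelTest ν ψ y * hankelTest ν χ y) ∂μ := by
      congr 1; funext y; rw [hu]; ring
    rw [e3, integral_gaussian_mul_hankelTest hν ht] at e2
    obtain ⟨C, hC0, hC⟩ := testFunction_bound χ
    have hint : Integrable (fun p : (Fin n → ℝ) × (Fin n → ℝ) =>
        heatProd ν 0 t p.1 p.2 * (ψ p.1 * χ p.2)) (μ.prod μ) := by
      simp_rw [← mul_assoc]
      exact (integrable_heatProd_mul hν 0 ht ψ).mul_bdd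
        (χ.continuous.comp continuous_snd).aestronglyMeasurable
        (Eventually.of_forall fun p => hC p.2)
    rw [integral_prod_symm _ hint] at e2
    calc ∫ x, χ x * g x ∂μ = ∫ x, g x * χ x ∂μ := by simp_rw [mul_comm]
      _ = _ := e2
      _ = ∫ x, χ x * P x ∂μ := by
        congr 1; funext z
        rw [← integral_const_mul]
        congr 1; funext x; ring
  have l1 : Tendsto (fun m => ∫ y, φ m y • h y ∂μ) atTop (𝓝 (∫ y, u y • h y ∂μ)) :=
    tendsto_integral_smul_of_L2 (fun m => testFunction_memLp (φ m) 2) hum hh hφ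
  have l2 := tendsto_integral_smul_of_L2 (fun m => hankelTest_memLp hν (φ m)) hg hf hHφ
  rw [show (fun m => ∫ y, φ m y • h y ∂μ) = fun m => ∫ x, hankelTest ν (φ m) x • f x ∂μ from
    funext fun m => hpair (φ m)] at l1
  rw [tendsto_nhds_unique l1 l2]
  refine integral_congr_ae ?_
  filter_upwards [hgP] with z hz
  rw [hz]

/-! ### The Schur test -/

/-- The Schur test for a non-negative kernel and a weight `w`. -/
lemma lintegral_schur {X : Type*} [MeasurableSpace X] {μ : Measure X} [SFinite μ]
    {M : X → X → ℝ≥0∞} (hM : Measurable (Function.uncurry M)) {w : X → ℝ≥0∞} (hw : Measurable w)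
    (hw0 : ∀ᵐ x ∂μ, w x ≠ 0) (hwt : ∀ᵐ x ∂μ, w x ≠ ∞) {p q : ℝ} (hpq : p.HolderConjugate q)
    {C : ℝ≥0∞} (h1 : ∀ᵐ x ∂μ, ∫⁻ z, M x z * w z ^ q ∂μ ≤ C * w x ^ q)
    (h2 : ∀ᵐ z ∂μ, ∫⁻ x, M x z * w x ^ p ∂μ ≤ C * w z ^ p)
    {g : X → ℝ≥0∞} (hg : Measurable g) :
    ∫⁻ x, (∫⁻ z, M x z * g z ∂μ) ^ p ∂μ ≤ C ^ p * ∫⁻ z, g z ^ p ∂μ := by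
  have hp := hpq.pos
  have hq := hpq.symm.pos
  have hMx : ∀ x, Measurable (M x) := fun x => hM.comp (f := fun z => (x, z)) (by fun_prop)
  have hMz : ∀ z, Measurable fun x => M x z := fun z => hM.comp (f := fun x => (x, z)) (by fun_prop)
  have hpow : 1 / q * p + 1 = p := by
    have := hpq.inv_add_inv_eq_one
    field_simp at this ⊢
    linarith
  have step : ∀ᵐ x ∂μ, (∫⁻ z, M x z * g z ∂μ) ^ p
      ≤ C ^ (1 / q * p) * (w x ^ p * ∫⁻ z, M x z * (w z ^ (-p) * g z ^ p) ∂μ) := by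
    filter_upwards [h1] with x hx
    -- Hölder's inequality for `M g = (M^(1/q) w) (M^(1/p) w⁻¹ g)`.
    have e : ∫⁻ z, M x z * g z ∂μ
        = ∫⁻ z, (fun z => M x z ^ (1 / q) * w z) z * (fun z => M x z ^ (1 / p) * ((w z)⁻¹ * g z)) z
          ∂μ := by
      refine lintegral_congr_ae ?_
      filter_upwards [hw0, hwt] with z h0 ht
      have e1 : M x z = M x z ^ (1 / q) * M x z ^ (1 / p) := by
        rw [← ENNReal.rpow_add_of_nonneg _ _ (by positivity) (by positivity), one_div, one_div,
          hpq.symm.inv_add_inv_eq_one, ENNReal.rpow_one]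
      calc M x z * g z = M x z ^ (1 / q) * M x z ^ (1 / p) * ((w z * (w z)⁻¹) * g z) := by
            rw [ENNReal.mul_inv_cancel h0 ht, one_mul, ← e1]
        _ = _ := by ring
    have hol := ENNReal.lintegral_mul_le_Lp_mul_Lq μ hpq.symm (f := fun z => M x z ^ (1 / q) * w z)
      (g := fun z => M x z ^ (1 / p) * ((w z)⁻¹ * g z))
      (((hMx x).pow_const _).mul hw).aemeasurable
      (((hMx x).pow_const _).mul (hw.inv.mul hg)).aemeasurable
    have e2 : ∀ z, (M x z ^ (1 / q) * w z) ^ q = M x z * w z ^ q := fun z => by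
      rw [ENNReal.mul_rpow_of_nonneg _ _ hq.le, ← ENNReal.rpow_mul, one_div,
        inv_mul_cancel₀ hq.ne', ENNReal.rpow_one]
    have e3 : ∀ z, (M x z ^ (1 / p) * ((w z)⁻¹ * g z)) ^ p = M x z * (w z ^ (-p) * g z ^ p) :=
      fun z => by
        rw [ENNReal.mul_rpow_of_nonneg _ _ hp.le, ← ENNReal.rpow_mul, one_div,
          inv_mul_cancel₀ hp.ne', ENNReal.rpow_one, ENNReal.mul_rpow_of_nonneg _ _ hp.le,
          ENNReal.inv_rpow, ENNReal.rpow_neg]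
    simp only [Pi.mul_apply, e2, e3] at hol
    rw [e]
    refine (ENNReal.rpow_le_rpow (hol.trans (mul_le_mul_left (ENNReal.rpow_le_rpow hx
      (by positivity)) _)) hp.le).trans_eq ?_
    rw [ENNReal.mul_rpow_of_nonneg _ _ hp.le, ← ENNReal.rpow_mul, ← ENNReal.rpow_mul, one_div p,
      inv_mul_cancel₀ hp.ne', ENNReal.rpow_one, ENNReal.mul_rpow_of_nonneg _ _ (by positivity),
      ← ENNReal.rpow_mul, show q * (1 / q * p) = p by field_simp, mul_assoc]
  have mprod : Measurable fun y : X × X => w y.1 ^ p * (M y.1 y.2 * (w y.2 ^ (-p) * g y.2 ^ p)) :=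
    ((hw.comp measurable_fst).pow_const _).mul (hM.mul
      (((hw.comp measurable_snd).pow_const _).mul ((hg.comp measurable_snd).pow_const _)))
  calc ∫⁻ x, (∫⁻ z, M x z * g z ∂μ) ^ p ∂μ
      ≤ ∫⁻ x, C ^ (1 / q * p) * (w x ^ p * ∫⁻ z, M x z * (w z ^ (-p) * g z ^ p) ∂μ) ∂μ :=
        lintegral_mono_ae step
    _ = C ^ (1 / q * p) * ∫⁻ x, ∫⁻ z, w x ^ p * (M x z * (w z ^ (-p) * g z ^ p)) ∂μ ∂μ := by
        have e : ∀ x, ∫⁻ z, w x ^ p * (M x z * (w z ^ (-p) * g z ^ p)) ∂μ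
            = w x ^ p * ∫⁻ z, M x z * (w z ^ (-p) * g z ^ p) ∂μ := fun x =>
          lintegral_const_mul _ ((hMx x).mul ((hw.pow_const _).mul (hg.pow_const _)))
        have m := mprod.lintegral_prod_right' (ν := μ)
        rw [← lintegral_const_mul _ m]
        simp_rw [e]
    _ = C ^ (1 / q * p) * ∫⁻ z, (w z ^ (-p) * g z ^ p) * ∫⁻ x, M x z * w x ^ p ∂μ ∂μ := by
        rw [lintegral_lintegral_swap mprod.aemeasurable]
        congr 2
        funext z
        have m : Measurable fun x => M x z * w x ^ p := (hMz z).mul (hw.pow_const _)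
        rw [← lintegral_const_mul _ m]
        congr 1
        funext x
        ring
    _ ≤ C ^ (1 / q * p) * ∫⁻ z, C * g z ^ p ∂μ := by
        gcongr 1
        refine lintegral_mono_ae ?_
        filter_upwards [h2, hw0, hwt] with z hz h0 ht
        calc (w z ^ (-p) * g z ^ p) * ∫⁻ x, M x z * w x ^ p ∂μ
            ≤ (w z ^ (-p) * g z ^ p) * (C * w z ^ p) := by gcongr
          _ = (w z ^ (-p) * w z ^ p) * (C * g z ^ p) := by ring
          _ = C * g z ^ p := by
            rw [← ENNReal.rpow_add _ _ h0 ht, neg_add_cancel, ENNReal.rpow_zero, one_mul]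
    _ = C ^ p * ∫⁻ z, g z ^ p ∂μ := by
        rw [lintegral_const_mul _ (hg.pow_const _), ← mul_assoc]
        congr 1
        nth_rewrite 2 [← ENNReal.rpow_one C]
        rw [← ENNReal.rpow_add_of_nonneg _ _ (by positivity) zero_le_one, hpow]

/-! ### A homogeneous kernel on the half line -/

lemma lintegral_Ioi_comp_mul {c : ℝ} (hc : 0 < c) (f : ℝ → ℝ≥0∞) :
    ∫⁻ t in Ioi 0, f t = ENNReal.ofReal c * ∫⁻ t in Ioi 0, f (c * t) := by
  have him : (fun t => c * t) '' Ioi 0 = Ioi 0 := by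
    rw [image_mul_left_Ioi hc, mul_zero]
  have h := lintegral_image_eq_lintegral_abs_deriv_mul (measurableSet_Ioi (a := (0 : ℝ)))
    (f := fun t => c * t) (f' := fun _ => c)
    (fun x _ => by simpa using ((hasDerivAt_id x).const_mul c).hasDerivWithinAt)
    (fun x _ y _ hxy => mul_left_cancel₀ hc.ne' hxy) f
  rw [him] at h
  rw [h, lintegral_const_mul' _ _ ENNReal.ofReal_ne_top, abs_of_pos hc]

lemma lintegral_rpow_mul_exp_inv_lt_top {η : ℝ} (hη : 0 < η) (hη' : η < 1 / 2) :
    ∫⁻ t in Ioi 0, ENNReal.ofReal (t ^ (η - 3 / 2) * Real.exp (-1 / (8 * t))) < ∞ := by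
  have i1 : IntegrableOn (fun t : ℝ => 8 * t ^ (η - 1 / 2)) (Ioc 0 1) :=
    ((intervalIntegral.intervalIntegrable_rpow' (by linarith)).1).const_mul 8
  have i2 : IntegrableOn (fun t : ℝ => t ^ (η - 3 / 2)) (Ioi 1) :=
    integrableOn_Ioi_rpow_of_lt (by linarith) one_pos
  rw [← Ioc_union_Ioi_eq_Ioi (zero_le_one (α := ℝ)), lintegral_union measurableSet_Ioi
    (Ioc_disjoint_Ioi le_rfl)]
  refine ENNReal.add_lt_top.2 ⟨?_, ?_⟩
  · refine (setLIntegral_mono' measurableSet_Ioc fun t ht => ?_).trans_lt i1.lintegral_lt_top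
    refine ENNReal.ofReal_le_ofReal ?_
    have ht0 : 0 < t := ht.1
    have e : t ^ (η - 1 / 2) = t ^ (η - 3 / 2) * t := by
      rw [← Real.rpow_add_one ht0.ne']; ring_nf
    have h8 : Real.exp (-1 / (8 * t)) ≤ 8 * t := by
      have := Real.add_one_le_exp (1 / (8 * t))
      rw [neg_div, Real.exp_neg, inv_le_comm₀ (Real.exp_pos _) (by positivity), ← one_div]
      linarith
    rw [e]
    nlinarith [Real.rpow_pos_of_pos ht0 (η - 3 / 2)]
  · refine (setLIntegral_mono' measurableSet_Ioi fun t ht => ?_).trans_lt i2.lintegral_lt_top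
    refine ENNReal.ofReal_le_ofReal (mul_le_of_le_one_right ?_ (Real.exp_le_one_iff.2 ?_))
    · exact Real.rpow_nonneg (zero_le_one.trans ht.le) _
    · have ht : 1 < t := ht
      exact div_nonpos_of_nonpos_of_nonneg (by norm_num) (by linarith)

/-- Integrating the Gaussian factors in time leaves a homogeneous singular kernel. -/
lemma lintegral_rpow_mul_exp_le {η : ℝ} (hη : 0 < η) (hη' : η < 1 / 2) :
    ∃ C : ℝ≥0∞, C < ∞ ∧ ∀ d : ℝ, 0 < d →
      ∫⁻ t in Ioi 0, ENNReal.ofReal (t ^ (η - 3 / 2) * Real.exp (-d ^ 2 / (8 * t)))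
        = C * ENNReal.ofReal (d ^ (2 * η - 1)) := by
  refine ⟨_, lintegral_rpow_mul_exp_inv_lt_top hη hη', fun d hd => ?_⟩
  have hd2 : 0 < d ^ 2 := by positivity
  rw [lintegral_Ioi_comp_mul hd2, mul_comm _ (ENNReal.ofReal (d ^ (2 * η - 1)))]
  have e : ∀ t ∈ Ioi (0 : ℝ), ENNReal.ofReal ((d ^ 2 * t) ^ (η - 3 / 2) *
      Real.exp (-d ^ 2 / (8 * (d ^ 2 * t)))) = ENNReal.ofReal ((d ^ 2) ^ (η - 3 / 2)) *
        ENNReal.ofReal (t ^ (η - 3 / 2) * Real.exp (-1 / (8 * t))) := fun t ht => by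
    have ht : 0 < t := ht
    rw [← ENNReal.ofReal_mul (by positivity), Real.mul_rpow hd2.le ht.le, mul_assoc]
    congr 4
    field_simp
  rw [setLIntegral_congr_fun measurableSet_Ioi e, lintegral_const_mul' _ _ ENNReal.ofReal_ne_top,
    ← mul_assoc, ← ENNReal.ofReal_mul hd2.le]
  congr 2
  rw [← Real.rpow_natCast d 2, ← Real.rpow_mul hd.le, ← Real.rpow_add hd]
  congr 1
  push_cast
  ring

lemma lintegral_abs_one_sub_rpow_lt_top {η a : ℝ} (hη : 0 < η) (ha : η < a)
    (ha' : η < 1 - a) :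
    ∫⁻ v in Ioi 0, ENNReal.ofReal (|1 - v| ^ (2 * η - 1) * v ^ (-η - a)) < ∞ := by
  set b := 2 * η - 1 with hb
  set c := -η - a with hc
  have hb0 : b < 0 := by rw [hb]; linarith
  have hc0 : c < 0 := by rw [hc]; linarith
  have i1 : IntegrableOn (fun v : ℝ => (1 / 2 : ℝ) ^ b * v ^ c) (Ioc 0 (1 / 2)) :=
    ((intervalIntegral.intervalIntegrable_rpow' (by rw [hc]; linarith)).1).const_mul _
  have i2 : IntegrableOn (fun v : ℝ => (1 / 2 : ℝ) ^ c * (1 - v) ^ b) (Ioc (1 / 2) 1) := by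
    have h := ((intervalIntegral.intervalIntegrable_rpow' (a := 1 - 1 / 2) (b := 1 - 1)
      (r := b) (by rw [hb]; linarith)).comp_sub_left 1).1.const_mul ((1 / 2 : ℝ) ^ c)
    norm_num at h ⊢
    exact h
  have i3 : IntegrableOn (fun v : ℝ => (1 / 2 : ℝ) ^ c * (v - 1) ^ b) (Ioc 1 2) := by
    have h := ((intervalIntegral.intervalIntegrable_rpow' (a := 0) (b := 1)
      (r := b) (by rw [hb]; linarith)).comp_sub_right 1).1.const_mul ((1 / 2 : ℝ) ^ c)
    norm_num at h
    exact h
  have i4 : IntegrableOn (fun v : ℝ => (1 / 2 : ℝ) ^ b * v ^ (b + c)) (Ioi 2) :=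
    (integrableOn_Ioi_rpow_of_lt (by rw [hb, hc]; linarith) two_pos).const_mul _
  rw [← Ioc_union_Ioi_eq_Ioi (show (0 : ℝ) ≤ 1 / 2 by norm_num), lintegral_union measurableSet_Ioi
    (Ioc_disjoint_Ioi le_rfl), ← Ioc_union_Ioi_eq_Ioi (show (1 / 2 : ℝ) ≤ 1 by norm_num),
    lintegral_union measurableSet_Ioi (Ioc_disjoint_Ioi le_rfl),
    ← Ioc_union_Ioi_eq_Ioi (show (1 : ℝ) ≤ 2 by norm_num),
    lintegral_union measurableSet_Ioi (Ioc_disjoint_Ioi le_rfl)]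
  refine ENNReal.add_lt_top.2 ⟨?_, ENNReal.add_lt_top.2 ⟨?_, ENNReal.add_lt_top.2 ⟨?_, ?_⟩⟩⟩
  · refine (setLIntegral_mono' measurableSet_Ioc fun v hv => ?_).trans_lt i1.lintegral_lt_top
    refine ENNReal.ofReal_le_ofReal (mul_le_mul_of_nonneg_right ?_ (Real.rpow_nonneg hv.1.le _))
    rw [abs_of_nonneg (by linarith [hv.2])]
    exact Real.rpow_le_rpow_of_nonpos (by norm_num) (by linarith [hv.2]) hb0.le
  · refine (setLIntegral_mono' measurableSet_Ioc fun v hv => ?_).trans_lt i2.lintegral_lt_top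
    rw [mul_comm, abs_of_nonneg (by linarith [hv.2])]
    refine ENNReal.ofReal_le_ofReal (mul_le_mul_of_nonneg_right ?_
      (Real.rpow_nonneg (by linarith [hv.2]) _))
    exact Real.rpow_le_rpow_of_nonpos (by norm_num) hv.1.le hc0.le
  · refine (setLIntegral_mono' measurableSet_Ioc fun v hv => ?_).trans_lt i3.lintegral_lt_top
    rw [mul_comm, abs_sub_comm, abs_of_nonneg (by linarith [hv.1])]
    refine ENNReal.ofReal_le_ofReal (mul_le_mul_of_nonneg_right ?_
      (Real.rpow_nonneg (by linarith [hv.1]) _))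
    exact Real.rpow_le_rpow_of_nonpos (by norm_num) (by linarith [hv.1]) hc0.le
  · refine (setLIntegral_mono' measurableSet_Ioi fun v hv => ?_).trans_lt i4.lintegral_lt_top
    have hv : 2 < v := hv
    have hv0 : 0 < v := by linarith
    rw [Real.rpow_add hv0, ← mul_assoc, ← Real.mul_rpow (by norm_num) hv0.le, abs_sub_comm,
      abs_of_nonneg (by linarith)]
    refine ENNReal.ofReal_le_ofReal (mul_le_mul_of_nonneg_right ?_ (Real.rpow_nonneg hv0.le _))
    exact Real.rpow_le_rpow_of_nonpos (by positivity) (by linarith) hb0.le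

/-- The one-dimensional Schur estimate: the kernel is homogeneous of degree `-1`, so that it
maps `u^(-a)` to a multiple of `x^(-a)`. -/
lemma lintegral_gauss_rpow_le {η a : ℝ} (hη : 0 < η) (hη' : η < 1 / 2) (ha : η < a)
    (ha' : η < 1 - a) : ∃ C : ℝ≥0∞, C < ∞ ∧ ∀ x : ℝ, 0 < x →
      ∫⁻ u in Ioi 0, ∫⁻ t in Ioi 0,
        ENNReal.ofReal (t⁻¹ * gauss t x u * (t / (x * u)) ^ η * u ^ (-a))
        ≤ C * ENNReal.ofReal (x ^ (-a)) := by
  obtain ⟨C, hC, hCd⟩ := lintegral_rpow_mul_exp_le hη hη'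
  refine ⟨C * _, ENNReal.mul_lt_top hC (lintegral_abs_one_sub_rpow_lt_top hη ha ha'),
    fun x hx => ?_⟩
  have h1 : ∀ᵐ u ∂volume.restrict (Ioi 0), ∫⁻ t in Ioi 0,
        ENNReal.ofReal (t⁻¹ * gauss t x u * (t / (x * u)) ^ η * u ^ (-a))
      = C * ENNReal.ofReal (|x - u| ^ (2 * η - 1) * x ^ (-η) * u ^ (-η - a)) := by
    filter_upwards [ae_restrict_mem measurableSet_Ioi,
      ae_restrict_of_ae (compl_mem_ae_iff.2 (measure_singleton x))] with u hu hux
    have hu : 0 < u := hu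
    have hd : 0 < |x - u| := abs_pos.2 (sub_ne_zero.2 (Ne.symm hux))
    have e : ∀ t ∈ Ioi (0 : ℝ), ENNReal.ofReal (t⁻¹ * gauss t x u * (t / (x * u)) ^ η * u ^ (-a))
        = ENNReal.ofReal (x ^ (-η) * u ^ (-η - a)) *
          ENNReal.ofReal (t ^ (η - 3 / 2) * Real.exp (-|x - u| ^ 2 / (8 * t))) := fun t ht => by
      have ht : 0 < t := ht
      rw [← ENNReal.ofReal_mul (by positivity), gauss, sq_abs, Real.div_rpow ht.le (by positivity),
        Real.mul_rpow hx.le hu.le, Real.rpow_sub hu, Real.rpow_neg hx.le, Real.rpow_neg hu.le,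
        Real.rpow_neg hu.le, Real.rpow_sub ht, show (3 / 2 : ℝ) = 1 + 1 / 2 by norm_num,
        Real.rpow_add ht, Real.rpow_one, ← Real.sqrt_eq_rpow]
      congr 1
      have := Real.rpow_pos_of_pos hx η
      have := Real.rpow_pos_of_pos hu η
      have := Real.rpow_pos_of_pos hu a
      have := Real.sqrt_pos.2 ht
      field_simp
    rw [setLIntegral_congr_fun measurableSet_Ioi e, lintegral_const_mul' _ _ ENNReal.ofReal_ne_top,
      hCd _ hd, mul_left_comm, ← ENNReal.ofReal_mul (by positivity)]
    congr 2
    ring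
  rw [lintegral_congr_ae h1, lintegral_const_mul' _ _ hC.ne, mul_assoc, lintegral_Ioi_comp_mul hx]
  refine mul_le_mul_right ?_ C
  -- Scaling `u = x v`.
  have e : ∀ v ∈ Ioi (0 : ℝ), ENNReal.ofReal (|x - x * v| ^ (2 * η - 1) * x ^ (-η) *
      (x * v) ^ (-η - a)) = ENNReal.ofReal (x ^ (-1 - a)) *
        ENNReal.ofReal (|1 - v| ^ (2 * η - 1) * v ^ (-η - a)) := fun v hv => by
    have hv : 0 < v := hv
    rw [← ENNReal.ofReal_mul (by positivity), show x - x * v = x * (1 - v) by ring, abs_mul,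
      abs_of_pos hx, Real.mul_rpow hx.le (abs_nonneg _), Real.mul_rpow hx.le hv.le,
      show -1 - a = (2 * η - 1) + -η + (-η - a) by ring, Real.rpow_add hx, Real.rpow_add hx]
    congr 1
    ring
  rw [setLIntegral_congr_fun measurableSet_Ioi e, lintegral_const_mul' _ _ ENNReal.ofReal_ne_top,
    ← mul_assoc, ← ENNReal.ofReal_mul hx.le, mul_comm]
  refine le_of_eq ?_
  congr 2
  rw [mul_comm, ← Real.rpow_add_one hx.ne']
  ring_nf

/-! ### The majorant of the difference kernel -/

/-- The kernel `∫_0^∞ ∏_i t^(-1/2) e^(-(x_i - z_i)² / 8t) (t / (x_j z_j))^η dt / t`. -/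
noncomputable def majorant (η : ℝ) (j : Fin n) (x z : Fin n → ℝ) : ℝ≥0∞ :=
  ∫⁻ t in Ioi 0, ENNReal.ofReal (t⁻¹ * gaussProd t x z * (t / (x j * z j)) ^ η)

lemma measurable_majorant_integrand (η : ℝ) (j : Fin n) :
    Measurable fun p : ((Fin n → ℝ) × (Fin n → ℝ)) × ℝ =>
      ENNReal.ofReal (p.2⁻¹ * gaussProd p.2 p.1.1 p.1.2 * (p.2 / (p.1.1 j * p.1.2 j)) ^ η) := by
  have m : Measurable fun p : ((Fin n → ℝ) × (Fin n → ℝ)) × ℝ => gaussProd p.2 p.1.1 p.1.2 :=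
    (measurable_gaussProd n).comp
      (f := fun p : ((Fin n → ℝ) × (Fin n → ℝ)) × ℝ => (p.2, p.1)) (by fun_prop)
  fun_prop

lemma measurable_majorant (η : ℝ) (j : Fin n) :
    Measurable (Function.uncurry (majorant η j)) :=
  (measurable_majorant_integrand η j).lintegral_prod_right' (ν := volume.restrict (Ioi 0))

lemma majorant_comm (η : ℝ) (j : Fin n) (x z : Fin n → ℝ) :
    majorant η j x z = majorant η j z x := by
  unfold majorant
  congr 1
  funext t
  rw [gaussProd_comm, mul_comm (x j)]

lemma lintegral_gaussProd_mul_coord_le {t : ℝ} (ht : 0 < t) (x : Fin n → ℝ) (j : Fin n)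
    {e : ℝ → ℝ≥0∞} (he : Measurable e) :
    ∫⁻ z, ENNReal.ofReal (gaussProd t x z) * e (z j) ∂orthantMeasure n
      ≤ (∫⁻ u in Ioi 0, ENNReal.ofReal (gauss t (x j) u) * e u)
        * ENNReal.ofReal √(8 * Real.pi) ^ (n - 1) := by
  set f : Fin n → ℝ → ℝ≥0∞ := fun i u =>
    ENNReal.ofReal (gauss t (x i) u) * (if i = j then e u else 1) with hf
  have mg : ∀ i, Measurable fun u => ENNReal.ofReal (gauss t (x i) u) := fun i =>
    (measurable_gauss.comp (f := fun u => (t, x i, u)) (by fun_prop)).ennreal_ofReal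
  have mf : ∀ i, Measurable (f i) := fun i => by
    refine (mg i).mul ?_
    split_ifs
    · exact he
    · exact measurable_const
  have e1 : ∀ z : Fin n → ℝ, ENNReal.ofReal (gaussProd t x z) * e (z j) = ∏ i, f i (z i) :=
    fun z => by
      rw [hf, gaussProd, ENNReal.ofReal_prod_of_nonneg fun _ _ => gauss_nonneg _ _ _,
        Finset.prod_mul_distrib, Finset.prod_ite_eq' Finset.univ j (fun i => e (z i))]
      simp
  simp_rw [e1]
  rw [lintegral_orthant_prod mf, ← Finset.mul_prod_erase _ _ (Finset.mem_univ j)]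
  refine mul_le_mul' (le_of_eq (by simp [hf])) ?_
  have hc : (Finset.univ.erase j).card = n - 1 := by
    rw [Finset.card_erase_of_mem (Finset.mem_univ j), Finset.card_fin]
  rw [← hc, ← Finset.prod_const]
  refine Finset.prod_le_prod' fun i hi => ?_
  simp only [hf, if_neg (Finset.ne_of_mem_erase hi), mul_one]
  exact lintegral_gauss_le ht (x i)

lemma lintegral_majorant_mul_le {η a : ℝ} (hη : 0 < η) (hη' : η < 1 / 2) (ha : η < a)
    (ha' : η < 1 - a) (j : Fin n) : ∃ C : ℝ≥0∞, C < ∞ ∧ ∀ x : Fin n → ℝ, (∀ i, 0 < x i) →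
      ∫⁻ z, majorant η j x z * ENNReal.ofReal (z j ^ (-a)) ∂orthantMeasure n
        ≤ C * ENNReal.ofReal (x j ^ (-a)) := by
  obtain ⟨C, hC, hCx⟩ := lintegral_gauss_rpow_le hη hη' ha ha'
  refine ⟨C * ENNReal.ofReal √(8 * Real.pi) ^ (n - 1), by finiteness, fun x hx => ?_⟩
  have m1 : Measurable fun q : (Fin n → ℝ) × ℝ =>
      ENNReal.ofReal (q.2⁻¹ * gaussProd q.2 x q.1 * (q.2 / (x j * q.1 j)) ^ η) :=
    (measurable_majorant_integrand η j).comp (f := fun q : (Fin n → ℝ) × ℝ => ((x, q.1), q.2))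
      (by fun_prop)
  have e1 : ∀ z : Fin n → ℝ, majorant η j x z * ENNReal.ofReal (z j ^ (-a)) = ∫⁻ t in Ioi 0,
      ENNReal.ofReal (t⁻¹ * gaussProd t x z * (t / (x j * z j)) ^ η) * ENNReal.ofReal (z j ^ (-a)) :=
    fun z => (lintegral_mul_const' _ _ ENNReal.ofReal_ne_top).symm
  simp_rw [e1]
  rw [lintegral_lintegral_swap (Measurable.aemeasurable (by fun_prop))]
  have m2 : Measurable fun q : ℝ × ℝ =>
      ENNReal.ofReal (q.2⁻¹ * gauss q.2 (x j) q.1 * (q.2 / (x j * q.1)) ^ η * q.1 ^ (-a)) := by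
    have := measurable_gauss.comp (f := fun q : ℝ × ℝ => (q.2, x j, q.1)) (by fun_prop)
    simp only [Function.comp_def] at this
    fun_prop
  calc _ ≤ ∫⁻ t in Ioi 0, (∫⁻ u in Ioi 0,
        ENNReal.ofReal (t⁻¹ * gauss t (x j) u * (t / (x j * u)) ^ η * u ^ (-a)))
          * ENNReal.ofReal √(8 * Real.pi) ^ (n - 1) := by
        refine setLIntegral_mono' measurableSet_Ioi fun t ht => ?_
        have ht : 0 < t := ht
        refine (lintegral_mono_ae ?_).trans
          ((lintegral_gaussProd_mul_coord_le ht x j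
            (e := fun u => ENNReal.ofReal (t⁻¹ * (t / (x j * u)) ^ η * u ^ (-a)))
            (by fun_prop)).trans (le_of_eq ?_))
        · filter_upwards [ae_orthant n] with z hz
          have h1 := mul_pos (hx j) (hz j)
          have := hz j
          rw [← ENNReal.ofReal_mul (mul_nonneg (mul_nonneg (by positivity)
            (gaussProd_nonneg _ _ _)) (by positivity)),
            ← ENNReal.ofReal_mul (gaussProd_nonneg _ _ _)]
          refine le_of_eq ?_
          congr 1
          ring
        · congr 1
          refine setLIntegral_congr_fun measurableSet_Ioi fun u _ => ?_
          rw [← ENNReal.ofReal_mul (gauss_nonneg _ _ _)]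
          congr 1
          ring
    _ ≤ _ := by
        rw [lintegral_mul_const' _ _ (by finiteness),
          ← lintegral_lintegral_swap m2.aemeasurable, mul_right_comm]
        exact mul_le_mul_left (hCx (x j) (hx j)) _

/-- The majorants are bounded on `L^p`. -/
lemma lintegral_majorant_schur {p q : ℝ} (hpq : p.HolderConjugate q) {η : ℝ} (hη : 0 < η)
    (h1 : η < 1 / p) (h2 : η < 1 / q) (j : Fin n) : ∃ C : ℝ≥0∞, C < ∞ ∧
      ∀ g : (Fin n → ℝ) → ℝ≥0∞, Measurable g →
        ∫⁻ x, (∫⁻ z, majorant η j x z * g z ∂orthantMeasure n) ^ p ∂orthantMeasure n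
          ≤ C * ∫⁻ z, g z ^ p ∂orthantMeasure n := by
  have hp := hpq.pos
  have hq := hpq.symm.pos
  have hs : 1 / p + 1 / q = 1 := by rw [one_div, one_div, hpq.inv_add_inv_eq_one]
  obtain ⟨A, hA, hA'⟩ := lintegral_majorant_mul_le hη (by linarith) h1 (by linarith) j
  obtain ⟨B, hB, hB'⟩ := lintegral_majorant_mul_le hη (by linarith) h2 (by linarith) j
  -- The weight `w = x_j^(-1/(pq))` has `w^q = x_j^(-1/p)` and `w^p = x_j^(-1/q)`.
  have hw : ∀ (x : Fin n → ℝ), 0 < x j → ∀ r s : ℝ, r ≠ 0 → s ≠ 0 →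
      ENNReal.ofReal (x j ^ (-(1 / (r * s)))) ^ s = ENNReal.ofReal (x j ^ (-(1 / r))) := by
    intro x hx r s hr hs
    rw [ENNReal.ofReal_rpow_of_pos (by positivity), ← Real.rpow_mul hx.le]
    congr 2
    field_simp
  refine ⟨(A + B) ^ p, by finiteness, fun g hg => ?_⟩
  refine lintegral_schur (measurable_majorant η j)
    (w := fun x => ENNReal.ofReal (x j ^ (-(1 / (p * q))))) (by fun_prop) ?_ ?_ hpq ?_ ?_ hg
  · filter_upwards [ae_orthant n] with x hx
    have := hx j
    simp only [ne_eq, ENNReal.ofReal_eq_zero, not_le]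
    positivity
  · exact Filter.Eventually.of_forall fun x => ENNReal.ofReal_ne_top
  · filter_upwards [ae_orthant n] with x hx
    rw [hw x (hx j) p q hp.ne' hq.ne']
    refine (lintegral_mono_ae ?_).trans ((hA' x hx).trans
      (mul_le_mul_left le_self_add _))
    filter_upwards [ae_orthant n] with z hz
    rw [hw z (hz j) p q hp.ne' hq.ne']
  · filter_upwards [ae_orthant n] with z hz
    rw [mul_comm p q, hw z (hz j) q p hq.ne' hp.ne']
    refine (lintegral_mono_ae ?_).trans ((hB' z hz).trans
      (mul_le_mul_left le_add_self _))
    filter_upwards [ae_orthant n] with x hx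
    rw [hw x (hx j) q p hq.ne' hp.ne', majorant_comm]

lemma lintegral_sum_majorant_schur {p q : ℝ} (hpq : p.HolderConjugate q) {η : ℝ} (hη : 0 < η)
    (h1 : η < 1 / p) (h2 : η < 1 / q) : ∃ C : ℝ≥0∞, C < ∞ ∧
      ∀ g : (Fin n → ℝ) → ℝ≥0∞, Measurable g →
        ∫⁻ x, (∫⁻ z, (∑ j, majorant η j x z) * g z ∂orthantMeasure n) ^ p ∂orthantMeasure n
          ≤ C * ∫⁻ z, g z ^ p ∂orthantMeasure n := by
  choose C hC hC' using lintegral_majorant_schur (n := n) hpq hη h1 h2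
  have hp := hpq.pos
  refine ⟨((n : ℝ≥0∞) ^ (p - 1)) * ∑ j, C j, ENNReal.mul_lt_top ?_
    (ENNReal.sum_lt_top.2 fun j _ => hC j), fun g hg => ?_⟩
  · exact ENNReal.rpow_lt_top_of_nonneg (by linarith [hpq.lt]) (by simp)
  have mM : ∀ (j : Fin n) x, Measurable (majorant η j x) := fun j x =>
    (measurable_majorant η j).comp (f := fun z => (x, z)) (by fun_prop)
  have mI : ∀ j : Fin n, Measurable fun x => ∫⁻ z, majorant η j x z * g z ∂orthantMeasure n := fun j =>
    ((measurable_majorant η j).mul (hg.comp measurable_snd)).lintegral_prod_right'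
      (ν := orthantMeasure n)
  calc _ ≤ ∫⁻ x, (n : ℝ≥0∞) ^ (p - 1) *
        ∑ j, (∫⁻ z, majorant η j x z * g z ∂orthantMeasure n) ^ p ∂orthantMeasure n := by
        refine lintegral_mono fun x => ?_
        simp_rw [Finset.sum_mul]
        have m : ∀ j, Measurable fun z => majorant η j x z * g z := fun j => (mM j x).mul hg
        rw [lintegral_finsetSum _ fun j _ => m j]
        have := ENNReal.rpow_sum_le_const_mul_sum_rpow Finset.univ
          (fun j => ∫⁻ z, majorant η j x z * g z ∂orthantMeasure n) hpq.lt.le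
        simpa using this
    _ = (n : ℝ≥0∞) ^ (p - 1) * ∑ j, ∫⁻ x,
        (∫⁻ z, majorant η j x z * g z ∂orthantMeasure n) ^ p ∂orthantMeasure n := by
        rw [lintegral_const_mul _ (Finset.measurable_sum _ fun j _ => (mI j).pow_const _),
          lintegral_finsetSum _ fun j _ => (mI j).pow_const _]
    _ ≤ _ := by
        rw [mul_assoc, Finset.sum_mul]
        gcongr with j
        exact hC' j g hg

/-! ### The difference kernel -/

lemma abs_prod_sub_prod_le {ι : Type*} (s : Finset ι) {A B g e : ι → ℝ} (hA : ∀ i, |A i| ≤ g i)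
    (hB : ∀ i, |B i| ≤ g i) (hAB : ∀ i, |A i - B i| ≤ g i * e i) :
    |∏ i ∈ s, A i - ∏ i ∈ s, B i| ≤ (∏ i ∈ s, g i) * ∑ i ∈ s, e i := by
  classical
  have hg : ∀ i, 0 ≤ g i := fun i => (abs_nonneg _).trans (hA i)
  induction s using Finset.induction_on with
  | empty => simp
  | insert i s hi ih =>
    rw [Finset.prod_insert hi, Finset.prod_insert hi, Finset.prod_insert hi, Finset.sum_insert hi]
    have hP : |∏ i ∈ s, B i| ≤ ∏ i ∈ s, g i := by
      rw [Finset.abs_prod]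
      exact Finset.prod_le_prod (fun _ _ => abs_nonneg _) fun i _ => hB i
    calc |A i * ∏ i ∈ s, A i - B i * ∏ i ∈ s, B i|
        = |A i * (∏ i ∈ s, A i - ∏ i ∈ s, B i) + (A i - B i) * ∏ i ∈ s, B i| := by ring_nf
      _ ≤ |A i| * |∏ i ∈ s, A i - ∏ i ∈ s, B i| + |A i - B i| * |∏ i ∈ s, B i| := by
        rw [← abs_mul, ← abs_mul]; exact abs_add_le _ _
      _ ≤ g i * ((∏ i ∈ s, g i) * ∑ i ∈ s, e i) + g i * e i * ∏ i ∈ s, g i :=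
        add_le_add (mul_le_mul (hA i) ih (abs_nonneg _) (hg i))
          (mul_le_mul (hAB i) hP (abs_nonneg _) ((abs_nonneg _).trans (hAB i)))
      _ = _ := by ring

lemma abs_heatProd_sub_le {ν : Fin n → ℝ} (hν : ∀ j, -(1 / 2 : ℝ) < ν j) (k α : Fin n → ℕ)
    {η : ℝ} (hη : 0 ≤ η) (hη' : η ≤ 1 / 2) : ∃ C, 0 ≤ C ∧ ∀ (t : ℝ) (x z : Fin n → ℝ), 0 < t →
      (∀ j, 0 < x j) → (∀ j, 0 < z j) →
      |heatProd ν k t x z - heatProd (fun j => ν j + (α j : ℝ)) k t x z|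
        ≤ C * (√t)⁻¹ ^ (∑ j, k j) * gaussProd t x z * ∑ j, (t / (x j * z j)) ^ η := by
  have hν' : ∀ j, -(1 / 2 : ℝ) < ν j + (α j : ℝ) := fun j => by
    have := (α j).cast_nonneg (α := ℝ)
    linarith [hν j]
  choose A hA0 hA using fun j => abs_heatKernel_le (hν j) (k j)
  choose B hB0 hB using fun j => abs_heatKernel_le (hν' j) (k j)
  choose D hD0 hD using fun j => abs_heatKernel_sub_add_nat_le (hν j) (α j) (k j) hη hη'
  refine ⟨∏ j, (A j + B j + D j), Finset.prod_nonneg fun j _ => by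
    have := hA0 j; have := hB0 j; have := hD0 j; positivity, fun t x z ht hx hz => ?_⟩
  have h := abs_prod_sub_prod_le Finset.univ
    (A := fun j => heatKernel (ν j) (k j) t (x j) (z j))
    (B := fun j => heatKernel (ν j + (α j : ℝ)) (k j) t (x j) (z j))
    (g := fun j => (A j + B j + D j) * (√t)⁻¹ ^ k j * gauss t (x j) (z j))
    (e := fun j => (t / (x j * z j)) ^ η)
    (fun j => (hA j t _ _ ht (hx j) (hz j)).trans (by
      unfold gauss
      have := hB0 j; have := hD0 j
      gcongr
      linarith))
    (fun j => (hB j t _ _ ht (hx j) (hz j)).trans (by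
      unfold gauss
      have := hA0 j; have := hD0 j
      gcongr
      linarith))
    (fun j => (hD j t _ _ ht (hx j) (hz j)).trans (by
      unfold gauss
      have := hA0 j; have := hB0 j
      have := mul_pos (hx j) (hz j)
      gcongr
      linarith))
  rw [Finset.prod_mul_distrib, Finset.prod_mul_distrib, Finset.prod_pow_eq_pow_sum] at h
  exact h

/-- The integrand in `t` of the kernel of the difference of the two Riesz transforms, up to the
factor `1 / Γ(|k| / 2)`. -/
noncomputable def diffIntegrand (ν μ : Fin n → ℝ) (k : Fin n → ℕ) (t : ℝ) (x z : Fin n → ℝ) : ℝ :=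
  t ^ (((∑ j, k j : ℕ) : ℝ) / 2 - 1) * (heatProd ν k t x z - heatProd μ k t x z)

lemma measurable_diffIntegrand (ν μ : Fin n → ℝ) (k : Fin n → ℕ) :
    Measurable fun p : ℝ × (Fin n → ℝ) × (Fin n → ℝ) => diffIntegrand ν μ k p.1 p.2.1 p.2.2 := by
  have h1 := measurable_heatProd ν k
  have h2 := measurable_heatProd μ k
  unfold diffIntegrand
  fun_prop

lemma lintegral_diffIntegrand_le {ν : Fin n → ℝ} (hν : ∀ j, -(1 / 2 : ℝ) < ν j) (k α : Fin n → ℕ)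
    {η : ℝ} (hη : 0 ≤ η) (hη' : η ≤ 1 / 2) : ∃ C : ℝ≥0∞, C < ∞ ∧ ∀ (x z : Fin n → ℝ),
      (∀ j, 0 < x j) → (∀ j, 0 < z j) →
      ∫⁻ t in Ioi 0, ‖diffIntegrand ν (fun j => ν j + (α j : ℝ)) k t x z‖ₑ
        ≤ C * ∑ j, majorant η j x z := by
  obtain ⟨C, hC0, hC⟩ := abs_heatProd_sub_le hν k α hη hη'
  refine ⟨ENNReal.ofReal C, ENNReal.ofReal_lt_top, fun x z hx hz => ?_⟩
  unfold majorant
  have m : ∀ j, Measurable fun t : ℝ =>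
      ENNReal.ofReal (t⁻¹ * gaussProd t x z * (t / (x j * z j)) ^ η) := fun j =>
    (measurable_majorant_integrand η j).comp (f := fun t => ((x, z), t)) (by fun_prop)
  rw [← lintegral_finsetSum _ fun j _ => m j, ← lintegral_const_mul' _ _ ENNReal.ofReal_ne_top]
  refine setLIntegral_mono' measurableSet_Ioi fun t ht => ?_
  have ht : 0 < t := ht
  have hp : ∀ j, 0 < x j * z j := fun j => mul_pos (hx j) (hz j)
  have hg := gaussProd_nonneg t x z
  rw [← ENNReal.ofReal_sum_of_nonneg fun j _ => mul_nonneg (by positivity)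
      (Real.rpow_nonneg (div_nonneg ht.le (hp j).le) _), ← ENNReal.ofReal_mul hC0,
    Real.enorm_eq_ofReal_abs]
  refine ENNReal.ofReal_le_ofReal ?_
  rw [diffIntegrand, abs_mul, abs_of_nonneg (by positivity), ← Finset.mul_sum]
  have e : t ^ (((∑ j, k j : ℕ) : ℝ) / 2 - 1) * (√t)⁻¹ ^ (∑ j, k j) = t⁻¹ := by
    rw [Real.sqrt_eq_rpow, ← Real.rpow_neg ht.le, ← Real.rpow_natCast, ← Real.rpow_mul ht.le,
      ← Real.rpow_add ht, ← Real.rpow_neg_one]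
    congr 1
    ring
  calc _ ≤ t ^ (((∑ j, k j : ℕ) : ℝ) / 2 - 1) * (C * (√t)⁻¹ ^ (∑ j, k j) * gaussProd t x z *
        ∑ j, (t / (x j * z j)) ^ η) := by
        gcongr
        exact hC t x z ht hx hz
    _ = C * ((t ^ (((∑ j, k j : ℕ) : ℝ) / 2 - 1) * (√t)⁻¹ ^ (∑ j, k j)) * gaussProd t x z *
        ∑ j, (t / (x j * z j)) ^ η) := by ring
    _ = _ := by rw [e]

/-! ### Integral operators on `L^p` -/

/-- A kernel dominated by a positive kernel that is bounded on `L^p` defines a bounded operator. -/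
lemma exists_integralOperator {X : Type*} [MeasurableSpace X] {μ : Measure X} [SFinite μ]
    {K : X → X → ℝ} (hK : Measurable (Function.uncurry K)) {M : X → X → ℝ≥0∞}
    (hM : Measurable (Function.uncurry M)) (hKM : ∀ᵐ x ∂μ, ∀ᵐ z ∂μ, ‖K x z‖ₑ ≤ M x z)
    {p : ℝ≥0∞} [Fact (1 ≤ p)] (hp : p ≠ ∞) {C : ℝ≥0∞} (hC : C < ∞)
    (hMC : ∀ g : X → ℝ≥0∞, Measurable g →
      ∫⁻ x, (∫⁻ z, M x z * g z ∂μ) ^ p.toReal ∂μ ≤ C * ∫⁻ z, g z ^ p.toReal ∂μ) :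
    ∃ T : Lp ℂ p μ →L[ℂ] Lp ℂ p μ, ∀ f : Lp ℂ p μ, T f =ᵐ[μ] fun x => ∫ z, K x z • f z ∂μ := by
  have hp1 : 1 ≤ p := Fact.out
  have hp0 : p ≠ 0 := (zero_lt_one.trans_le hp1).ne'
  have hpr : 0 < p.toReal := ENNReal.toReal_pos hp0 hp
  have mf : ∀ f : Lp ℂ p μ, Measurable f := fun f => (Lp.stronglyMeasurable f).measurable
  have mint : ∀ f : Lp ℂ p μ, Measurable fun y : X × X => K y.1 y.2 • f y.2 := fun f =>
    hK.smul ((mf f).comp measurable_snd)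
  have hle : ∀ f : Lp ℂ p μ, ∀ᵐ x ∂μ, ∫⁻ z, ‖K x z • f z‖ₑ ∂μ ≤ ∫⁻ z, M x z * ‖f z‖ₑ ∂μ :=
    fun f => by
      filter_upwards [hKM] with x hx
      refine lintegral_mono_ae ?_
      filter_upwards [hx] with z hz
      rw [enorm_smul]
      gcongr
  have hpow : ∀ f : Lp ℂ p μ, ∫⁻ x, (∫⁻ z, M x z * ‖f z‖ₑ ∂μ) ^ p.toReal ∂μ
      ≤ C * eLpNorm f p μ ^ p.toReal := fun f => by
    refine (hMC (fun z => ‖f z‖ₑ) (mf f).enorm).trans_eq ?_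
    rw [eLpNorm_eq_lintegral_rpow_enorm_toReal hp0 hp, ← ENNReal.rpow_mul, one_div,
      inv_mul_cancel₀ hpr.ne', ENNReal.rpow_one]
  have mMf : ∀ f : Lp ℂ p μ, Measurable fun x => ∫⁻ z, M x z * ‖f z‖ₑ ∂μ := fun f =>
    (hM.mul ((mf f).comp measurable_snd).enorm).lintegral_prod_right' (ν := μ)
  have hint : ∀ f : Lp ℂ p μ, ∀ᵐ x ∂μ, Integrable (fun z => K x z • f z) μ := fun f => by
    have hfin : ∫⁻ x, (∫⁻ z, M x z * ‖f z‖ₑ ∂μ) ^ p.toReal ∂μ < ∞ := (hpow f).trans_lt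
      (ENNReal.mul_lt_top hC (ENNReal.rpow_lt_top_of_nonneg hpr.le (Lp.eLpNorm_ne_top f)))
    filter_upwards [hle f, ae_lt_top ((mMf f).pow_const _) hfin.ne] with x h1 h2
    refine ⟨((mint f).comp (f := fun z => (x, z)) (by fun_prop)).aestronglyMeasurable,
      h1.trans_lt ?_⟩
    by_contra h3
    rw [not_lt, top_le_iff] at h3
    rw [h3, ENNReal.top_rpow_of_pos hpr] at h2
    exact lt_irrefl _ h2
  set u : Lp ℂ p μ → X → ℂ := fun f x => ∫ z, K x z • f z ∂μ with hu
  have mu : ∀ f, AEStronglyMeasurable (u f) μ := fun f =>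
    ((mint f).stronglyMeasurable.integral_prod_right' (ν := μ)).aestronglyMeasurable
  have hnorm : ∀ f, eLpNorm (u f) p μ ≤ C ^ (1 / p.toReal) * eLpNorm f p μ := fun f => by
    rw [eLpNorm_eq_lintegral_rpow_enorm_toReal hp0 hp]
    calc (∫⁻ x, ‖u f x‖ₑ ^ p.toReal ∂μ) ^ (1 / p.toReal)
        ≤ (C * eLpNorm f p μ ^ p.toReal) ^ (1 / p.toReal) := by
          refine ENNReal.rpow_le_rpow ((lintegral_mono_ae ?_).trans (hpow f)) (by positivity)
          filter_upwards [hle f] with x hx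
          exact ENNReal.rpow_le_rpow ((enorm_integral_le_lintegral_enorm _).trans hx) hpr.le
      _ = _ := by
          rw [ENNReal.mul_rpow_of_nonneg _ _ (by positivity), ← ENNReal.rpow_mul, one_div,
            mul_inv_cancel₀ hpr.ne', ENNReal.rpow_one]
  have hCp : C ^ (1 / p.toReal) ≠ ∞ := (ENNReal.rpow_lt_top_of_nonneg (by positivity) hC.ne).ne
  have hu_mem : ∀ f, MemLp (u f) p μ := fun f =>
    ⟨mu f, (hnorm f).trans_lt (ENNReal.mul_lt_top hCp.lt_top (Lp.eLpNorm_lt_top f))⟩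
  let L : Lp ℂ p μ →ₗ[ℂ] Lp ℂ p μ :=
    { toFun := fun f => (hu_mem f).toLp
      map_add' := fun f g => by
        rw [← MemLp.toLp_add, MemLp.toLp_eq_toLp_iff]
        filter_upwards [hint f, hint g] with x hf hg
        rw [Pi.add_apply, hu, ← integral_add hf hg]
        refine integral_congr_ae ?_
        filter_upwards [Lp.coeFn_add f g] with z hz
        rw [hz, Pi.add_apply, smul_add]
      map_smul' := fun c f => by
        rw [← MemLp.toLp_const_smul, MemLp.toLp_eq_toLp_iff]
        refine Filter.Eventually.of_forall fun x => ?_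
        rw [Pi.smul_apply, hu, RingHom.id_apply, ← integral_smul]
        refine integral_congr_ae ?_
        filter_upwards [Lp.coeFn_smul c f] with z hz
        rw [hz, Pi.smul_apply, smul_comm] }
  refine ⟨L.mkContinuous (C ^ (1 / p.toReal)).toReal fun f => ?_, fun f => (hu_mem f).coeFn_toLp⟩
  change ‖(hu_mem f).toLp‖ ≤ _
  rw [Lp.norm_toLp, Lp.norm_def, ← ENNReal.toReal_mul]
  exact ENNReal.toReal_mono (ENNReal.mul_ne_top hCp (Lp.eLpNorm_ne_top f)) (hnorm f)

/-! ### The difference operator -/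

/-- The operator with kernel `∫_0^∞ t^(|k|/2 - 1) (δ_ν^k p_t^ν - δ_(ν+α)^k p_t^(ν+α)) dt` is bounded
on `L^p`, and its pairing with a test function is an absolutely convergent triple integral. -/
lemma exists_diffOperator {ν : Fin n → ℝ} (hν : ∀ j, -(1 / 2 : ℝ) < ν j) (k α : Fin n → ℕ)
    (p : ℝ≥0∞) [Fact (1 ≤ p)] (hp1 : 1 < p) (hp2 : p < ∞) :
    ∃ T : Lp ℂ p (orthantMeasure n) →L[ℂ] Lp ℂ p (orthantMeasure n),
      ∀ (f : Lp ℂ p (orthantMeasure n)) (φ : 𝓓(orthant n, ℝ)),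
        Integrable (fun w : ℝ × (Fin n → ℝ) × (Fin n → ℝ) =>
          (diffIntegrand ν (fun j => ν j + (α j : ℝ)) k w.1 w.2.1 w.2.2 * φ w.2.1) • f w.2.2)
          ((volume.restrict (Ioi 0)).prod ((orthantMeasure n).prod (orthantMeasure n))) ∧
        ∫ x, φ x • T f x ∂orthantMeasure n = ∫ t in Ioi 0, ∫ y : (Fin n → ℝ) × (Fin n → ℝ),
          (diffIntegrand ν (fun j => ν j + (α j : ℝ)) k t y.1 y.2 * φ y.1) • f y.2
          ∂((orthantMeasure n).prod (orthantMeasure n)) := by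
  set μ := orthantMeasure n with hμ
  set D : ℝ → (Fin n → ℝ) → (Fin n → ℝ) → ℝ := diffIntegrand ν (fun j => ν j + (α j : ℝ)) k with hD
  have mD : Measurable fun w : ℝ × (Fin n → ℝ) × (Fin n → ℝ) => D w.1 w.2.1 w.2.2 :=
    measurable_diffIntegrand _ _ _
  set r := p.toReal with hr
  have hr1 : 1 < r := by
    have := ENNReal.toReal_strict_mono hp2.ne hp1
    rwa [ENNReal.toReal_one] at this
  have hpq := Real.HolderConjugate.conjExponent hr1
  set q := r.conjExponent with hq
  have hr0 : 0 < r := hpq.pos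
  have hq0 : 0 < q := hpq.symm.pos
  obtain ⟨η, hη, hη'⟩ := exists_between (show 0 < min (1 / r) (1 / q) by positivity)
  obtain ⟨h1, h2⟩ := lt_min_iff.1 hη'
  have hs : 1 / r + 1 / q = 1 := by rw [one_div, one_div, hpq.inv_add_inv_eq_one]
  obtain ⟨A, hA, hAg⟩ := lintegral_sum_majorant_schur (n := n) hpq hη h1 h2
  obtain ⟨B, hB, hBx⟩ := lintegral_diffIntegrand_le hν k α hη.le (by linarith)
  set M : (Fin n → ℝ) → (Fin n → ℝ) → ℝ≥0∞ := fun x z => ∑ j, majorant η j x z with hMdef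
  have mM : Measurable (Function.uncurry M) :=
    Finset.measurable_sum _ fun j _ => measurable_majorant η j
  have mMx : ∀ x, Measurable (M x) := fun x => mM.comp (f := fun z => (x, z)) (by fun_prop)
  have hKM : ∀ᵐ x ∂μ, ∀ᵐ z ∂μ, ‖∫ t in Ioi 0, D t x z‖ₑ ≤ B * M x z := by
    filter_upwards [ae_orthant n] with x hx
    filter_upwards [ae_orthant n] with z hz
    exact (enorm_integral_le_lintegral_enorm _).trans (hBx x z hx hz)
  have hMC : ∀ g : (Fin n → ℝ) → ℝ≥0∞, Measurable g →
      ∫⁻ x, (∫⁻ z, B * M x z * g z ∂μ) ^ r ∂μ ≤ B ^ r * A * ∫⁻ z, g z ^ r ∂μ := fun g hg => by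
    have e : ∀ x, (∫⁻ z, B * M x z * g z ∂μ) ^ r = B ^ r * (∫⁻ z, M x z * g z ∂μ) ^ r := fun x => by
      simp_rw [mul_assoc]
      rw [lintegral_const_mul' _ _ hB.ne, ENNReal.mul_rpow_of_nonneg _ _ hr0.le]
    simp_rw [e]
    rw [lintegral_const_mul' _ _ (by finiteness), mul_assoc]
    gcongr
    exact hAg g hg
  have mK : Measurable (Function.uncurry fun x z => ∫ t in Ioi 0, D t x z) := by
    have m : Measurable fun w : ((Fin n → ℝ) × (Fin n → ℝ)) × ℝ => D w.2 w.1.1 w.1.2 :=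
      mD.comp (f := fun w : ((Fin n → ℝ) × (Fin n → ℝ)) × ℝ => (w.2, w.1)) (by fun_prop)
    exact (m.stronglyMeasurable.integral_prod_right' (ν := volume.restrict (Ioi 0))).measurable
  have mBM : Measurable (Function.uncurry fun x z => B * M x z) := mM.const_mul B
  obtain ⟨T, hT⟩ := exists_integralOperator mK mBM hKM hp2.ne
    (by finiteness : B ^ r * A < ∞) hMC
  refine ⟨T, fun f φ => ?_⟩
  have mf : Measurable f := (Lp.stronglyMeasurable f).measurable
  have mφ : Measurable φ := φ.continuous.measurable
  have hI : Integrable (fun w : ℝ × (Fin n → ℝ) × (Fin n → ℝ) =>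
      (D w.1 w.2.1 w.2.2 * φ w.2.1) • f w.2.2)
      ((volume.restrict (Ioi 0)).prod (μ.prod μ)) := by
    have mF : Measurable fun w : ℝ × (Fin n → ℝ) × (Fin n → ℝ) =>
        (D w.1 w.2.1 w.2.2 * φ w.2.1) • f w.2.2 := by fun_prop
    refine ⟨mF.aestronglyMeasurable, ?_⟩
    rw [HasFiniteIntegral, lintegral_prod_symm _ mF.enorm.aemeasurable]
    have m2 : Measurable fun x => ∫⁻ z, M x z * ‖f z‖ₑ ∂μ :=
      (mM.mul (mf.comp measurable_snd).enorm).lintegral_prod_right' (ν := μ)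
    have ha1 : ∀ᵐ y ∂(μ.prod μ), ∀ j, 0 < y.1 j :=
      Measure.quasiMeasurePreserving_fst.ae (ae_orthant n)
    have ha2 : ∀ᵐ y ∂(μ.prod μ), ∀ j, 0 < y.2 j :=
      Measure.quasiMeasurePreserving_snd.ae (ae_orthant n)
    have m3 : Measurable fun y : (Fin n → ℝ) × (Fin n → ℝ) => ‖φ y.1‖ₑ * (M y.1 y.2 * ‖f y.2‖ₑ) :=
      (mφ.comp measurable_fst).enorm.mul (mM.mul (mf.comp measurable_snd).enorm)
    calc _ ≤ ∫⁻ y, B * (‖φ y.1‖ₑ * (M y.1 y.2 * ‖f y.2‖ₑ)) ∂(μ.prod μ) := by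
          refine lintegral_mono_ae ?_
          filter_upwards [ha1, ha2] with y h1 h2
          have e : ∀ t, ‖(D t y.1 y.2 * φ y.1) • f y.2‖ₑ
              = ‖D t y.1 y.2‖ₑ * (‖φ y.1‖ₑ * ‖f y.2‖ₑ) := fun t => by
            rw [enorm_smul, enorm_mul, mul_assoc]
          simp_rw [e]
          rw [lintegral_mul_const' _ _ (by finiteness)]
          calc _ ≤ B * M y.1 y.2 * (‖φ y.1‖ₑ * ‖f y.2‖ₑ) := by
                gcongr
                exact hBx _ _ h1 h2
            _ = _ := by ring
      _ = B * ∫⁻ x, ‖φ x‖ₑ * ∫⁻ z, M x z * ‖f z‖ₑ ∂μ ∂μ := by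
          rw [lintegral_const_mul' _ _ hB.ne, lintegral_prod _ m3.aemeasurable]
          congr 1
          refine lintegral_congr fun x => ?_
          exact lintegral_const_mul' ‖φ x‖ₑ _ enorm_ne_top
      _ ≤ B * ((∫⁻ x, ‖φ x‖ₑ ^ q ∂μ) ^ (1 / q) *
          (∫⁻ x, (∫⁻ z, M x z * ‖f z‖ₑ ∂μ) ^ r ∂μ) ^ (1 / r)) := by
          gcongr
          exact ENNReal.lintegral_mul_le_Lp_mul_Lq μ hpq.symm mφ.enorm.aemeasurable m2.aemeasurable
      _ ≤ B * ((∫⁻ x, ‖φ x‖ₑ ^ q ∂μ) ^ (1 / q) * (A * ∫⁻ z, ‖f z‖ₑ ^ r ∂μ) ^ (1 / r)) := by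
          gcongr
          exact hAg _ mf.enorm
      _ < ∞ := by
          have l1 : ∫⁻ x, ‖φ x‖ₑ ^ q ∂μ < ∞ := by
            have := lintegral_rpow_enorm_lt_top_of_eLpNorm_lt_top (p := ENNReal.ofReal q)
              (by simpa using hq0) ENNReal.ofReal_ne_top (testFunction_memLp φ _).2
            rwa [ENNReal.toReal_ofReal hq0.le] at this
          have l2 : ∫⁻ z, ‖f z‖ₑ ^ r ∂μ < ∞ :=
            lintegral_rpow_enorm_lt_top_of_eLpNorm_lt_top (zero_lt_one.trans hp1).ne' hp2.ne
              (Lp.eLpNorm_lt_top f)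
          have := l1.ne
          have := l2.ne
          have : 0 ≤ 1 / q := by positivity
          have : 0 ≤ 1 / r := by positivity
          finiteness
  refine ⟨hI, ?_⟩
  have e1 : ∀ y : (Fin n → ℝ) × (Fin n → ℝ), ∫ t in Ioi 0, (D t y.1 y.2 * φ y.1) • f y.2
      = ((∫ t in Ioi 0, D t y.1 y.2) * φ y.1) • f y.2 := fun y => by
    rw [integral_smul_const, integral_mul_const]
  have hI2 := hI.integral_prod_right
  simp only [e1] at hI2
  rw [integral_integral_swap hI]
  simp_rw [e1]
  rw [integral_prod _ hI2]
  refine integral_congr_ae ?_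
  filter_upwards [hT f] with x hx
  rw [hx, ← integral_smul]
  congr 1
  funext z
  rw [smul_smul, mul_comm]

/-! ### The Riesz transforms as integrals over the heat semigroup -/

lemma integrable_heatProd_smul {ν : Fin n → ℝ} (hν : ∀ j, -(1 / 2 : ℝ) < ν j)
    (k : Fin n → ℕ) {t : ℝ} (ht : 0 < t) (φ : 𝓓(orthant n, ℝ)) {f : (Fin n → ℝ) → ℂ}
    (hfm : Measurable f) (hf : MemLp f 2 (orthantMeasure n)) :
    Integrable (fun y : (Fin n → ℝ) × (Fin n → ℝ) => (heatProd ν k t y.1 y.2 * φ y.1) • f y.2)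
      ((orthantMeasure n).prod (orthantMeasure n)) := by
  obtain ⟨C, hC0, hC⟩ := abs_heatProd_le hν k
  have mh : Measurable fun p : (Fin n → ℝ) × (Fin n → ℝ) => heatProd ν k t p.1 p.2 :=
    (measurable_heatProd ν k).comp (f := fun p => (t, p)) (by fun_prop)
  have mφ : Measurable φ := φ.continuous.measurable
  have hst : 0 ≤ (√t)⁻¹ ^ (∑ j, k j) := by positivity
  refine ⟨Measurable.aestronglyMeasurable (by fun_prop), ?_⟩
  have ha1 : ∀ᵐ p ∂((orthantMeasure n).prod (orthantMeasure n)), ∀ j, 0 < p.1 j :=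
    Measure.quasiMeasurePreserving_fst.ae (ae_orthant n)
  have ha2 : ∀ᵐ p ∂((orthantMeasure n).prod (orthantMeasure n)), ∀ j, 0 < p.2 j :=
    Measure.quasiMeasurePreserving_snd.ae (ae_orthant n)
  have mg : Measurable fun p : (Fin n → ℝ) × (Fin n → ℝ) => gaussProd t p.1 p.2 :=
    (measurable_gaussProd n).comp (f := fun p => (t, p)) (by fun_prop)
  have l2 : ∀ {F : Type} [NormedAddCommGroup F] {u : (Fin n → ℝ) → F},
      MemLp u 2 (orthantMeasure n) → ∫⁻ x, ‖u x‖ₑ ^ 2 ∂orthantMeasure n < ∞ := by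
    intro F _ u hu
    simpa using lintegral_rpow_enorm_lt_top_of_eLpNorm_lt_top two_ne_zero ENNReal.ofNat_ne_top hu.2
  calc _ ≤ ∫⁻ p, ENNReal.ofReal (C * (√t)⁻¹ ^ (∑ j, k j)) *
        (ENNReal.ofReal (gaussProd t p.1 p.2) * ‖φ p.1‖ₑ ^ 2
          + ENNReal.ofReal (gaussProd t p.1 p.2) * ‖f p.2‖ₑ ^ 2)
          ∂((orthantMeasure n).prod (orthantMeasure n)) := by
        refine lintegral_mono_ae ?_
        filter_upwards [ha1, ha2] with p h1 h2
        rw [enorm_smul, enorm_mul, Real.enorm_eq_ofReal_abs, ← mul_add, ← mul_assoc,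
          ← ENNReal.ofReal_mul (by positivity), mul_assoc]
        gcongr
        · exact hC t _ _ ht h1 h2
        · exact ENNReal_mul_le_sq_add_sq _ _
    _ ≤ ENNReal.ofReal (C * (√t)⁻¹ ^ (∑ j, k j)) * (ENNReal.ofReal √(8 * Real.pi) ^ n *
        ∫⁻ x, ‖φ x‖ₑ ^ 2 ∂orthantMeasure n + ENNReal.ofReal √(8 * Real.pi) ^ n *
        ∫⁻ x, ‖f x‖ₑ ^ 2 ∂orthantMeasure n) := by
        rw [lintegral_const_mul _ (by fun_prop), lintegral_add_left (by fun_prop)]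
        gcongr
        · exact lintegral_gaussProd_mul_le ht (by fun_prop)
        · rw [← lintegral_prod_swap]
          simp only [Prod.fst_swap, Prod.snd_swap]
          simp_rw [gaussProd_comm t (Prod.snd _)]
          exact lintegral_gaussProd_mul_le ht (by fun_prop)
    _ < ∞ := by
        have := (l2 (testFunction_memLp φ 2)).ne
        have := (l2 hf).ne
        finiteness

/-- The pairing `⟨δ_ν^k e^(-tΔ_ν) f, φ⟩`, in terms of the Hankel transform `h` of `f` and in terms
of the heat kernel. -/
lemma integral_gaussian_hankelTest_deltaAdjPow {ν : Fin n → ℝ} (hν : ∀ j, -(1 / 2 : ℝ) < ν j)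
    (k : Fin n → ℕ) {t : ℝ} (ht : 0 < t) {f h : (Fin n → ℝ) → ℂ} (hfm : Measurable f)
    (hfh : IsHankelTransform ν f h) (φ : 𝓓(orthant n, ℝ)) :
    ∫ y, (Real.exp (-t * ∑ j, y j ^ 2) * hankelTest ν (deltaAdjPowTest ν k φ) y) • h y
        ∂orthantMeasure n
      = ∫ y : (Fin n → ℝ) × (Fin n → ℝ), (heatProd ν k t y.1 y.2 * φ y.1) • f y.2
        ∂((orthantMeasure n).prod (orthantMeasure n)) := by
  rw [integral_gaussian_hankelTest_smul hν ht hfh,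
    integral_prod_symm _ (integrable_heatProd_smul hν k ht φ hfm hfh.1)]
  refine integral_congr_ae ?_
  filter_upwards [ae_orthant n] with z hz
  rw [integral_heatProd_mul_deltaAdjPow hν k ht hz, integral_smul_const]

lemma rieszTransform_eq {ν : Fin n → ℝ} {k : Fin n → ℕ} {f : (Fin n → ℝ) → ℂ}
    {R : 𝓓(orthant n, ℝ) → ℂ} (hR : IsRieszTransform ν k f R) :
    ∃ h : (Fin n → ℝ) → ℂ, IsHankelTransform ν f h ∧
      MemLp (fun y => ((∑ j, y j ^ 2) ^ (-(((∑ j, k j : ℕ) : ℝ) / 2))) • h y) 2 (orthantMeasure n) ∧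
      ∀ φ, R φ = ∫ y, hankelTest ν (deltaAdjPowTest ν k φ) y •
        (((∑ j, y j ^ 2) ^ (-(((∑ j, k j : ℕ) : ℝ) / 2))) • h y) ∂orthantMeasure n := by
  obtain ⟨g, ⟨h, hfh, hhg⟩, rfl⟩ := hR
  refine ⟨h, hfh, hhg.1, fun φ => ?_⟩
  rw [← hhg.2.2, coe_deltaAdjPowTest, deltaPowDist]

lemma sum_sq_pos_of_orthant (hn : 1 ≤ n) {y : Fin n → ℝ} (hy : ∀ j, 0 < y j) :
    0 < ∑ j, y j ^ 2 :=
  Finset.sum_pos (fun j _ => by have := hy j; positivity) ⟨⟨0, hn⟩, Finset.mem_univ _⟩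

/-- Subordination: `∫_0^∞ t^(s-1) e^(-t|y|²) dt = Γ(s) |y|^(-2s)` under an absolutely convergent
integral over `y`. -/
lemma integral_rpow_smul_gaussian (hn : 1 ≤ n) {s : ℝ} (hs : 0 < s) {u : (Fin n → ℝ) → ℝ}
    {h : (Fin n → ℝ) → ℂ} (hu : MemLp u 2 (orthantMeasure n)) (hh : MemLp h 2 (orthantMeasure n))
    (hsh : MemLp (fun y => ((∑ j, y j ^ 2) ^ (-s)) • h y) 2 (orthantMeasure n)) :
    IntegrableOn (fun t : ℝ => t ^ (s - 1) •
        ∫ y, (Real.exp (-t * ∑ j, y j ^ 2) * u y) • h y ∂orthantMeasure n) (Ioi 0) ∧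
      ∫ t in Ioi 0, (t : ℝ) ^ (s - 1) •
        ∫ y, (Real.exp (-t * ∑ j, y j ^ 2) * u y) • h y ∂orthantMeasure n
      = Real.Gamma s • ∫ y, u y • (((∑ j, y j ^ 2) ^ (-s)) • h y) ∂orthantMeasure n := by
  set F : ℝ × (Fin n → ℝ) → ℂ := fun w =>
    (w.1 ^ (s - 1) * (Real.exp (-w.1 * ∑ j, w.2 j ^ 2) * u w.2)) • h w.2 with hF
  have mF : AEStronglyMeasurable F ((volume.restrict (Ioi 0)).prod (orthantMeasure n)) := by
    have m1 : Measurable fun w : ℝ × (Fin n → ℝ) => w.1 ^ (s - 1) := by fun_prop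
    have m2 : Measurable fun w : ℝ × (Fin n → ℝ) => Real.exp (-w.1 * ∑ j, w.2 j ^ 2) := by fun_prop
    exact (m1.aestronglyMeasurable.mul (m2.aestronglyMeasurable.mul hu.1.comp_snd)).smul
      hh.1.comp_snd
  have e0 : ∀ y : Fin n → ℝ, (∀ j, 0 < y j) → ∀ t : ℝ, F (t, y)
      = (t ^ (s - 1) * Real.exp (-((∑ j, y j ^ 2) * t))) • (u y • h y) := fun y hy t => by
    simp only [hF]
    rw [smul_smul, neg_mul, mul_comm t, mul_assoc]
  have e1 : ∀ y : Fin n → ℝ, (∀ j, 0 < y j) → ∫ t in Ioi 0, t ^ (s - 1) *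
      Real.exp (-((∑ j, y j ^ 2) * t)) = Real.Gamma s * (∑ j, y j ^ 2) ^ (-s) := fun y hy => by
    have ha := sum_sq_pos_of_orthant hn hy
    rw [Real.integral_rpow_mul_exp_neg_mul_Ioi hs ha, one_div, Real.inv_rpow ha.le,
      Real.rpow_neg ha.le, mul_comm]
  have e1i : ∀ y : Fin n → ℝ, (∀ j, 0 < y j) → IntegrableOn (fun t => t ^ (s - 1) *
      Real.exp (-((∑ j, y j ^ 2) * t))) (Ioi 0) := fun y hy => by
    have ha := sum_sq_pos_of_orthant hn hy
    by_contra hcon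
    have := integral_undef hcon
    rw [e1 y hy] at this
    have h2 := Real.Gamma_pos_of_pos hs
    have : 0 < Real.Gamma s * (∑ j, y j ^ 2) ^ (-s) := by positivity
    linarith
  have hI : Integrable F ((volume.restrict (Ioi 0)).prod (orthantMeasure n)) := by
    refine (integrable_prod_iff' mF).2 ⟨?_, ?_⟩
    · filter_upwards [ae_orthant n] with y hy
      simp_rw [e0 y hy]
      exact (e1i y hy).smul_const _
    · have hg : Integrable (fun y => Real.Gamma s * ‖u y • (((∑ j, y j ^ 2) ^ (-s)) • h y)‖)
          (orthantMeasure n) := (memLp_one_iff_integrable.1 (hsh.smul hu)).norm.const_mul _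
      refine hg.congr ?_
      filter_upwards [ae_orthant n] with y hy
      have ha := sum_sq_pos_of_orthant hn hy
      have e2 : ∀ t ∈ Ioi (0 : ℝ), ‖F (t, y)‖
          = t ^ (s - 1) * Real.exp (-((∑ j, y j ^ 2) * t)) * ‖u y • h y‖ := fun t ht => by
        have ht : 0 < t := ht
        rw [e0 y hy, norm_smul, Real.norm_of_nonneg (by positivity)]
      rw [setIntegral_congr_fun measurableSet_Ioi e2, integral_mul_const, e1 y hy, norm_smul,
        norm_smul, norm_smul, Real.norm_of_nonneg (by positivity : 0 ≤ (∑ j, y j ^ 2) ^ (-s))]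
      ring
  have e3 : ∀ t : ℝ, ∫ y, F (t, y) ∂orthantMeasure n = t ^ (s - 1) •
      ∫ y, (Real.exp (-t * ∑ j, y j ^ 2) * u y) • h y ∂orthantMeasure n := fun t => by
    rw [← integral_smul]
    simp only [hF, mul_smul]
  refine ⟨?_, ?_⟩
  · have := hI.integral_prod_left
    simp_rw [e3] at this
    exact this
  · simp_rw [← e3]
    rw [integral_integral_swap (f := fun t y => F (t, y)) hI, ← integral_smul]
    refine integral_congr_ae ?_
    filter_upwards [ae_orthant n] with y hy
    simp_rw [e0 y hy]
    rw [integral_smul_const, e1 y hy, smul_smul, smul_smul, smul_smul]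
    congr 1
    ring

open Filter Topology in
/-- A function that is integrable near `0` cannot be asymptotic to `c / t`. -/
lemma eq_zero_of_integrableOn_of_tendsto {J : ℝ → ℂ} (hJ : IntegrableOn J (Ioi 0)) {c : ℂ}
    (hc : Tendsto (fun t : ℝ => t • J t) (𝓝[>] 0) (𝓝 c)) : c = 0 := by
  by_contra h0
  have hc0 : 0 < ‖c‖ := norm_pos_iff.2 h0
  have h1 := (hc.norm).eventually (lt_mem_nhds (half_lt_self hc0))
  obtain ⟨ε, hε, hε'⟩ := mem_nhdsGT_iff_exists_Ioc_subset.1 h1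
  have hε : 0 < ε := hε
  have h2 : IntegrableOn (fun t : ℝ => ‖c‖ / 2 * t⁻¹) (Ioc 0 ε) := by
    refine Integrable.mono (hJ.mono_set Ioc_subset_Ioi_self)
      (Measurable.aestronglyMeasurable (by fun_prop)) ?_
    filter_upwards [ae_restrict_mem measurableSet_Ioc] with t ht
    have ht0 : 0 < t := ht.1
    have h3 : ‖c‖ / 2 < ‖t • J t‖ := hε' ht
    rw [norm_smul, Real.norm_of_nonneg ht0.le] at h3
    rw [Real.norm_of_nonneg (by positivity), ← div_eq_mul_inv, div_le_iff₀ ht0]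
    linarith
  have h4 : IntegrableOn (fun t : ℝ => t⁻¹) (Ioc 0 ε) := by
    refine (h2.const_mul (‖c‖ / 2)⁻¹).congr (Eventually.of_forall fun t => ?_)
    simp only
    rw [inv_mul_cancel_left₀ (by positivity)]
  rw [← intervalIntegrable_iff_integrableOn_Ioc_of_le hε.le, intervalIntegrable_inv_iff] at h4
  rcases h4 with h4 | h4
  · exact hε.ne h4
  · exact h4 left_mem_uIcc

open Filter Topology in
lemma tendsto_integral_gaussian_smul {u : (Fin n → ℝ) → ℝ}
    {h : (Fin n → ℝ) → ℂ} (hu : MemLp u 2 (orthantMeasure n)) (hh : MemLp h 2 (orthantMeasure n)) :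
    Tendsto (fun t : ℝ => ∫ y, (Real.exp (-t * ∑ j, y j ^ 2) * u y) • h y ∂orthantMeasure n)
      (𝓝[>] 0) (𝓝 (∫ y, u y • h y ∂orthantMeasure n)) := by
  have hi : Integrable (fun y => u y • h y) (orthantMeasure n) :=
    memLp_one_iff_integrable.1 (hh.smul hu)
  refine tendsto_integral_filter_of_dominated_convergence (fun y => ‖u y • h y‖) ?_ ?_ hi.norm ?_
  · refine Eventually.of_forall fun t => AEStronglyMeasurable.smul
      (AEStronglyMeasurable.mul (Continuous.aestronglyMeasurable (by fun_prop)) hu.1) hh.1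
  · filter_upwards [self_mem_nhdsWithin] with t ht
    have ht : 0 < t := ht
    refine Eventually.of_forall fun y => ?_
    rw [mul_smul, norm_smul, Real.norm_of_nonneg (Real.exp_pos _).le]
    refine mul_le_of_le_one_left (norm_nonneg _) (Real.exp_le_one_iff.2 ?_)
    have : 0 ≤ ∑ j, y j ^ 2 := Finset.sum_nonneg fun j _ => sq_nonneg _
    nlinarith
  · refine Eventually.of_forall fun y => ?_
    have hc : Continuous fun t : ℝ => (Real.exp (-t * ∑ j, y j ^ 2) * u y) • h y := by fun_prop
    have := (hc.tendsto 0).mono_left (nhdsWithin_le_nhds (s := Ioi 0))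
    simpa using this

/-- The difference of two Riesz transforms as an integral over the heat semigroups. For `|k| = 0`
both sides vanish, the right one because `1 / Γ(0) = 0` here. -/
lemma rieszTransform_sub_eq (hn : 1 ≤ n) {ν μ : Fin n → ℝ} (hν : ∀ j, -(1 / 2 : ℝ) < ν j)
    (hμ : ∀ j, -(1 / 2 : ℝ) < μ j) {k : Fin n → ℕ} {f : (Fin n → ℝ) → ℂ} (hfm : Measurable f)
    {R R' : 𝓓(orthant n, ℝ) → ℂ} (hR : IsRieszTransform ν k f R) (hR' : IsRieszTransform μ k f R')
    (φ : 𝓓(orthant n, ℝ))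
    (hI : Integrable (fun w : ℝ × (Fin n → ℝ) × (Fin n → ℝ) =>
        (diffIntegrand ν μ k w.1 w.2.1 w.2.2 * φ w.2.1) • f w.2.2)
      ((volume.restrict (Ioi 0)).prod ((orthantMeasure n).prod (orthantMeasure n)))) :
    R φ - R' φ = (Real.Gamma (((∑ j, k j : ℕ) : ℝ) / 2))⁻¹ •
      ∫ t in Ioi 0, ∫ y : (Fin n → ℝ) × (Fin n → ℝ),
        (diffIntegrand ν μ k t y.1 y.2 * φ y.1) • f y.2
          ∂((orthantMeasure n).prod (orthantMeasure n)) := by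
  obtain ⟨h, hfh, hsh, hRφ⟩ := rieszTransform_eq hR
  obtain ⟨h', hfh', hsh', hRφ'⟩ := rieszTransform_eq hR'
  rw [hRφ, hRφ']
  set s : ℝ := ((∑ j, k j : ℕ) : ℝ) / 2 with hs
  have hu := hankelTest_memLp hν (deltaAdjPowTest ν k φ)
  have hu' := hankelTest_memLp hμ (deltaAdjPowTest μ k φ)
  have hdiff : ∀ t : ℝ, 0 < t → ∫ y : (Fin n → ℝ) × (Fin n → ℝ),
        (diffIntegrand ν μ k t y.1 y.2 * φ y.1) • f y.2
          ∂((orthantMeasure n).prod (orthantMeasure n))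
      = t ^ (s - 1) • ((∫ y, (Real.exp (-t * ∑ j, y j ^ 2) *
          hankelTest ν (deltaAdjPowTest ν k φ) y) • h y ∂orthantMeasure n) -
        ∫ y, (Real.exp (-t * ∑ j, y j ^ 2) *
          hankelTest μ (deltaAdjPowTest μ k φ) y) • h' y ∂orthantMeasure n) := fun t ht => by
    rw [integral_gaussian_hankelTest_deltaAdjPow hν k ht hfm hfh,
      integral_gaussian_hankelTest_deltaAdjPow hμ k ht hfm hfh',
      ← integral_sub (integrable_heatProd_smul hν k ht φ hfm hfh.1)
        (integrable_heatProd_smul hμ k ht φ hfm hfh.1), ← integral_smul]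
    congr 1
    funext y
    rw [diffIntegrand, ← sub_smul, smul_smul]
    congr 1
    ring
  rcases (∑ j, k j).eq_zero_or_pos with h0 | h0
  -- Here `Γ(0)⁻¹ = 0`. The integrand in `t`, multiplied by `t`, tends to `R φ - R' φ` as `t → 0`;
  -- since it is integrable, this limit must be zero.
  · have hs0 : s = 0 := by rw [hs, h0]; simp
    have hJ := hI.integral_prod_left
    have key := eq_zero_of_integrableOn_of_tendsto hJ
      (((tendsto_integral_gaussian_smul hu hfh.2.1).sub
        (tendsto_integral_gaussian_smul hu' hfh'.2.1)).congr' ?_)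
    · rw [hs0, Real.Gamma_zero, inv_zero, zero_smul]
      simpa using key
    · filter_upwards [self_mem_nhdsWithin] with t ht
      have ht : 0 < t := ht
      rw [hdiff t ht, hs0, smul_smul, zero_sub, Real.rpow_neg_one, mul_inv_cancel₀ ht.ne', one_smul]
  · have hs0 : 0 < s := by rw [hs]; positivity
    obtain ⟨i1, e1⟩ := integral_rpow_smul_gaussian hn hs0 hu hfh.2.1 hsh
    obtain ⟨i2, e2⟩ := integral_rpow_smul_gaussian hn hs0 hu' hfh'.2.1 hsh'
    rw [setIntegral_congr_fun measurableSet_Ioi fun t ht => hdiff t ht]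
    simp_rw [smul_sub]
    rw [integral_sub i1 i2, e1, e2, smul_sub, smul_smul, smul_smul,
      inv_mul_cancel₀ (Real.Gamma_pos_of_pos hs0).ne', one_smul, one_smul]

/-! ### Test functions with vanishing moments in one variable -/

lemma map_mul_volume {D : Fin n → ℝ} (hD : ∀ j, 0 < D j) :
    (volume : Measure (Fin n → ℝ)).map (fun x => D * x) = ENNReal.ofReal (∏ j, D j)⁻¹ • volume := by
  have hP : 0 < ∏ j, D j := Finset.prod_pos fun j _ => hD j
  have h := Real.smul_map_diagonal_volume_pi (D := D) (by rw [Matrix.det_diagonal]; exact hP.ne')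
  have e : ⇑(Matrix.toLin' (Matrix.diagonal D)) = fun x => D * x := by
    funext x
    ext j
    simp [Matrix.mulVec_diagonal]
  rw [Matrix.det_diagonal, abs_of_pos hP, e] at h
  nth_rewrite 2 [← h]
  rw [smul_smul, ← ENNReal.ofReal_mul (by positivity), inv_mul_cancel₀ hP.ne', ENNReal.ofReal_one,
    one_smul]

/-- The dilation `x ↦ D x` of the coordinates. -/
noncomputable def dilation (D : Fin n → ℝ) (hD : ∀ j, 0 < D j) : (Fin n → ℝ) ≃ₜ (Fin n → ℝ) :=
  Homeomorph.piCongrRight fun j => Homeomorph.mulLeft₀ (D j) (hD j).ne'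

lemma coe_dilation (D : Fin n → ℝ) (hD : ∀ j, 0 < D j) : ⇑(dilation D hD) = fun x => D * x := rfl

lemma integral_comp_dilation {D : Fin n → ℝ} (hD : ∀ j, 0 < D j) (F : (Fin n → ℝ) → ℝ) :
    ∫ x, F (D * x) = (∏ j, D j)⁻¹ * ∫ x, F x := by
  have hP : 0 < ∏ j, D j := Finset.prod_pos fun j _ => hD j
  have h := (dilation D hD).measurableEmbedding.integral_map (μ := volume) F
  rw [coe_dilation, map_mul_volume hD, integral_smul_measure,
    ENNReal.toReal_ofReal (by positivity)] at h
  exact h.symm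

/-- The test function `x ↦ φ (D x)`. -/
noncomputable def dilateTest (D : Fin n → ℝ) (hD : ∀ j, 0 < D j) (φ : 𝓓(orthant n, ℝ)) :
    𝓓(orthant n, ℝ) where
  toFun x := φ (D * x)
  contDiff' := φ.contDiff.comp (by
    rw [contDiff_pi]
    intro j
    exact contDiff_const.mul (contDiff_apply ℝ ℝ j))
  hasCompactSupport' := φ.hasCompactSupport.comp_homeomorph (dilation D hD)
  tsupport_subset' := fun x hx j => by
    have h := φ.tsupport_subset (tsupport_comp_subset_preimage φ (dilation D hD).continuous hx) j
    exact (mul_pos_iff_of_pos_left (hD j)).1 h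

lemma dilateTest_apply (D : Fin n → ℝ) (hD : ∀ j, 0 < D j) (φ : 𝓓(orthant n, ℝ)) (x : Fin n → ℝ) :
    dilateTest D hD φ x = φ (D * x) := rfl

lemma eLpNorm_testFunction (φ : 𝓓(orthant n, ℝ)) (p : ℝ≥0∞) :
    eLpNorm φ p (orthantMeasure n) = eLpNorm φ p volume :=
  eLpNorm_restrict_eq_of_support_subset ((subset_tsupport _).trans φ.tsupport_subset)

lemma eLpNorm_dilateTest {D : Fin n → ℝ} (hD : ∀ j, 0 < D j) (φ : 𝓓(orthant n, ℝ)) {p : ℝ≥0∞}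
    (hp : p ≠ ∞) : eLpNorm (dilateTest D hD φ) p (orthantMeasure n)
      = ENNReal.ofReal (∏ j, D j)⁻¹ ^ (1 / p).toReal * eLpNorm φ p (orthantMeasure n) := by
  have h := (dilation D hD).measurableEmbedding.eLpNorm_map_measure (μ := volume) (g := φ) (p := p)
  rw [coe_dilation, map_mul_volume hD, eLpNorm_smul_measure_of_ne_top hp] at h
  rw [eLpNorm_testFunction, eLpNorm_testFunction]
  exact h.symm

/-- The moment of order `β` of `φ` in the variable `x_i` vanishes, for almost all values of the
other variables. This is tested against functions `G` of the other variables. -/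
def MomentVanishes (i : Fin n) (β : ℝ) (φ : 𝓓(orthant n, ℝ)) : Prop :=
  ∀ G : (Fin n → ℝ) → ℝ, ContinuousOn G (orthant n) →
    (∀ x c, G (Function.update x i c) = G x) →
      ∫ x, (x i ^ β * G x) * φ x ∂orthantMeasure n = 0

/-- The vector of dilation factors that is `c` at `i` and `1` elsewhere. -/
def scaleVec (i : Fin n) (c : ℝ) : Fin n → ℝ := Function.update 1 i c

lemma scaleVec_mul (i : Fin n) (c : ℝ) (x : Fin n → ℝ) :
    scaleVec i c * x = Function.update x i (c * x i) := by
  ext j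
  rcases eq_or_ne j i with rfl | h
  · simp [scaleVec]
  · simp [scaleVec, h]

lemma scaleVec_pos (i : Fin n) {c : ℝ} (hc : 0 < c) (j : Fin n) :
    0 < scaleVec i c j := by
  rcases eq_or_ne j i with rfl | h
  · simpa [scaleVec] using hc
  · simp [scaleVec, h]

lemma prod_scaleVec (i : Fin n) (c : ℝ) : ∏ j, scaleVec i c j = c := by
  rw [scaleVec, Finset.prod_update_of_mem (Finset.mem_univ i)]
  simp

/-- A dilation in `x_i` multiplies the moments by a power of the factor. -/
lemma integral_moment_dilateTest (i : Fin n) (β : ℝ) (φ : 𝓓(orthant n, ℝ)) {ρ : ℝ} (hρ : 0 < ρ)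
    {G : (Fin n → ℝ) → ℝ} (hG : ∀ x c, G (Function.update x i c) = G x) :
    ∫ x, (x i ^ β * G x) * dilateTest (scaleVec i ρ⁻¹)
        (scaleVec_pos i (inv_pos.2 hρ)) φ x ∂orthantMeasure n
      = ρ ^ (1 + β) * ∫ x, (x i ^ β * G x) * φ x ∂orthantMeasure n := by
  have hD := scaleVec_pos i (inv_pos.2 hρ)
  rw [integral_orthant_mul_testFunction (fun x => x i ^ β * G x)]
  have e : ∀ x : Fin n → ℝ, (x i ^ β * G x) * dilateTest (scaleVec i ρ⁻¹) hD φ x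
      = (fun x => ((ρ * x i) ^ β * G x) * φ x) (scaleVec i ρ⁻¹ * x) := fun x => by
    simp only [dilateTest_apply]
    have h1 : G (scaleVec i ρ⁻¹ * x) = G x := by rw [scaleVec_mul, hG]
    have h2 : ρ * (scaleVec i ρ⁻¹ * x) i = x i := by
      rw [scaleVec_mul, Function.update_self, mul_inv_cancel_left₀ hρ.ne']
    rw [h1, h2]
  simp_rw [e]
  rw [integral_comp_dilation hD (fun x => ((ρ * x i) ^ β * G x) * φ x), prod_scaleVec, inv_inv,
    ← integral_orthant_mul_testFunction, Real.rpow_add hρ, Real.rpow_one, mul_assoc,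
    ← integral_const_mul (ρ ^ β)]
  congr 1
  refine integral_congr_ae ?_
  filter_upwards [ae_orthant n] with x hx
  rw [Real.mul_rpow hρ.le (hx i).le]
  ring

open Filter Topology in
/-- Test functions whose moments of finitely many positive orders vanish are dense in `L^p`: the
moment of order `β` is killed by `φ - ρ^(-1-β) φ(· / ρ)`, and the correction tends to zero in `L^p`
as `ρ → ∞`. -/
lemma exists_momentVanishes_approx (i : Fin n) {p : ℝ≥0∞} (hp1 : 1 ≤ p) (hp : p ≠ ∞) (l : List ℝ)
    (hl : ∀ β ∈ l, 0 < β) (φ : 𝓓(orthant n, ℝ)) {ε : ℝ} (hε : 0 < ε) :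
    ∃ ψ : 𝓓(orthant n, ℝ), eLpNorm (⇑φ - ⇑ψ) p (orthantMeasure n) ≤ ENNReal.ofReal ε ∧
      ∀ β ∈ l, MomentVanishes i β ψ := by
  induction l generalizing ε with
  | nil => exact ⟨φ, by simp, by simp⟩
  | cons β l ih =>
    obtain ⟨ψ, hψ, hm⟩ := ih (fun b hb => hl b (List.mem_cons_of_mem _ hb)) (half_pos hε)
    have hβ : 0 < β := hl β List.mem_cons_self
    set A := eLpNorm ψ p (orthantMeasure n) with hA
    have hA' : A ≠ ∞ := (testFunction_memLp ψ p).eLpNorm_ne_top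
    set r := (1 / p).toReal with hr
    have hr1 : r ≤ 1 := by
      rw [hr, ← ENNReal.toReal_one]
      exact ENNReal.toReal_mono ENNReal.one_ne_top (by simpa using hp1)
    have hlim : Tendsto (fun ρ : ℝ => ENNReal.ofReal (ρ ^ (-(1 + β - r))) * A) atTop (𝓝 0) := by
      have h1 := ENNReal.tendsto_ofReal (tendsto_rpow_neg_atTop (y := 1 + β - r) (by linarith))
      rw [ENNReal.ofReal_zero] at h1
      simpa using ENNReal.Tendsto.mul_const h1 (Or.inr hA')
    -- The multiple `ρ^(-(1 + β))` of the dilate by `ρ` has the same moment of order `β` as `ψ`, while its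
    -- norm decays like `ρ^(-(1 + β - 1/p))`. Moments that vanish for `ψ` also vanish for the dilate.
    obtain ⟨ρ, hρε, hρ⟩ := ((hlim.eventually (gt_mem_nhds
      (ENNReal.ofReal_pos.2 (half_pos hε)))).and (eventually_gt_atTop 0)).exists
    set χ := dilateTest (scaleVec i ρ⁻¹) (scaleVec_pos i (inv_pos.2 hρ)) ψ with hχ
    have hcoe : ⇑(ψ - ρ ^ (-(1 + β)) • χ) = ⇑ψ - ρ ^ (-(1 + β)) • ⇑χ := rfl
    refine ⟨ψ - ρ ^ (-(1 + β)) • χ, ?_, ?_⟩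
    · have hn : eLpNorm (ρ ^ (-(1 + β)) • ⇑χ) p (orthantMeasure n)
          = ENNReal.ofReal (ρ ^ (-(1 + β - r))) * A := by
        rw [eLpNorm_const_smul, hχ, eLpNorm_dilateTest _ _ hp, prod_scaleVec, inv_inv, ← hA,
          Real.enorm_of_nonneg (by positivity), ← hr, ENNReal.ofReal_rpow_of_pos hρ, ← mul_assoc,
          ← ENNReal.ofReal_mul (by positivity), ← Real.rpow_add hρ]
        congr 3
        ring
      rw [hcoe, show ⇑φ - (⇑ψ - ρ ^ (-(1 + β)) • ⇑χ) = (⇑φ - ⇑ψ) + ρ ^ (-(1 + β)) • ⇑χ by abel]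
      refine (eLpNorm_add_le (φ.continuous.sub ψ.continuous).aestronglyMeasurable
        (χ.continuous.const_smul _).aestronglyMeasurable hp1).trans ?_
      rw [hn, ← add_halves ε, ENNReal.ofReal_add (half_pos hε).le (half_pos hε).le]
      exact add_le_add hψ hρε.le
    · intro b hb G hG hGi
      have hc : ContinuousOn (fun x : Fin n → ℝ => x i ^ b * G x) (orthant n) :=
        ((continuous_apply i).continuousOn.rpow_const fun x hx => Or.inl (hx i).ne').mul hG
      have i1 : Integrable (fun x => (x i ^ b * G x) * ψ x) (orthantMeasure n) :=
        (integrable_mul_testFunction hc ψ).restrict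
      have i2 : Integrable (fun x => (x i ^ b * G x) * χ x) (orthantMeasure n) :=
        (integrable_mul_testFunction hc χ).restrict
      have e : ∀ x, (x i ^ b * G x) * (ψ - ρ ^ (-(1 + β)) • χ) x
          = (x i ^ b * G x) * ψ x - ρ ^ (-(1 + β)) * ((x i ^ b * G x) * χ x) := fun x => by
        rw [hcoe, Pi.sub_apply, Pi.smul_apply, smul_eq_mul]
        ring
      simp_rw [e]
      rw [integral_sub i1 (i2.const_mul _), integral_const_mul, hχ,
        integral_moment_dilateTest i b ψ hρ hGi]
      rcases List.mem_cons.1 hb with rfl | hb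
      · rw [← mul_assoc, ← Real.rpow_add hρ, neg_add_cancel, Real.rpow_zero, one_mul, sub_self]
      · rw [hm b hb G hG hGi]
        simp

/-! ### Decay of the Hankel transform at the origin -/

lemma abs_besselEntire_sub_le {ν : ℝ} (hν : -(1 / 2) < ν) (N : ℕ) (w : ℝ) :
    |besselEntire ν w - ∑ m ∈ Finset.range N, besselCoeff ν m * (w / 2) ^ (2 * m)|
      ≤ besselConst ν 1 * (w ^ 2) ^ N * Real.exp (w ^ 2) := by
  have h := hasSum_besselEntire hν w
  have e : besselEntire ν w - ∑ m ∈ Finset.range N, besselCoeff ν m * (w / 2) ^ (2 * m)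
      = ∑' m, besselCoeff ν (m + N) * (w / 2) ^ (2 * (m + N)) := by
    rw [sub_eq_iff_eq_add, ← h.tsum_eq, ← h.summable.sum_add_tsum_nat_add N, add_comm]
  rw [e]
  refine tsum_of_norm_bounded (f := fun m => besselCoeff ν (m + N) * (w / 2) ^ (2 * (m + N)))
    ((hasSum_exp_sq (w ^ 2)).mul_left _) fun m => ?_
  refine (abs_bessel_term_le hν one_pos w (m + N)).trans ?_
  have hB := besselConst_pos hν 1
  rw [mul_assoc, one_mul, pow_add, mul_comm ((w ^ 2) ^ m), mul_div_assoc]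
  gcongr
  exact Nat.le_add_right m N

lemma continuousOn_besselFactor {ν : ℝ} (hν : -(1 / 2) < ν) :
    ContinuousOn (besselFactor ν) (Ioi 0) := by
  unfold besselFactor
  refine Real.continuous_sqrt.continuousOn.mul (ContinuousOn.mul ?_
    (continuous_besselEntire hν).continuousOn)
  exact (continuous_id.div_const 2).continuousOn.rpow_const fun x hx => Or.inl (by
    have : (0 : ℝ) < x := hx
    simp only [id]
    positivity)

/-- The beginning of the expansion of `√w J_ν(w)` in powers of `w`. -/
lemma abs_besselFactor_sub_le {ν : ℝ} (hν : -(1 / 2) < ν) (N : ℕ) :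
    ∃ a : ℕ → ℝ, ∀ R : ℝ, 0 < R → ∃ C, 0 ≤ C ∧ ∀ x y : ℝ, 0 < x → x ≤ R → 0 < y → y ≤ 1 →
      |besselFactor ν (x * y) - ∑ m ∈ Finset.range N, a m * (x * y) ^ (2 * (m : ℝ) + ν + 1 / 2)|
        ≤ C * y ^ N := by
  refine ⟨fun m => besselCoeff ν m / 2 ^ (2 * (m : ℝ) + ν), fun R hR =>
    ⟨R ^ (ν + 1 / 2) / 2 ^ ν * (besselConst ν 1 * (R ^ 2) ^ N * Real.exp (R ^ 2)), ?_,
    fun x y hx hxR hy hy1 => ?_⟩⟩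
  · have := besselConst_pos hν 1
    positivity
  have hB := besselConst_pos hν 1
  have hw : 0 < x * y := mul_pos hx hy
  have hwR : x * y ≤ R := (mul_le_of_le_one_right hx.le hy1).trans hxR
  have e : besselFactor ν (x * y) - ∑ m ∈ Finset.range N, besselCoeff ν m / 2 ^ (2 * (m : ℝ) + ν) *
      (x * y) ^ (2 * (m : ℝ) + ν + 1 / 2) = (x * y) ^ (ν + 1 / 2) / 2 ^ ν * (besselEntire ν (x * y)
        - ∑ m ∈ Finset.range N, besselCoeff ν m * (x * y / 2) ^ (2 * m)) := by
    rw [mul_sub, besselFactor, Real.sqrt_eq_rpow, Real.div_rpow hw.le two_pos.le, Real.rpow_add hw,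
      Finset.mul_sum]
    congr 1
    · ring
    · refine Finset.sum_congr rfl fun m _ => ?_
      rw [Real.rpow_add hw, Real.rpow_add hw, Real.rpow_add two_pos, div_pow,
        show (2 * (m : ℝ)) = ((2 * m : ℕ) : ℝ) by push_cast; ring, Real.rpow_natCast,
        Real.rpow_natCast]
      have : (2 : ℝ) ^ ν ≠ 0 := by positivity
      field_simp
  rw [e, abs_mul, abs_of_pos (by positivity), mul_assoc]
  gcongr
  · linarith
  refine (abs_besselEntire_sub_le hν N (x * y)).trans ?_
  have h1 : ((x * y) ^ 2) ^ N ≤ (R ^ 2) ^ N * y ^ N := by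
    rw [← mul_pow]
    refine pow_le_pow_left₀ (by positivity) ?_ N
    rw [mul_pow]
    refine mul_le_mul (by gcongr) ?_ (by positivity) (by positivity)
    nlinarith
  have h2 : Real.exp ((x * y) ^ 2) ≤ Real.exp (R ^ 2) := by gcongr
  calc besselConst ν 1 * ((x * y) ^ 2) ^ N * Real.exp ((x * y) ^ 2)
      ≤ besselConst ν 1 * ((R ^ 2) ^ N * y ^ N) * Real.exp (R ^ 2) := by gcongr
    _ = _ := by ring

/-- The Hankel transform of a test function vanishes at the origin to the order to which the
moments of the test function vanish. -/
lemma abs_hankelTest_le_pow {ν : Fin n → ℝ} (hν : ∀ j, -(1 / 2 : ℝ) < ν j) (i : Fin n) (N : ℕ)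
    (φ : 𝓓(orthant n, ℝ))
    (hφ : ∀ m < N, MomentVanishes i (2 * (m : ℝ) + ν i + 1 / 2) φ) :
    ∃ C, 0 ≤ C ∧ ∀ y : Fin n → ℝ, (∀ j, 0 < y j ∧ y j ≤ 1) → |hankelTest ν φ y| ≤ C * y i ^ N := by
  obtain ⟨R, hR, hsupp⟩ := testFunction_support_bound φ
  obtain ⟨a, ha⟩ := abs_besselFactor_sub_le (hν i) N
  obtain ⟨A, hA0, hA⟩ := ha R hR
  choose B hB0 hB using fun j => abs_besselFactor_le (hν j) one_pos
  set G : (Fin n → ℝ) → (Fin n → ℝ) → ℝ := fun y x =>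
    ∏ j ∈ Finset.univ.erase i, besselFactor (ν j) (x j * y j) with hG
  set b : ℝ := ∏ j ∈ Finset.univ.erase i, (B j * Real.exp (R ^ 2)) with hb
  have hb0 : 0 ≤ b := Finset.prod_nonneg fun j _ => mul_nonneg (hB0 j) (Real.exp_pos _).le
  refine ⟨A * b * ∫ x, ‖φ x‖ ∂orthantMeasure n, by positivity, fun y hy => ?_⟩
  have hy0 : ∀ j, 0 < y j := fun j => (hy j).1
  have cG : ContinuousOn (G y) (orthant n) := by
    refine continuousOn_finsetProd _ fun j _ => ?_
    exact (continuousOn_besselFactor (hν j)).comp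
      ((continuous_apply j).mul continuous_const).continuousOn fun x hx => mul_pos (hx j) (hy0 j)
  have hGi : ∀ x c, G y (Function.update x i c) = G y x := fun x c =>
    Finset.prod_congr rfl fun j hj => by
      rw [Function.update_of_ne (Finset.ne_of_mem_erase hj)]
  set P : ℝ → ℝ := fun w => ∑ m ∈ Finset.range N, a m * w ^ (2 * (m : ℝ) + ν i + 1 / 2) with hP
  have cm : ∀ m : ℕ, ContinuousOn
      (fun x : Fin n → ℝ => x i ^ (2 * (m : ℝ) + ν i + 1 / 2) * G y x) (orthant n) := fun m =>
    ((continuous_apply i).continuousOn.rpow_const fun x hx => Or.inl (hx i).ne').mul cG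
  have im : ∀ m : ℕ, Integrable (fun x : Fin n → ℝ =>
      (x i ^ (2 * (m : ℝ) + ν i + 1 / 2) * G y x) * φ x) (orthantMeasure n) := fun m =>
    (integrable_mul_testFunction (cm m) φ).restrict
  have eP : (fun x : Fin n → ℝ => P (x i * y i) * G y x * φ x) =ᵐ[orthantMeasure n]
      fun x => ∑ m ∈ Finset.range N, (a m * y i ^ (2 * (m : ℝ) + ν i + 1 / 2)) *
        ((x i ^ (2 * (m : ℝ) + ν i + 1 / 2) * G y x) * φ x) := by
    filter_upwards [ae_orthant n] with x hx
    rw [hP, Finset.sum_mul, Finset.sum_mul]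
    refine Finset.sum_congr rfl fun m _ => ?_
    rw [Real.mul_rpow (hx i).le (hy0 i).le]
    ring
  have iP : Integrable (fun x : Fin n → ℝ => P (x i * y i) * G y x * φ x) (orthantMeasure n) :=
    (integrable_finsetSum _ fun m _ => (im m).const_mul _).congr eP.symm
  have hP0 : ∫ x, P (x i * y i) * G y x * φ x ∂orthantMeasure n = 0 := by
    rw [integral_congr_ae eP, integral_finsetSum _ fun m _ => (im m).const_mul _]
    refine Finset.sum_eq_zero fun m hm => ?_
    rw [integral_const_mul, hφ m (Finset.mem_range.1 hm) (G y) cG hGi, mul_zero]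
  have eH : ∀ x, hankelKernel ν y x = besselFactor (ν i) (x i * y i) * G y x := fun x => by
    rw [hankelKernel, ← Finset.mul_prod_erase _ _ (Finset.mem_univ i)]
  rw [hankelTest_eq ν φ hy0, ← sub_zero (∫ x, hankelKernel ν y x * φ x ∂orthantMeasure n), ← hP0,
    ← integral_sub (integrable_hankelKernel_mul hν φ hy0) iP, ← Real.norm_eq_abs]
  refine (norm_integral_le_of_norm_le ((testFunction_integrable φ).norm.const_mul
    (A * b * y i ^ N)) (Filter.Eventually.of_forall fun x => ?_)).trans_eq ?_
  · by_cases h : φ x = 0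
    · simp [h]
    have hx := hsupp x h
    rw [eH, ← sub_mul, ← sub_mul, norm_mul, norm_mul]
    refine mul_le_mul_of_nonneg_right ?_ (norm_nonneg _)
    rw [mul_right_comm]
    refine mul_le_mul (hA _ _ (hx i).1 (hx i).2 (hy i).1 (hy i).2) ?_ (norm_nonneg _) (by
      have := hy0 i; positivity)
    rw [hG, hb, norm_prod]
    refine Finset.prod_le_prod (fun j _ => norm_nonneg _) fun j _ => ?_
    have hxy := mul_pos (hx j).1 (hy0 j)
    refine (hB j _ hxy).trans (mul_le_mul_of_nonneg_left (Real.exp_le_exp.2 ?_) (hB0 j))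
    rw [one_mul]
    exact pow_le_pow_left₀ hxy.le ((mul_le_of_le_one_right (hx j).1.le (hy j).2).trans (hx j).2) 2
  · rw [integral_const_mul]
    ring

/-! ### Density of the domain -/

lemma integral_ofReal_add_mul_I {X : Type*} [MeasurableSpace X] {μ : Measure X} {w₁ w₂ : X → ℝ}
    (h₁ : Integrable w₁ μ) (h₂ : Integrable w₂ μ) :
    ∫ x, ((w₁ x : ℂ) + (w₂ x : ℂ) * Complex.I) ∂μ
      = ((∫ x, w₁ x ∂μ : ℝ) : ℂ) + ((∫ x, w₂ x ∂μ : ℝ) : ℂ) * Complex.I := by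
  have a₁ : Integrable (fun x => (w₁ x : ℂ)) μ := h₁.ofReal
  have a₂ : Integrable (fun x => (w₂ x : ℂ)) μ := h₂.ofReal
  rw [integral_add a₁ (a₂.mul_const _), integral_mul_const, integral_complex_ofReal,
    integral_complex_ofReal]

lemma memLp_ofReal_add_mul_I {X : Type*} [MeasurableSpace X] {μ : Measure X} {p : ℝ≥0∞}
    {w₁ w₂ : X → ℝ} (h₁ : MemLp w₁ p μ) (h₂ : MemLp w₂ p μ) :
    MemLp (fun x => (w₁ x : ℂ) + (w₂ x : ℂ) * Complex.I) p μ := by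
  have a₁ : MemLp (fun x => (w₁ x : ℂ)) p μ := h₁.ofReal
  have a₂ : MemLp (fun x => (w₂ x : ℂ)) p μ := h₂.ofReal
  exact a₁.add (a₂.mul_const Complex.I)

lemma isHankelTransform_of_real {ν : Fin n → ℝ} (hν : ∀ j, -(1 / 2 : ℝ) < ν j)
    {u₁ u₂ v₁ v₂ : (Fin n → ℝ) → ℝ} (hu₁ : MemLp u₁ 2 (orthantMeasure n))
    (hu₂ : MemLp u₂ 2 (orthantMeasure n)) (hv₁ : MemLp v₁ 2 (orthantMeasure n))
    (hv₂ : MemLp v₂ 2 (orthantMeasure n))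
    (h₁ : ∀ χ : 𝓓(orthant n, ℝ), ∫ y, χ y * v₁ y ∂orthantMeasure n
      = ∫ x, hankelTest ν χ x * u₁ x ∂orthantMeasure n)
    (h₂ : ∀ χ : 𝓓(orthant n, ℝ), ∫ y, χ y * v₂ y ∂orthantMeasure n
      = ∫ x, hankelTest ν χ x * u₂ x ∂orthantMeasure n) :
    IsHankelTransform ν (fun x => (u₁ x : ℂ) + (u₂ x : ℂ) * Complex.I)
      (fun y => (v₁ y : ℂ) + (v₂ y : ℂ) * Complex.I) := by
  refine ⟨memLp_ofReal_add_mul_I hu₁ hu₂, memLp_ofReal_add_mul_I hv₁ hv₂, fun χ => ?_⟩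
  have hi : ∀ {a b : (Fin n → ℝ) → ℝ}, MemLp a 2 (orthantMeasure n) →
      MemLp b 2 (orthantMeasure n) → Integrable (fun x => a x * b x) (orthantMeasure n) :=
    fun ha hb => memLp_one_iff_integrable.1 (hb.smul ha)
  have e : ∀ a b c : ℝ, a • ((b : ℂ) + (c : ℂ) * Complex.I)
      = ((a * b : ℝ) : ℂ) + ((a * c : ℝ) : ℂ) * Complex.I := fun a b c => by
    rw [Complex.real_smul]
    push_cast
    ring
  simp_rw [e]
  have hχ := testFunction_memLp χ 2
  have hHχ := hankelTest_memLp hν χ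
  rw [integral_ofReal_add_mul_I (hi hχ hv₁) (hi hχ hv₂),
    integral_ofReal_add_mul_I (hi hHχ hu₁) (hi hHχ hu₂), h₁, h₂]

lemma IsHankelTransform.congr {ν : Fin n → ℝ} {f f' h : (Fin n → ℝ) → ℂ}
    (hf : IsHankelTransform ν f h) (e : f =ᵐ[orthantMeasure n] f') : IsHankelTransform ν f' h := by
  refine ⟨hf.1.ae_eq e, hf.2.1, fun χ => (hf.2.2 χ).trans (integral_congr_ae ?_)⟩
  filter_upwards [e] with x hx
  rw [hx]

open Filter Topology in
/-- Every real function in `L²` has a Hankel transform in the weak sense. -/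
lemma exists_weak_hankelTransform {ν : Fin n → ℝ} (hν : ∀ j, -(1 / 2 : ℝ) < ν j)
    {v : (Fin n → ℝ) → ℝ} (hv : MemLp v 2 (orthantMeasure n)) :
    ∃ g : (Fin n → ℝ) → ℝ, MemLp g 2 (orthantMeasure n) ∧
      ∀ χ : 𝓓(orthant n, ℝ), ∫ y, χ y * g y ∂orthantMeasure n
        = ∫ x, hankelTest ν χ x * v x ∂orthantMeasure n := by
  obtain ⟨φ, g, hg, hφ, hHφ⟩ := exists_hankel_approx hν hv
  refine ⟨g, hg, fun χ => ?_⟩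
  have l1 := tendsto_integral_smul_of_L2 (fun m => hankelTest_memLp hν (φ m)) hg
    (testFunction_memLp χ 2) hHφ
  have l2 := tendsto_integral_smul_of_L2 (fun m => testFunction_memLp (φ m) 2) hv
    (hankelTest_memLp hν χ) hφ
  simp only [smul_eq_mul] at l1 l2
  simp_rw [fun m => integral_mul_hankelTest_comm hν (φ m) χ] at l2
  simp_rw [mul_comm (χ _), mul_comm (hankelTest ν χ _)]
  exact tendsto_nhds_unique l1 l2

lemma memLp_rpow_mul_hankelTest (hn : 1 ≤ n) {ν : Fin n → ℝ} (hν : ∀ j, -(1 / 2 : ℝ) < ν j)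
    (i : Fin n) (N : ℕ) (φ : 𝓓(orthant n, ℝ))
    (hφ : ∀ m < N, MomentVanishes i (2 * (m : ℝ) + ν i + 1 / 2) φ) :
    MemLp (fun y => (∑ j, y j ^ 2) ^ (-((N : ℝ) / 2)) * hankelTest ν φ y) 2 (orthantMeasure n) := by
  obtain ⟨C, hC0, hC⟩ := abs_hankelTest_le_pow hν i N φ hφ
  have hH := hankelTest_memLp hν φ
  have hB : MemLp ((Icc (0 : Fin n → ℝ) 1).indicator fun _ => C) 2 (orthantMeasure n) :=
    memLp_indicator_const 2 measurableSet_Icc C (Or.inr isCompact_Icc.measure_lt_top.ne)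
  refine (hH.norm.add hB).mono ((Measurable.aestronglyMeasurable (by fun_prop)).mul hH.1) ?_
  filter_upwards [ae_orthant n] with y hy
  have ha := sum_sq_pos_of_orthant hn hy
  set a := ∑ j, y j ^ 2 with ha_def
  have hind : 0 ≤ (Icc (0 : Fin n → ℝ) 1).indicator (fun _ => C) y :=
    indicator_nonneg (fun _ _ => hC0) y
  rw [Pi.add_apply, Real.norm_of_nonneg (add_nonneg (norm_nonneg _) hind), norm_mul,
    Real.norm_of_nonneg (Real.rpow_nonneg ha.le _)]
  have hya : ∀ j, y j ^ 2 ≤ a := fun j =>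
    Finset.single_le_sum (f := fun j => y j ^ 2) (fun j _ => sq_nonneg _) (Finset.mem_univ j)
  rcases le_or_gt 1 a with h1 | h1
  · have : a ^ (-((N : ℝ) / 2)) ≤ 1 :=
      Real.rpow_le_one_of_one_le_of_nonpos h1 (by simp only [Left.neg_nonpos_iff]; positivity)
    nlinarith [norm_nonneg (hankelTest ν φ y)]
  · have hy1 : ∀ j, y j ≤ 1 := fun j => by nlinarith [hya j, hy j]
    have hmem : y ∈ Icc (0 : Fin n → ℝ) 1 := ⟨fun j => (hy j).le, hy1⟩
    rw [indicator_of_mem hmem]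
    have h2 : a ^ (-((N : ℝ) / 2)) ≤ (y i ^ N)⁻¹ := by
      have hyi := hy i
      calc a ^ (-((N : ℝ) / 2)) ≤ (y i ^ 2) ^ (-((N : ℝ) / 2)) :=
            Real.rpow_le_rpow_of_nonpos (by positivity) (hya i)
              (by simp only [Left.neg_nonpos_iff]; positivity)
        _ = (y i ^ N)⁻¹ := by
            rw [← Real.rpow_natCast (y i) 2, ← Real.rpow_mul hyi.le, ← Real.rpow_natCast (y i) N,
              ← Real.rpow_neg hyi.le]
            congr 1
            push_cast
            ring
    have h3 := hC y fun j => ⟨hy j, hy1 j⟩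
    have hpos : 0 < y i ^ N := pow_pos (hy i) N
    calc a ^ (-((N : ℝ) / 2)) * ‖hankelTest ν φ y‖ ≤ (y i ^ N)⁻¹ * (C * y i ^ N) :=
          mul_le_mul h2 h3 (norm_nonneg _) (by positivity)
      _ = C := by field_simp
      _ ≤ _ := le_add_of_nonneg_left (norm_nonneg _)

lemma exists_rieszTransform (hn : 1 ≤ n) {ν : Fin n → ℝ} (hν : ∀ j, -(1 / 2 : ℝ) < ν j)
    (k : Fin n → ℕ) (i : Fin n) {φ₁ φ₂ : 𝓓(orthant n, ℝ)}
    (h₁ : ∀ m < ∑ j, k j, MomentVanishes i (2 * (m : ℝ) + ν i + 1 / 2) φ₁)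
    (h₂ : ∀ m < ∑ j, k j, MomentVanishes i (2 * (m : ℝ) + ν i + 1 / 2) φ₂)
    {f : (Fin n → ℝ) → ℂ}
    (hf : f =ᵐ[orthantMeasure n] fun x => (φ₁ x : ℂ) + (φ₂ x : ℂ) * Complex.I) :
    ∃ R, IsRieszTransform ν k f R := by
  have m₁ := memLp_rpow_mul_hankelTest hn hν i _ φ₁ h₁
  have m₂ := memLp_rpow_mul_hankelTest hn hν i _ φ₂ h₂
  obtain ⟨g₁, hg₁, e₁⟩ := exists_weak_hankelTransform hν m₁
  obtain ⟨g₂, hg₂, e₂⟩ := exists_weak_hankelTransform hν m₂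
  refine ⟨_, _, ⟨_, (isHankelTransform_of_real hν (testFunction_memLp φ₁ 2)
    (testFunction_memLp φ₂ 2) (hankelTest_memLp hν φ₁) (hankelTest_memLp hν φ₂)
    (fun χ => integral_mul_hankelTest_comm hν χ φ₁)
    (fun χ => integral_mul_hankelTest_comm hν χ φ₂)).congr hf.symm,
    (isHankelTransform_of_real hν m₁ m₂ hg₁ hg₂ e₁ e₂).congr
      (Filter.Eventually.of_forall fun y => ?_)⟩, rfl⟩
  simp only [Complex.real_smul]
  push_cast
  ring

/-- The initial domain of the difference is dense in `L^p`: it contains the test functions with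
sufficiently many vanishing moments. -/
lemma dense_differenceDomain (hn : 1 ≤ n) {ν μ : Fin n → ℝ} (hν : ∀ j, -(1 / 2 : ℝ) < ν j)
    (hμ : ∀ j, -(1 / 2 : ℝ) < μ j) (k : Fin n → ℕ) (p : ℝ≥0∞) [Fact (1 ≤ p)] (hp : p ≠ ∞) :
    Dense (differenceDomain ν μ k p) := by
  have hp1 : 1 ≤ p := Fact.out
  set i : Fin n := ⟨0, hn⟩ with hi
  -- The moments to be removed for the two parameters; only the first variable is needed.
  set l : List ℝ := (List.range (∑ j, k j)).map (fun m : ℕ => 2 * (m : ℝ) + ν i + 1 / 2) ++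
    (List.range (∑ j, k j)).map (fun m : ℕ => 2 * (m : ℝ) + μ i + 1 / 2) with hl
  have hlν : ∀ m < ∑ j, k j, 2 * (m : ℝ) + ν i + 1 / 2 ∈ l := fun m hm =>
    List.mem_append_left _ (List.mem_map.2 ⟨m, List.mem_range.2 hm, rfl⟩)
  have hlμ : ∀ m < ∑ j, k j, 2 * (m : ℝ) + μ i + 1 / 2 ∈ l := fun m hm =>
    List.mem_append_right _ (List.mem_map.2 ⟨m, List.mem_range.2 hm, rfl⟩)
  have hlpos : ∀ β ∈ l, 0 < β := fun β hβ => by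
    rcases List.mem_append.1 hβ with h | h <;> obtain ⟨m, -, rfl⟩ := List.mem_map.1 h
    · have := hν i; have := m.cast_nonneg (α := ℝ); linarith
    · have := hμ i; have := m.cast_nonneg (α := ℝ); linarith
  have approx : ∀ u : (Fin n → ℝ) → ℝ, MemLp u p (orthantMeasure n) → ∀ ε : ℝ, 0 < ε →
      ∃ ψ : 𝓓(orthant n, ℝ), eLpNorm (u - ⇑ψ) p (orthantMeasure n) ≤ ENNReal.ofReal ε ∧
        ∀ β ∈ l, MomentVanishes i β ψ := fun u hu ε hε => by
    obtain ⟨φ, hφ⟩ := exists_testFunction_eLpNorm_sub_le hp hp1 hu (half_pos hε)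
    obtain ⟨ψ, hψ, hm⟩ := exists_momentVanishes_approx i hp1 hp l hlpos φ (half_pos hε)
    refine ⟨ψ, ?_, hm⟩
    rw [show u - ⇑ψ = (u - ⇑φ) + (⇑φ - ⇑ψ) by abel]
    refine (eLpNorm_add_le (hu.1.sub φ.continuous.aestronglyMeasurable)
      (φ.continuous.sub ψ.continuous).aestronglyMeasurable hp1).trans ?_
    rw [← add_halves ε, ENNReal.ofReal_add (half_pos hε).le (half_pos hε).le]
    exact add_le_add hφ hψ
  intro f
  rw [Metric.mem_closure_iff]
  intro ε hε
  have hf := Lp.memLp f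
  obtain ⟨ψ₁, hψ₁, hm₁⟩ := approx (fun x => (f x).re) hf.re (ε / 4) (by positivity)
  obtain ⟨ψ₂, hψ₂, hm₂⟩ := approx (fun x => (f x).im) hf.im (ε / 4) (by positivity)
  have hg := memLp_ofReal_add_mul_I (testFunction_memLp ψ₁ p) (testFunction_memLp ψ₂ p)
  refine ⟨hg.toLp, ⟨exists_rieszTransform hn hν k i (fun m hm => hm₁ _ (hlν m hm))
    (fun m hm => hm₂ _ (hlν m hm)) hg.coeFn_toLp, exists_rieszTransform hn hμ k i
      (fun m hm => hm₁ _ (hlμ m hm)) (fun m hm => hm₂ _ (hlμ m hm)) hg.coeFn_toLp⟩, ?_⟩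
  rw [Lp.dist_def, eLpNorm_congr_ae (g := (fun x => (((fun x => (f x).re) - ⇑ψ₁) x : ℂ)) +
    fun x => (((fun x => (f x).im) - ⇑ψ₂) x : ℂ) * Complex.I)]
  · have a₁ : AEStronglyMeasurable ((fun x => (f x).re) - ⇑ψ₁) (orthantMeasure n) :=
      hf.re.1.sub ψ₁.continuous.aestronglyMeasurable
    have a₂ : AEStronglyMeasurable ((fun x => (f x).im) - ⇑ψ₂) (orthantMeasure n) :=
      hf.im.1.sub ψ₂.continuous.aestronglyMeasurable
    have hle : eLpNorm ((fun x => (((fun x => (f x).re) - ⇑ψ₁) x : ℂ)) +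
        fun x => (((fun x => (f x).im) - ⇑ψ₂) x : ℂ) * Complex.I) p (orthantMeasure n)
        ≤ ENNReal.ofReal (ε / 2) := by
      refine (eLpNorm_add_le (Complex.continuous_ofReal.comp_aestronglyMeasurable a₁)
        ((Complex.continuous_ofReal.comp_aestronglyMeasurable a₂).mul_const _) hp1).trans ?_
      rw [show ε / 2 = ε / 4 + ε / 4 by ring, ENNReal.ofReal_add (by positivity) (by positivity)]
      refine add_le_add ((eLpNorm_congr_norm_ae (Filter.Eventually.of_forall fun x => ?_)).trans_le
        hψ₁) ((eLpNorm_congr_norm_ae (Filter.Eventually.of_forall fun x => ?_)).trans_le hψ₂)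
      · rw [Complex.norm_real]
      · rw [norm_mul, Complex.norm_I, mul_one, Complex.norm_real]
    calc _ ≤ (ENNReal.ofReal (ε / 2)).toReal := ENNReal.toReal_mono ENNReal.ofReal_ne_top hle
      _ = ε / 2 := ENNReal.toReal_ofReal (by positivity)
      _ < ε := half_lt_self hε
  · filter_upwards [hg.coeFn_toLp] with x hx
    rw [Pi.sub_apply, hx, Pi.add_apply, Pi.sub_apply, Pi.sub_apply]
    nth_rewrite 1 [← Complex.re_add_im (f x)]
    push_cast
    ring

end BesselRiesz

theorem theorem4p1 {n : ℕ} (hn : 1 ≤ n) (ν : Fin n → ℝ) (hν : ∀ j, -(1 / 2 : ℝ) < ν j)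
    (k α : Fin n → ℕ) (p : ℝ≥0∞) [Fact (1 ≤ p)] (hp1 : 1 < p) (hp2 : p < ∞) :
    Dense (BesselRiesz.differenceDomain ν (fun j => ν j + (α j : ℝ)) k p) ∧
    ∃ T : Lp ℂ p (BesselRiesz.orthantMeasure n) →L[ℂ] Lp ℂ p (BesselRiesz.orthantMeasure n),
      ∀ (f : Lp ℂ p (BesselRiesz.orthantMeasure n)) (R R' : 𝓓(BesselRiesz.orthant n, ℝ) → ℂ),
        BesselRiesz.IsRieszTransform ν k f R →
        BesselRiesz.IsRieszTransform (fun j => ν j + (α j : ℝ)) k f R' →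
        ∀ φ : 𝓓(BesselRiesz.orthant n, ℝ),
          ∫ x, φ x • T f x ∂(BesselRiesz.orthantMeasure n) = R φ - R' φ := by
  have hμ : ∀ j, -(1 / 2 : ℝ) < ν j + (α j : ℝ) := fun j => by
    have := (α j).cast_nonneg (α := ℝ)
    linarith [hν j]
  refine ⟨BesselRiesz.dense_differenceDomain hn hν hμ k p hp2.ne, ?_⟩
  obtain ⟨T, hT⟩ := BesselRiesz.exists_diffOperator hν k α p hp1 hp2
  set c : ℝ := (Real.Gamma (((∑ j, k j : ℕ) : ℝ) / 2))⁻¹ with hc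
  refine ⟨(c : ℂ) • T, fun f R R' hR hR' φ => ?_⟩
  obtain ⟨hI, hTφ⟩ := hT f φ
  rw [BesselRiesz.rieszTransform_sub_eq hn hν hμ (Lp.stronglyMeasurable f).measurable hR hR' φ hI,
    ← hTφ, ← integral_smul]
  refine integral_congr_ae ?_
  filter_upwards [Lp.coeFn_smul (c : ℂ) (T f)] with x hx
  rw [_root_.smul_apply, hx, Pi.smul_apply, smul_comm, Complex.coe_smul]
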